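/- **Setting.** Let $H$ be a real Hilbert space with inner product $(\cdot,\cdot)_H$. For $i=1,2$ let $\varphi^i:H\to(-\infty,\infty]$ be proper, convex and lower semicontinuous, with effective domain $D(\varphi^i)=\{w:\varphi^i(w)<\infty\}$, subdifferential $\partial\varphi^i(z)=\{\xi\in H:\varphi^i(v)-\varphi^i(z)\ge(\xi,v-z)_H\ \forall v\in D(\varphi^i)\}$ for $z\in D(\varphi^i)$, and $D(\partial\varphi^i)=\{w\in D(\varphi^i):\partial\varphi^i(w)\ne\emptyset\}$; for $w\in D(\partial\varphi^i)$ let $\mathring{\partial\varphi^i}(w)$ be the element of least norm of $\partial\varphi^i(w)$. Write $(k*w)(t)=\int_0^t k(t-s)w(s)\,ds$. Consider $$\frac{d}{dt}[k*(u-u_0)](t)+\partial\varphi^1(u(t))-\partial\varphi^2(u(t))\ni f(t)\quad\text{in }H,\ 0<t<T.\tag{P}$$ For $T<\infty$, a function $u\in L^2(0,T;H)$ is a strong solution of (P) on $[0,T]$ if $k*(u-u_0)\in W^{1,2}(0,T;H)$, $[k*(u-u_0)](0)=0$ (for the continuous representative), $u(t)\in D(\partial\varphi^1)\cap D(\partial\varphi^2)$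 for a.e. $t\in(0,T)$, and there are $\xi,\eta\in L^2(0,T;H)$ with $\xi(t)\in\partial\varphi^1(u(t))$, $\eta(t)\in\partial\varphi^2(u(t))$ and $\frac{d}{dt}[k*(u-u_0)](t)+\xi(t)-\eta(t)=f(t)$ for a.e. $t\in(0,T)$. A strong solution on $[0,\infty)$ is defined in the same way with $T=\infty$ and with $L^2_{\rm loc}([0,\infty);H)$ and $W^{1,2}_{\rm loc}([0,\infty);H)$ in place of $L^2$ and $W^{1,2}$. **Assumptions.** - (K) $k,\ell\in L^1_{\rm loc}([0,\infty))$ are nonnegative and nonincreasing, and $(k*\ell)(t)=1$ for all $t>0$. - (A1)′ For each $r\in\mathbb R$ the set $\{w\in H:\varphi^1(w)\le r\}$ is precompact in $H$. - (A2)′ $D(\partial\varphi^1)\subset D(\partial\varphi^2)$ and $\varphi^1\ge0$; and there are $\nu_2\in[0,1)$, a Borel measurable, locally bounded $m_2:[0,\infty)\to[0,\infty)$ and a nondecreasing $M_2:[0,\infty)\to[0,\infty)$ such that $m_2(r)>0$ for $0<r<r_0$ with some $r_0\in(0,\infty]$, $\lim_{r\to0_+}M_2(r)/m_2(r)=0$,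 and for all $w\in D(\partial\varphi^1)$ $$m_2(\varphi^1(w))\le\|\mathring{\partial\varphi^1}(w)\|_H,\qquad \|\mathring{\partial\varphi^2}(w)\|_H\le\nu_2\|\mathring{\partial\varphi^1}(w)\|_H+M_2(\varphi^1(w)).$$ **Theorem (global existence for small data).** Assume (K), (A1)′ and (A2)′. There are a constant $C>0$ depending only on $\nu_2$ and a constant $\delta_0>0$ depending only on $M_2$, $m_2$ and $\nu_2$ such that the following hold. (i) Let $T\in(0,\infty)$. For every $u_0\in D(\varphi^1)$ and $f\in L^2(0,T;H)$ with $$E_T(u_0,f):=\varphi^1(u_0)+\big\|\ell*\|f(\cdot)\|_H^2\big\|_{L^\infty(0,T)}<\delta_0,$$ (P) has a strong solution $u$ on $[0,T]$ with $u\in C([0,T];H)$, $u(0)=u_0$, $\varphi^1(u(\cdot))\in L^\infty(0,T)$ and $\sup_{t\in[0,T]}\varphi^1(u(t))\le C\,E_T(u_0,f)$. (ii) For every $u_0\in D(\varphi^1)$ and $f\in L^2_{\rm loc}([0,\infty);H)$ with $$E_\infty(u_0,f):=\varphi^1(u_0)+\big\|\ell*\|f(\cdot)\|_H^2\big\|_{L^\infty(0,\infty)}<\delta_0,$$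 (P) with $T=\infty$ has a strong solution $u$ on $[0,\infty)$ with $u\in C([0,\infty);H)$, $u(0)=u_0$, $\varphi^1(u(\cdot))\in L^\infty(0,\infty)$ and $\sup_{t\in[0,\infty)}\varphi^1(u(t))\le C\,E_\infty(u_0,f)$. -/

import Mathlib

open MeasureTheory Set Filter Topology
open scoped NNReal ENNReal ContDiff

universe u

namespace FracGradFlow

section Functionals

variable {H : Type u} [NormedAddCommGroup H] [InnerProductSpace ℝ H]

/-- `φ : H → (-∞, ∞]` is proper, convex and lower semicontinuous. -/
structure ProperConvexLSC (φ : H → EReal) : Prop where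
  ne_bot : ∀ w, φ w ≠ ⊥
  proper : ∃ w, φ w < ⊤
  convex : ∀ x y : H, ∀ a b : ℝ, 0 ≤ a → 0 ≤ b → a + b = 1 →
    φ (a • x + b • y) ≤ (a : EReal) * φ x + (b : EReal) * φ y
  lsc : LowerSemicontinuous φ

/-- The effective domain `D(φ)`. -/
def effDom (φ : H → EReal) : Set H := {w | φ w < ⊤}

/-- The subdifferential `∂φ(z)`; it is empty for `z ∉ D(φ)`. -/
def subdiff (φ : H → EReal) (z : H) : Set H :=
  {ξ | z ∈ effDom φ ∧ ∀ v ∈ effDom φ, φ z + ((inner ℝ ξ (v - z) : ℝ) : EReal) ≤ φ v}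

/-- The domain `D(∂φ)`. -/
def subdiffDom (φ : H → EReal) : Set H := {w | w ∈ effDom φ ∧ (subdiff φ w).Nonempty}

/-- `ξ` is an element of `∂φ(w)` of minimal norm. -/
def IsMinimal (φ : H → EReal) (w ξ : H) : Prop :=
  ξ ∈ subdiff φ w ∧ ∀ η ∈ subdiff φ w, ‖ξ‖ ≤ ‖η‖

open Classical in
/-- The minimal section of `∂φ`: the element of minimal norm of `∂φ(w)` for `w ∈ D(∂φ)`
(see `existsUnique_isMinimal`); the value `0` elsewhere is never used. -/
noncomputable def minSection (φ : H → EReal) (w : H) : H :=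
  if h : ∃ ξ, IsMinimal φ w ξ then h.choose else 0

theorem mem_subdiff_iff {φ : H → EReal} (hφ : ProperConvexLSC φ) {z ξ : H} :
    ξ ∈ subdiff φ z ↔ z ∈ effDom φ ∧ ∀ v ∈ effDom φ,
      (φ z).toReal + inner ℝ ξ (v - z) ≤ (φ v).toReal := by
  unfold subdiff
  refine and_congr_right fun hz => forall₂_congr fun v hv => ?_
  have h1 : ((φ z).toReal : EReal) = φ z := EReal.coe_toReal (ne_of_lt hz) (hφ.ne_bot z)
  have h2 : ((φ v).toReal : EReal) = φ v := EReal.coe_toReal (ne_of_lt hv) (hφ.ne_bot v)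
  rw [← EReal.coe_le_coe_iff, EReal.coe_add, h1, h2]

theorem convex_subdiff {φ : H → EReal} (hφ : ProperConvexLSC φ) (z : H) :
    Convex ℝ (subdiff φ z) := by
  intro ξ hξ η hη a b ha hb hab
  rw [mem_subdiff_iff hφ] at hξ hη ⊢
  refine ⟨hξ.1, fun v hv => ?_⟩
  have h1 := mul_le_mul_of_nonneg_left (hξ.2 v hv) ha
  have h2 := mul_le_mul_of_nonneg_left (hη.2 v hv) hb
  rw [inner_add_left, real_inner_smul_left, real_inner_smul_left]
  have hb' : b = 1 - a := by linarith
  subst hb'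
  linarith

theorem isClosed_subdiff {φ : H → EReal} (hφ : ProperConvexLSC φ) (z : H) :
    IsClosed (subdiff φ z) := by
  have : subdiff φ z = {ξ | z ∈ effDom φ ∧ ∀ v ∈ effDom φ,
      (φ z).toReal + inner ℝ ξ (v - z) ≤ (φ v).toReal} := by
    ext ξ; exact mem_subdiff_iff hφ
  rw [this]
  by_cases hz : z ∈ effDom φ
  · simp only [hz, true_and, Set.ofPred_forall]
    refine isClosed_iInter fun v => isClosed_iInter fun _ => isClosed_le ?_ continuous_const
    fun_prop
  · simp [hz]

theorem existsUnique_isMinimal [CompleteSpace H] {φ : H → EReal} (hφ : ProperConvexLSC φ)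
    {w : H} (hw : w ∈ subdiffDom φ) : ∃! ξ, IsMinimal φ w ξ := by
  obtain ⟨ξ, hξ, hmin⟩ := exists_norm_eq_iInf_of_complete_convex hw.2
    (isClosed_subdiff hφ w).isComplete (convex_subdiff hφ w) 0
  have hle : ∀ η ∈ subdiff φ w, ‖ξ‖ ≤ ‖η‖ := by
    intro η hη
    have h := ciInf_le (f := fun x : subdiff φ w => ‖(0 : H) - x‖)
      ⟨0, by rintro _ ⟨x, rfl⟩; exact norm_nonneg _⟩ ⟨η, hη⟩
    rw [← hmin] at h
    simpa using h
  refine ⟨ξ, ⟨hξ, hle⟩, fun ζ hζ => ?_⟩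
  have hn : ‖ζ‖ = ‖ξ‖ := le_antisymm (hζ.2 ξ hξ) (hle ζ hζ.1)
  have hm := hle _ (convex_subdiff hφ w hξ hζ.1 (by norm_num : (0 : ℝ) ≤ 1 / 2)
    (by norm_num : (0 : ℝ) ≤ 1 / 2) (by norm_num))
  rw [← smul_add, norm_smul] at hm
  have hp := parallelogram_law_with_norm ℝ ζ ξ
  rw [add_comm ξ ζ] at hm
  norm_num at hm
  have h0 : ‖ζ - ξ‖ * ‖ζ - ξ‖ ≤ 0 := by
    rw [hn] at hp
    nlinarith [norm_nonneg ξ]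
  have : ‖ζ - ξ‖ = 0 := by nlinarith [norm_nonneg (ζ - ξ)]
  exact sub_eq_zero.mp (norm_eq_zero.mp this)

theorem minSection_isMinimal [CompleteSpace H] {φ : H → EReal} (hφ : ProperConvexLSC φ)
    {w : H} (hw : w ∈ subdiffDom φ) : IsMinimal φ w (minSection φ w) := by
  have h := (existsUnique_isMinimal hφ hw).exists
  unfold minSection
  rw [dif_pos h]
  exact h.choose_spec

/-- Sublevel sets of `φ` are precompact. -/
def PrecompactSublevels (φ : H → EReal) : Prop :=
  ∀ r : ℝ, IsCompact (closure {w | φ w ≤ (r : EReal)})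

end Functionals

/-- The requirements on the comparison functions `m₂, M₂ : [0, ∞) → [0, ∞)` alone. -/
structure AdmissibleGrowth (m₂ M₂ : ℝ≥0 → ℝ≥0) : Prop where
  measurable : Measurable m₂
  locallyBounded : ∀ R : ℝ≥0, BddAbove (m₂ '' Icc 0 R)
  monotone : Monotone M₂
  pos : ∃ r₀ : ℝ≥0∞, 0 < r₀ ∧ ∀ r : ℝ≥0, 0 < r → (r : ℝ≥0∞) < r₀ → 0 < m₂ r
  tendsto : Tendsto (fun r => M₂ r / m₂ r) (𝓝[>] 0) (𝓝 0)

/-- The structural condition relating `∂φ²` to `∂φ¹`. As `φ¹ ≥ 0`, the value of `φ¹` at a point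
of `D(∂φ¹)` is an element of `[0, ∞)`. -/
structure GrowthCondition {H : Type u} [NormedAddCommGroup H] [InnerProductSpace ℝ H]
    (ν₂ : ℝ) (m₂ M₂ : ℝ≥0 → ℝ≥0) (φ₁ φ₂ : H → EReal) : Prop where
  dom_subset : subdiffDom φ₁ ⊆ subdiffDom φ₂
  nonneg : ∀ w, 0 ≤ φ₁ w
  lower : ∀ w ∈ subdiffDom φ₁, (m₂ (φ₁ w).toReal.toNNReal : ℝ) ≤ ‖minSection φ₁ w‖
  upper : ∀ w ∈ subdiffDom φ₁,
    ‖minSection φ₂ w‖ ≤ ν₂ * ‖minSection φ₁ w‖ + M₂ (φ₁ w).toReal.toNNReal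

section Evolution

variable {H : Type u} [NormedAddCommGroup H] [InnerProductSpace ℝ H]

/-- The convolution `(k * w)(t) = ∫₀ᵗ k(t - s) w(s) ds`. -/
noncomputable def conv {E : Type*} [NormedAddCommGroup E] [NormedSpace ℝ E]
    (k : ℝ → ℝ) (w : ℝ → E) (t : ℝ) : E :=
  ∫ s in (0 : ℝ)..t, k (t - s) • w s

/-- `k` and `ℓ` are conjugate kernels: both are nonnegative, nonincreasing on `(0, ∞)` and locally
integrable on `[0, ∞)`, and `k * ℓ = 1` on `(0, ∞)`. -/
structure ConjugateKernels (k l : ℝ → ℝ) : Prop where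
  k_locInt : LocallyIntegrableOn k (Ici 0)
  k_nonneg : ∀ t, 0 < t → 0 ≤ k t
  k_anti : AntitoneOn k (Ioi 0)
  l_locInt : LocallyIntegrableOn l (Ici 0)
  l_nonneg : ∀ t, 0 < t → 0 ≤ l t
  l_anti : AntitoneOn l (Ioi 0)
  conv_eq_one : ∀ t, 0 < t → conv k l t = 1

/-- `w ∈ L²(0, S; H)`. -/
def MemL2 (S : ℝ) (w : ℝ → H) : Prop := MemLp w 2 (volume.restrict (Ioo 0 S))

/-- `w ∈ L²_loc([0, ∞); H)`. -/
def MemL2Loc (w : ℝ → H) : Prop := ∀ S : ℝ, 0 < S → MemL2 S w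

/-- `g` is the weak derivative of `v` in the open set `I`. -/
def IsWeakDeriv (I : Set ℝ) (v g : ℝ → H) : Prop :=
  ∀ ψ : ℝ → ℝ, ContDiff ℝ ∞ ψ → HasCompactSupport ψ → tsupport ψ ⊆ I →
    ∫ t in I, deriv ψ t • v t = -∫ t in I, ψ t • g t

/-- The continuous representative of `v` on `[0, S]` vanishes at `0`. -/
def HasZeroTrace (S : ℝ) (v : ℝ → H) : Prop :=
  ∃ v' : ℝ → H, ContinuousOn v' (Icc 0 S) ∧ v' =ᵐ[volume.restrict (Ioo 0 S)] v ∧ v' 0 = 0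

/-- `u` is a strong solution on `[0, S]` of
`(d/dt)[k * (u - u₀)] + ∂φ¹(u) - ∂φ²(u) ∋ f`. Here `g` is the weak derivative of `k * (u - u₀)`,
so that `k * (u - u₀) ∈ W^{1,2}(0, S; H)`. -/
def IsStrongSolution (φ₁ φ₂ : H → EReal) (k : ℝ → ℝ) (u₀ : H) (f : ℝ → H) (S : ℝ)
    (u : ℝ → H) : Prop :=
  MemL2 S u ∧ MemL2 S (conv k fun t => u t - u₀) ∧ HasZeroTrace S (conv k fun t => u t - u₀) ∧
  (∀ᵐ t ∂volume.restrict (Ioo 0 S), u t ∈ subdiffDom φ₁ ∩ subdiffDom φ₂) ∧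
  ∃ g ξ η : ℝ → H, MemL2 S g ∧ IsWeakDeriv (Ioo 0 S) (conv k fun t => u t - u₀) g ∧
    MemL2 S ξ ∧ MemL2 S η ∧
    ∀ᵐ t ∂volume.restrict (Ioo 0 S),
      ξ t ∈ subdiff φ₁ (u t) ∧ η t ∈ subdiff φ₂ (u t) ∧ g t + ξ t - η t = f t

/-- `u` is a strong solution on `[0, ∞)`: the same with all spaces replaced by their local
versions on `[0, ∞)`. -/
def IsGlobalStrongSolution (φ₁ φ₂ : H → EReal) (k : ℝ → ℝ) (u₀ : H) (f : ℝ → H)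
    (u : ℝ → H) : Prop :=
  MemL2Loc u ∧ MemL2Loc (conv k fun t => u t - u₀) ∧
  (∀ S : ℝ, 0 < S → HasZeroTrace S (conv k fun t => u t - u₀)) ∧
  (∀ᵐ t ∂volume.restrict (Ioi 0), u t ∈ subdiffDom φ₁ ∩ subdiffDom φ₂) ∧
  ∃ g ξ η : ℝ → H, MemL2Loc g ∧ IsWeakDeriv (Ioi 0) (conv k fun t => u t - u₀) g ∧
    MemL2Loc ξ ∧ MemL2Loc η ∧
    ∀ᵐ t ∂volume.restrict (Ioi 0),
      ξ t ∈ subdiff φ₁ (u t) ∧ η t ∈ subdiff φ₂ (u t) ∧ g t + ξ t - η t = f t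

/-- `E(u₀, f) = φ¹(u₀) + ‖ℓ * ‖f(·)‖²‖_{L^∞(I)}`, with values in `(-∞, ∞]`;
`I = (0, T)` or `I = (0, ∞)`. -/
noncomputable def dataEnergy (φ₁ : H → EReal) (l : ℝ → ℝ) (I : Set ℝ) (u₀ : H) (f : ℝ → H) :
    EReal :=
  φ₁ u₀ + ((eLpNorm (conv l fun t => ‖f t‖ ^ 2) ∞ (volume.restrict I) : ℝ≥0∞) : EReal)

/-- `h ∈ L^∞(I)` for an extended-real function `h`. -/
def MemLInfty (I : Set ℝ) (h : ℝ → EReal) : Prop :=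
  (∀ᵐ t ∂volume.restrict I, h t ≠ ⊤ ∧ h t ≠ ⊥) ∧
    MemLp (fun t => (h t).toReal) ∞ (volume.restrict I)

end Evolution

end FracGradFlow

/-! The equation is discretised in such a way that the two kernels stay exactly conjugate.
Integration against the Poisson weights e^{-Lt}(Lt)^n/n! turns convolutions on the half-line into
convolutions of sequences (`lintegral_conv_mul_poissonWeight`) and keeps kernels nonnegative and
nonincreasing. So the moments a of `l` and L times the moments b of `k` satisfy a * b = 1
(`ConjugateKernels.conjugateSequences`), and the backward difference of b, which plays the role of
d/dt[k * ·], is the convolution inverse of a.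

The scheme is implicit in φ¹ and explicit in φ², so that each step is a single resolvent of ∂φ¹
(`exists_scheme`). The signs of the backward difference of b and convexity give a discrete chain
rule (`ConjugateSequences.chain_rule`). Near level zero M₂ is absorbed by m₂, hence ‖∂φ²‖ ≤ ν‖∂φ¹‖
for minimal sections, with some ν < 1, as long as φ¹ ≤ ρ. Young's inequality followed by convolution
with a then bounds φ¹(u_n) and a * ‖ξ‖² by multiples of the data energy. For small data this bound
lies below ρ, so strong induction keeps every step in the region where the growth estimate is
available (`exists_discrete_solution`). No bound depends on L or on a final time.

For the limit L → ∞, a * ‖g‖² ≤ const and monotonicity of a give a common modulus of continuity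
governed by ∫₀^δ l (`asymptotically_equicontinuous_step`). With compact sublevels this yields a
locally uniform limit along an ultrafilter (`exists_continuous_limit`), while the subgradients
converge weakly in a weighted L² space. Lebesgue differentiation identifies the weak limits as
subgradients (`ae_mem_subdiff_of_tendsto`). Poisson concentration (a law of large numbers) shows
that the discrete convolutions converge to the continuous ones, which gives the integrated equation
k * (v - u₀) = ∫ (f + η - ξ).

The finite-horizon statement follows from the global one: f is extended by zero after T, and since
`l` is nonincreasing this does not increase the norm of l * ‖f‖²
(`IsKernel.eLpNorm_conv_indicator_le`). -/

namespace FracGradFlow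

/-! ### Resolvents of convex functionals with precompact sublevels. -/

section ConvexAnalysis

variable {H : Type u} [NormedAddCommGroup H] [InnerProductSpace ℝ H]

theorem ProperConvexLSC.coe_toReal {φ : H → EReal} (hφ : ProperConvexLSC φ) {w : H}
    (hw : w ∈ effDom φ) : ((φ w).toReal : EReal) = φ w :=
  EReal.coe_toReal (ne_of_lt hw) (hφ.ne_bot w)

/-- Direct method on one compact set: with c the value of the penalised functional at some point of
the domain, any point with φ > c is a worse competitor, so it suffices to minimise over the closure
of {φ ≤ c}. -/
theorem ProperConvexLSC.exists_forall_add_sq_le {φ : H → EReal} (hφ : ProperConvexLSC φ)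
    (hc : PrecompactSublevels φ) {a : ℝ} (ha : 0 < a) (z : H) :
    ∃ w ∈ effDom φ, ∀ v ∈ effDom φ,
      (φ w).toReal + a * ‖w - z‖ ^ 2 ≤ (φ v).toReal + a * ‖v - z‖ ^ 2 := by
  obtain ⟨v₀, hv₀⟩ := hφ.proper
  have hq : Continuous fun v : H => a * ‖v - z‖ ^ 2 := by fun_prop
  set Ψ : H → EReal := fun v => φ v + ((a * ‖v - z‖ ^ 2 : ℝ) : EReal) with hΨ
  have hΨl : LowerSemicontinuous Ψ := by
    refine LowerSemicontinuous.add' hφ.lsc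
      (continuous_coe_real_ereal.comp hq).lowerSemicontinuous fun x => ?_
    exact EReal.continuousAt_add (Or.inr (EReal.coe_ne_bot _)) (Or.inr (EReal.coe_ne_top _))
  have hΨ_real : ∀ v ∈ effDom φ, Ψ v = (((φ v).toReal + a * ‖v - z‖ ^ 2 : ℝ) : EReal) := by
    intro v hv
    rw [EReal.coe_add, hφ.coe_toReal hv]
  set c : ℝ := (φ v₀).toReal + a * ‖v₀ - z‖ ^ 2 with hcdef
  have hv₀c : φ v₀ ≤ (c : EReal) := by
    rw [← hφ.coe_toReal hv₀, EReal.coe_le_coe_iff, hcdef]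
    have := sq_nonneg ‖v₀ - z‖
    nlinarith
  obtain ⟨w, -, hmin⟩ := LowerSemicontinuousOn.exists_isMinOn
    ⟨v₀, subset_closure (show v₀ ∈ {w | φ w ≤ (c : EReal)} from hv₀c)⟩ (hc c)
    (hΨl.lowerSemicontinuousOn _)
  have hw0 : Ψ w ≤ (c : EReal) := by
    have := hmin (subset_closure (show v₀ ∈ {w | φ w ≤ (c : EReal)} from hv₀c))
    rwa [mem_ofPred_eq, hΨ_real v₀ hv₀] at this
  have hle : ∀ v, φ v ≤ Ψ v := fun v => by
    have h0 : (0 : EReal) ≤ ((a * ‖v - z‖ ^ 2 : ℝ) : EReal) := by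
      rw [← EReal.coe_zero, EReal.coe_le_coe_iff]; positivity
    have := add_le_add_right h0 (φ v)
    rwa [add_zero] at this
  have hwd : w ∈ effDom φ := lt_of_le_of_lt ((hle w).trans hw0) (EReal.coe_lt_top _)
  refine ⟨w, hwd, fun v hv => ?_⟩
  rw [← EReal.coe_le_coe_iff, ← hΨ_real w hwd, ← hΨ_real v hv]
  by_cases hvc : φ v ≤ (c : EReal)
  · exact hmin (subset_closure (show v ∈ {w | φ w ≤ (c : EReal)} from hvc))
  · exact hw0.trans ((not_le.mp hvc).le.trans (hle v))

/-- The resolvent of `∂φ` is everywhere defined. -/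
theorem ProperConvexLSC.exists_resolvent {φ : H → EReal} (hφ : ProperConvexLSC φ)
    (hc : PrecompactSublevels φ) {a : ℝ} (ha : 0 < a) (z : H) :
    ∃ w, a⁻¹ • (z - w) ∈ subdiff φ w := by
  obtain ⟨w, hw, hmin⟩ := hφ.exists_forall_add_sq_le hc (a := (2 * a)⁻¹) (by positivity) z
  refine ⟨w, (mem_subdiff_iff hφ).mpr ⟨hw, fun v hv => ?_⟩⟩
  -- First variation: compare the minimiser with w + s(v - w), use convexity, divide by s, and later
  -- let s → 0.
  have key : ∀ s ∈ Ioo (0 : ℝ) 1, (φ w).toReal + inner ℝ (a⁻¹ • (z - w)) (v - w)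
      ≤ (φ v).toReal + s * ((2 * a)⁻¹ * ‖v - w‖ ^ 2) := by
    intro s hs
    have hconv := hφ.convex w v (1 - s) s (by linarith [hs.2]) hs.1.le (by ring)
    have hpt : (1 - s) • w + s • v = w + s • (v - w) := by
      rw [sub_smul, one_smul, smul_sub]; abel
    rw [hpt, ← hφ.coe_toReal hw, ← hφ.coe_toReal hv, ← EReal.coe_mul, ← EReal.coe_mul,
      ← EReal.coe_add] at hconv
    have hd : w + s • (v - w) ∈ effDom φ := lt_of_le_of_lt hconv (EReal.coe_lt_top _)
    rw [← hφ.coe_toReal hd, EReal.coe_le_coe_iff] at hconv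
    have hm := hmin _ hd
    have hexp : ‖w + s • (v - w) - z‖ ^ 2
        = ‖w - z‖ ^ 2 - 2 * s * inner ℝ (z - w) (v - w) + s ^ 2 * ‖v - w‖ ^ 2 := by
      have : w + s • (v - w) - z = s • (v - w) - (z - w) := by abel
      rw [this, norm_sub_sq_real, norm_smul, real_inner_smul_left, real_inner_comm,
        norm_sub_rev z w, mul_pow, Real.norm_eq_abs, sq_abs]
      ring
    rw [hexp] at hm
    rw [real_inner_smul_left]
    have h2 : a⁻¹ = 2 * (2 * a)⁻¹ := by field_simp
    rw [h2]
    have hs0 := hs.1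
    have : s * ((φ w).toReal + 2 * (2 * a)⁻¹ * inner ℝ (z - w) (v - w))
        ≤ s * ((φ v).toReal + s * ((2 * a)⁻¹ * ‖v - w‖ ^ 2)) := by nlinarith
    exact le_of_mul_le_mul_left this hs0
  have hlim : Tendsto (fun s : ℝ => (φ v).toReal + s * ((2 * a)⁻¹ * ‖v - w‖ ^ 2)) (𝓝[>] 0)
      (𝓝 ((φ v).toReal + 0 * ((2 * a)⁻¹ * ‖v - w‖ ^ 2))) :=
    (Continuous.tendsto (by fun_prop) 0).mono_left nhdsWithin_le_nhds
  rw [zero_mul, add_zero] at hlim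
  refine ge_of_tendsto hlim ?_
  filter_upwards [Ioo_mem_nhdsGT (zero_lt_one' ℝ)] with s hs using key s hs

end ConvexAnalysis

/-! ### The growth condition at small energy levels. -/

/-- Near the zero level, the perturbation is dominated by a multiple of the lower bound. -/
theorem AdmissibleGrowth.exists_le_mul {m₂ M₂ : ℝ≥0 → ℝ≥0} (h : AdmissibleGrowth m₂ M₂) {ε : ℝ}
    (hε : 0 < ε) : ∃ ρ : ℝ, 0 < ρ ∧ ∀ r : ℝ≥0, (r : ℝ) ≤ ρ → (M₂ r : ℝ) ≤ ε * m₂ r := by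
  obtain ⟨r₀, hr₀, hpos⟩ := h.pos
  have hquot : ∀ e : ℝ, 0 < e → ∀ᶠ r : ℝ≥0 in 𝓝[>] 0, (M₂ r : ℝ) ≤ e * m₂ r := by
    intro e he
    have h1 : ∀ᶠ r : ℝ≥0 in 𝓝[>] 0, M₂ r / m₂ r < e.toNNReal :=
      h.tendsto.eventually (gt_mem_nhds (by simpa using he))
    have h2 : ∀ᶠ r : ℝ≥0 in 𝓝[>] 0, (r : ℝ≥0∞) < r₀ := by
      have : Tendsto (fun r : ℝ≥0 => (r : ℝ≥0∞)) (𝓝[>] 0) (𝓝 ((0 : ℝ≥0) : ℝ≥0∞)) :=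
        (ENNReal.continuous_coe.tendsto 0).mono_left nhdsWithin_le_nhds
      exact this.eventually (gt_mem_nhds (by simpa using hr₀))
    filter_upwards [h1, h2, self_mem_nhdsWithin] with r hr1 hr2 hr3
    have hm : 0 < m₂ r := hpos r hr3 hr2
    rw [div_lt_iff₀ hm] at hr1
    have := NNReal.coe_le_coe.mpr hr1.le
    rwa [NNReal.coe_mul, Real.coe_toNNReal _ he.le] at this
  -- The quotient is controlled only for r > 0. The value at 0 is reached through M₂ 0 ≤ M₂ r ≤ e m₂
  -- r ≤ e B, by monotonicity of M₂ and local boundedness of m₂.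
  have hzero : M₂ 0 = 0 := by
    obtain ⟨B, hB⟩ := h.locallyBounded 1
    have hle : ∀ e : ℝ, 0 < e → (M₂ 0 : ℝ) ≤ e * B := by
      intro e he
      obtain ⟨r, hr, hr1⟩ := ((hquot e he).and
        (Ioo_mem_nhdsGT (zero_lt_one' ℝ≥0))).exists
      have hb : m₂ r ≤ B := hB ⟨r, ⟨hr1.1.le, hr1.2.le⟩, rfl⟩
      calc (M₂ 0 : ℝ) ≤ M₂ r := NNReal.coe_le_coe.mpr (h.monotone hr1.1.le)
        _ ≤ e * m₂ r := hr
        _ ≤ e * B := mul_le_mul_of_nonneg_left (NNReal.coe_le_coe.mpr hb) he.le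
    have hlim : Tendsto (fun e : ℝ => e * (B : ℝ)) (𝓝[>] 0) (𝓝 (0 * (B : ℝ))) :=
      (Continuous.tendsto (by fun_prop) 0).mono_left nhdsWithin_le_nhds
    have h0 : (M₂ 0 : ℝ) ≤ 0 * B := ge_of_tendsto hlim
      (by filter_upwards [self_mem_nhdsWithin] with e he using hle e he)
    rw [zero_mul] at h0
    exact le_antisymm (NNReal.coe_le_coe.mp h0) zero_le
  obtain ⟨d, hd, hsub⟩ := (mem_nhdsGT_iff_exists_Ioo_subset' (zero_lt_one' ℝ≥0)).mp (hquot ε hε)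
  refine ⟨(d : ℝ) / 2, by have : (0 : ℝ) < d := hd; positivity, fun r hr => ?_⟩
  rcases eq_or_ne r 0 with rfl | hr0
  · rw [hzero, NNReal.coe_zero]; positivity
  · refine hsub ⟨pos_iff_ne_zero.mpr hr0, ?_⟩
    have : (0 : ℝ) < d := hd
    exact NNReal.coe_lt_coe.mp (by linarith)

/-- The lower-order term disappears: M₂ ≤ ε m₂ at this level, and m₂ is itself a lower bound for the
minimal section of ∂φ¹. -/
theorem GrowthCondition.norm_minSection_le {H : Type u} [NormedAddCommGroup H]
    [InnerProductSpace ℝ H] {ν₂ ε ρ : ℝ} {m₂ M₂ : ℝ≥0 → ℝ≥0} {φ₁ φ₂ : H → EReal}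
    (h : GrowthCondition ν₂ m₂ M₂ φ₁ φ₂) (hε : 0 ≤ ε)
    (hρ : ∀ r : ℝ≥0, (r : ℝ) ≤ ρ → (M₂ r : ℝ) ≤ ε * m₂ r) {w : H} (hw : w ∈ subdiffDom φ₁)
    (hwρ : φ₁ w ≤ (ρ : EReal)) :
    ‖minSection φ₂ w‖ ≤ (ν₂ + ε) * ‖minSection φ₁ w‖ := by
  have hr : (((φ₁ w).toReal.toNNReal : ℝ≥0) : ℝ) ≤ ρ := by
    rw [Real.coe_toNNReal _ (EReal.toReal_nonneg (h.nonneg w))]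
    have := EReal.toReal_le_toReal hwρ ((EReal.bot_lt_zero.trans_le (h.nonneg w)).ne')
      (EReal.coe_ne_top _)
    simpa using this
  have h1 := h.upper w hw
  have h2 := hρ _ hr
  have h3 := mul_le_mul_of_nonneg_left (h.lower w hw) hε
  linarith

/-! ### Conjugate sequences and the discrete chain rule. -/

/-- Discrete analogue of `ConjugateKernels`. -/
structure ConjugateSequences (a b : ℕ → ℝ) : Prop where
  left_nonneg : ∀ n, 0 ≤ a n
  left_anti : Antitone a
  right_nonneg : ∀ n, 0 ≤ b n
  right_anti : Antitone b
  conv_eq_one : ∀ n, ∑ p ∈ Finset.HasAntidiagonal.antidiagonal n, a p.1 * b p.2 = 1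

/-- The coefficients of `(1 - X) b`. -/
def backwardDiff (b : ℕ → ℝ) : ℕ → ℝ
  | 0 => b 0
  | n + 1 => b (n + 1) - b n

theorem mk_backwardDiff (b : ℕ → ℝ) :
    PowerSeries.mk (backwardDiff b) = (1 - PowerSeries.X) * PowerSeries.mk b := by
  ext n
  cases n with
  | zero => simp [backwardDiff, sub_mul]
  | succ n => simp [backwardDiff, sub_mul, PowerSeries.coeff_succ_X_mul]

theorem mk_eq_mul_iff {a x y : ℕ → ℝ} :
    PowerSeries.mk x = PowerSeries.mk a * PowerSeries.mk y ↔
      ∀ n, x n = ∑ p ∈ Finset.HasAntidiagonal.antidiagonal n, a p.1 * y p.2 := by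
  simp [PowerSeries.ext_iff, PowerSeries.coeff_mul]

theorem sum_backwardDiff (b : ℕ → ℝ) (n : ℕ) :
    ∑ p ∈ Finset.HasAntidiagonal.antidiagonal n, backwardDiff b p.1 = b n := by
  rw [Finset.Nat.sum_antidiagonal_eq_sum_range_succ_mk]
  induction n with
  | zero => simp [backwardDiff]
  | succ n ih => rw [Finset.sum_range_succ, ih]; simp [backwardDiff]

namespace ConjugateSequences

variable {a b : ℕ → ℝ} (h : ConjugateSequences a b)
include h

theorem mk_mul : PowerSeries.mk a * PowerSeries.mk b = PowerSeries.mk (1 : ℕ → ℝ) := by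
  ext n; simp [PowerSeries.coeff_mul, h.conv_eq_one]

/-- Since a b = 1/(1 - X), the series (1 - X) b inverts a, just as d/dt[k * ·] inverts l * ·. -/
theorem mk_mul_backwardDiff : PowerSeries.mk a * PowerSeries.mk (backwardDiff b) = 1 := by
  rw [mk_backwardDiff, mul_left_comm, h.mk_mul, mul_comm]
  exact PowerSeries.mk_one_mul_one_sub_eq_one ℝ

theorem left_zero_pos : 0 < a 0 := by
  have := h.conv_eq_one 0
  simp only [Finset.HasAntidiagonal.antidiagonal_zero, Finset.sum_singleton] at this
  rcases (h.left_nonneg 0).eq_or_lt with h0 | h0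
  · simp [← h0] at this
  · exact h0

/-- Multiplying x = a y by b gives y/(1 - X), whose coefficients are the partial sums of y. This is
the discrete form of k * (l * y) = ∫ y. -/
theorem sum_eq {x y : ℕ → ℝ} (hx : ∀ n, x n = ∑ p ∈ Finset.HasAntidiagonal.antidiagonal n, a p.1 * y
    p.2) (n : ℕ) :
    ∑ j ∈ Finset.range (n + 1), y j = ∑ p ∈ Finset.HasAntidiagonal.antidiagonal n, b p.1 * x p.2 :=
      by
  have h1 : PowerSeries.mk (fun n => ∑ j ∈ Finset.range (n + 1), y j)
      = PowerSeries.mk b * PowerSeries.mk x := by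
    rw [mk_eq_mul_iff.mpr hx, ← mul_assoc, mul_comm (PowerSeries.mk b), h.mk_mul, mk_eq_mul_iff]
    intro n
    rw [Finset.Nat.sum_antidiagonal_eq_sum_range_succ_mk]
    simp only [Pi.one_apply, one_mul]
    exact (Finset.sum_range_reflect y (n + 1)).symm.trans
      (Finset.sum_congr rfl fun j _ => by congr 1)
  exact mk_eq_mul_iff.mp h1 n

theorem eq_backwardDiff_conv {x y : ℕ → ℝ}
    (hx : ∀ n, x n = ∑ p ∈ Finset.HasAntidiagonal.antidiagonal n, a p.1 * y p.2) (n : ℕ) :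
    y n = ∑ p ∈ Finset.HasAntidiagonal.antidiagonal n, backwardDiff b p.1 * x p.2 := by
  refine mk_eq_mul_iff.mp ?_ n
  rw [mk_eq_mul_iff.mpr hx, ← mul_assoc, mul_comm (PowerSeries.mk (backwardDiff b)),
    h.mk_mul_backwardDiff, one_mul]

theorem conv_backwardDiff_conv (x : ℕ → ℝ) (n : ℕ) :
    x n = ∑ p ∈ Finset.HasAntidiagonal.antidiagonal n, a p.1 * ∑ q ∈
      Finset.HasAntidiagonal.antidiagonal p.2, backwardDiff b q.1 * x q.2 := by
  refine (mk_eq_mul_iff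
    (y := fun m => ∑ q ∈ Finset.HasAntidiagonal.antidiagonal m, backwardDiff b q.1 * x q.2)).mp ?_ n
  rw [mk_eq_mul_iff.mpr fun m => rfl, ← mul_assoc, h.mk_mul_backwardDiff, one_mul]

/-- A sequence dominated by its last, nonnegative entry has nonnegative backward difference. -/
theorem backwardDiff_conv_nonneg {c : ℕ → ℝ} {n : ℕ} (hc : ∀ j ≤ n, c j ≤ c n) (h0 : 0 ≤ c n) :
    0 ≤ ∑ p ∈ Finset.HasAntidiagonal.antidiagonal n, backwardDiff b p.1 * c p.2 := by
  -- Beyond index 0 the coefficients of the backward difference are ≤ 0, as b is nonincreasing.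
  -- Replacing every c j by the larger c n thus lowers the sum, which then telescopes to b n * c n.
  calc (0 : ℝ) ≤ b n * c n := mul_nonneg (h.right_nonneg n) h0
    _ = ∑ p ∈ Finset.HasAntidiagonal.antidiagonal n, backwardDiff b p.1 * c n := by
        rw [← Finset.sum_mul, sum_backwardDiff b n]
    _ ≤ _ := Finset.sum_le_sum fun p hp => by
        rw [Finset.HasAntidiagonal.mem_antidiagonal] at hp
        rcases p with ⟨_ | i, j⟩
        · simp only [zero_add] at hp
          rw [hp]
        · exact mul_le_mul_of_nonpos_left (hc j (by simp only at hp; omega))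
            (sub_nonpos.mpr (h.right_anti i.le_succ))

/-- Discrete form of the inequality `(d/dt [k * w], ξ) ≥ d/dt [k * φ(w)]` for `ξ ∈ ∂φ(w)`. -/
theorem chain_rule {H : Type u} [NormedAddCommGroup H] [InnerProductSpace ℝ H] {φ : H → EReal}
    (hφ : ProperConvexLSC φ) {u₀ : H} (hu₀ : u₀ ∈ effDom φ) {u g : ℕ → H}
    (hu : ∀ n, u n = u₀ + ∑ p ∈ Finset.HasAntidiagonal.antidiagonal n, a p.1 • g p.2)
      (hd : ∀ n, u n ∈ effDom φ)
    {n : ℕ} {ξ : H} (hξ : ξ ∈ subdiff φ (u n)) :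
    ∑ p ∈ Finset.HasAntidiagonal.antidiagonal n, backwardDiff b p.1 *
      ((φ (u p.2)).toReal - (φ u₀).toReal)
      ≤ inner ℝ ξ (g n) := by
  have hx : ∀ m, inner ℝ ξ (u m - u₀) = ∑ p ∈ Finset.HasAntidiagonal.antidiagonal m, a p.1 * inner ℝ
    ξ (g p.2) := by
    intro m
    rw [hu m, add_sub_cancel_left, inner_sum]
    simp only [real_inner_smul_right]
  rw [h.eq_backwardDiff_conv (x := fun m => inner ℝ ξ (u m - u₀)) (y := fun j => inner ℝ ξ (g j)) hx
    n,
    ← sub_nonneg, ← Finset.sum_sub_distrib]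
  simp only [← mul_sub]
  have hs := ((mem_subdiff_iff hφ).mp hξ).2
  -- This c is the gap in the subgradient inequality at u n. Testing with u j shows that c is
  -- largest at j = n, testing with u₀ that it is nonnegative there.
  refine h.backwardDiff_conv_nonneg
    (c := fun j => inner ℝ ξ (u j - u₀) - ((φ (u j)).toReal - (φ u₀).toReal)) ?_ ?_
  · intro j _
    have := hs _ (hd j)
    rw [inner_sub_right] at this
    simp only [inner_sub_right]
    linarith
  · have := hs _ hu₀
    rw [inner_sub_right] at this
    simp only [inner_sub_right]
    linarith

/-- The convolution of the shifted sequence. -/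
theorem conv_succ_le {x y : ℕ → ℝ} {G : ℝ} (hx : ∀ n, x (n + 1) ≤ y n) (hx0 : x 0 = 0)
    (hG : 0 ≤ G) {m : ℕ} (hy : ∀ n < m, ∑ p ∈ Finset.HasAntidiagonal.antidiagonal n, a p.1 * y p.2 ≤
      G) :
    ∑ p ∈ Finset.HasAntidiagonal.antidiagonal m, a p.1 * x p.2 ≤ G := by
  cases m with
  | zero => simpa [hx0] using hG
  | succ m =>
    rw [Finset.Nat.sum_antidiagonal_succ']
    simp only [hx0, mul_zero, zero_add]
    exact (Finset.sum_le_sum fun p _ => mul_le_mul_of_nonneg_left (hx p.2)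
      (h.left_nonneg _)).trans (hy m m.lt_succ_self)

end ConjugateSequences

/-! ### The semi-implicit scheme and its uniform bounds. -/

/-- Course-of-values recursion for equations with memory: entries not yet constructed are replaced
by 0. Finite stages exist and are unique, so they can be glued along the diagonal. -/
theorem exists_seq_of_history {E : Type*} [Zero E] (Φ : ℕ → (ℕ → E) → E) :
    ∃ g : ℕ → E, ∀ n, g n = Φ n (fun j => if j < n then g j else 0) := by
  have key : ∀ n : ℕ, ∃ g : ℕ → E, (∀ m < n, g m = Φ m (fun j => if j < m then g j else 0)) ∧
      ∀ g' : ℕ → E, (∀ m < n, g' m = Φ m (fun j => if j < m then g' j else 0)) →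
        ∀ m < n, g' m = g m := by
    intro n
    induction n with
    | zero => exact ⟨fun _ => 0, by simp, by simp⟩
    | succ n ih =>
      obtain ⟨g, hg, hu⟩ := ih
      refine ⟨fun m => if m < n then g m else Φ m (fun j => if j < m then g j else 0), ?_, ?_⟩
      · intro m hm
        beta_reduce
        by_cases hmn : m < n
        · rw [if_pos hmn, hg m hmn]
          congr 1; ext j
          by_cases hj : j < m
          · simp [hj, hj.trans hmn]
          · simp [hj]
        · rw [if_neg hmn]
          congr 1; ext j
          by_cases hj : j < m
          · simp [hj, show j < n by omega]
          · simp [hj]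
      · intro g' hg' m hm
        have hlt := hu g' fun m hm => hg' m (by omega)
        beta_reduce
        by_cases hmn : m < n
        · rw [if_pos hmn, hlt m hmn]
        · rw [if_neg hmn, hg' m hm]
          congr 1; ext j
          by_cases hj : j < m
          · simp [hj, hlt j (by omega)]
          · simp [hj]
  choose G hG hGu using key
  refine ⟨fun n => G (n + 1) n, fun n => ?_⟩
  beta_reduce
  rw [hG (n + 1) n n.lt_succ_self]
  congr 1; ext j
  by_cases hj : j < n
  · simp only [hj, if_true]
    exact (hGu (j + 1) (G (n + 1)) (fun m hm => hG (n + 1) m (by omega)) j j.lt_succ_self)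
  · simp [hj]

section Scheme

variable {H : Type u} [NormedAddCommGroup H] [InnerProductSpace ℝ H]

/-- Solvability of the semi-implicit discrete problem. -/
theorem exists_scheme {φ₁ : H → EReal} (h₁ : ProperConvexLSC φ₁)
    (hc : PrecompactSublevels φ₁) (σ : H → H) {a : ℕ → ℝ} (ha : 0 < a 0) (f : ℕ → H) (u₀ : H) :
    ∃ u ξ η : ℕ → H, u 0 = u₀ ∧
      (∀ n, u (n + 1) = u₀ + ∑ p ∈ Finset.HasAntidiagonal.antidiagonal n, a p.1 •
        (f p.2 + η p.2 - ξ p.2)) ∧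
      (∀ n, ξ n ∈ subdiff φ₁ (u (n + 1))) ∧ η 0 = 0 ∧ ∀ n, η (n + 1) = σ (u (n + 1)) := by
  choose J hJ using fun z : H => h₁.exists_resolvent hc ha z
  -- The unknown is the increment g = f + η - ξ, with `U` the state rebuilt from it. `R` collects
  -- the past increments with kernel index shifted by one, so that U (n + 1) = u₀ + R n + a 0 • g n,
  -- and the current step reads U (n + 1) + a 0 • ξ n = Z n: a resolvent equation.
  set U : (ℕ → H) → ℕ → H := fun g n => match n with
    | 0 => u₀
    | n + 1 => u₀ + ∑ p ∈ Finset.HasAntidiagonal.antidiagonal n, a p.1 • g p.2 with hU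
  set R : (ℕ → H) → ℕ → H := fun g n => match n with
    | 0 => 0
    | n + 1 => ∑ p ∈ Finset.HasAntidiagonal.antidiagonal n, a (p.1 + 1) • g p.2 with hR
  set η : (ℕ → H) → ℕ → H := fun g n => match n with
    | 0 => 0
    | n + 1 => σ (U g (n + 1)) with hη
  set Z : (ℕ → H) → ℕ → H := fun g n => u₀ + R g n + a 0 • (f n + η g n) with hZ
  set ξ : (ℕ → H) → ℕ → H := fun g n => (a 0)⁻¹ • (Z g n - J (Z g n)) with hξ
  obtain ⟨g, hg⟩ := exists_seq_of_history fun n g => f n + η g n - ξ g n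
  -- The truncation in the recursion is harmless, since `U`, `R` and `η` at n only see increments of
  -- index below n.
  have hcut : ∀ n, ∀ c : ℕ → ℝ,
      ∑ p ∈ Finset.HasAntidiagonal.antidiagonal n, c p.1 • (if p.2 < n + 1 then g p.2 else 0)
        = ∑ p ∈ Finset.HasAntidiagonal.antidiagonal n, c p.1 • g p.2 := fun n c =>
    Finset.sum_congr rfl fun p hp => by
      rw [if_pos (by rw [Finset.HasAntidiagonal.mem_antidiagonal] at hp; omega)]
  have hUc : ∀ n, U (fun j => if j < n then g j else 0) n = U g n := by
    rintro (_ | n)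
    · rfl
    · simp only [hU]; rw [hcut n a]
  have hRc : ∀ n, R (fun j => if j < n then g j else 0) n = R g n := by
    rintro (_ | n)
    · rfl
    · simp only [hR]; rw [hcut n fun i => a (i + 1)]
  have hηc : ∀ n, η (fun j => if j < n then g j else 0) n = η g n := by
    rintro (_ | n)
    · rfl
    · simp only [hη]; rw [hUc (n + 1)]
  have hg' : ∀ n, g n = f n + η g n - ξ g n := by
    intro n
    rw [hg n]
    simp only [hξ, hZ, hηc, hRc]
  have hUs : ∀ n, U g (n + 1) = J (Z g n) := by
    intro n
    have h1 : U g (n + 1) = u₀ + R g n + a 0 • g n := by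
      cases n with
      | zero => simp [hU, hR]
      | succ n =>
        simp only [hU, hR]
        rw [Finset.Nat.sum_antidiagonal_succ]
        simp only; abel
    have h2 : a 0 • ξ g n = Z g n - J (Z g n) := by
      simp only [hξ]; rw [smul_inv_smul₀ ha.ne']
    rw [h1, hg' n, smul_sub, h2]
    simp only [hZ]; abel
  refine ⟨U g, ξ g, η g, rfl, fun n => ?_, fun n => ?_, rfl, fun n => rfl⟩
  · simp only [← hg']; rfl
  · rw [hUs]; exact hJ _

/-- Solutions of the discrete problem with small data obey bounds that do not depend on the
discretisation. -/
theorem exists_discrete_solution [CompleteSpace H] {φ₁ φ₂ : H → EReal}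
    (h₁ : ProperConvexLSC φ₁) (h₂ : ProperConvexLSC φ₂) (hnn : ∀ w, 0 ≤ φ₁ w)
    (hc : PrecompactSublevels φ₁) (hdom : subdiffDom φ₁ ⊆ subdiffDom φ₂) {ν ρ : ℝ} (hν₀ : 0 ≤ ν)
    (hν₁ : ν < 1)
    (hgrowth : ∀ w ∈ subdiffDom φ₁, φ₁ w ≤ (ρ : EReal) →
      ‖minSection φ₂ w‖ ≤ ν * ‖minSection φ₁ w‖)
    {a b : ℕ → ℝ} (hab : ConjugateSequences a b) {f : ℕ → H} {F : ℝ}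
    (hF : ∀ n, ∑ p ∈ Finset.HasAntidiagonal.antidiagonal n, a p.1 * ‖f p.2‖ ^ 2 ≤ F) {u₀ : H}
      (hu₀ : u₀ ∈ effDom φ₁)
    {Q : ℝ} (hQ : (φ₁ u₀).toReal + F / (2 * (1 - ν)) ≤ Q) (hQρ : Q / (1 - ν) ≤ ρ) :
    ∃ u ξ η : ℕ → H, u 0 = u₀ ∧
      (∀ n, u (n + 1) = u₀ + ∑ p ∈ Finset.HasAntidiagonal.antidiagonal n, a p.1 •
        (f p.2 + η p.2 - ξ p.2)) ∧
      (∀ n, ξ n ∈ subdiff φ₁ (u (n + 1))) ∧ (∀ n, η (n + 1) ∈ subdiff φ₂ (u (n + 1))) ∧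
      (∀ n, φ₁ (u n) ≤ ((Q / (1 - ν) : ℝ) : EReal)) ∧
      (∀ n, ∑ p ∈ Finset.HasAntidiagonal.antidiagonal n, a p.1 * ‖ξ p.2‖ ^ 2 ≤ 2 * Q / (1 - ν)) ∧
      (∀ n, ∑ p ∈ Finset.HasAntidiagonal.antidiagonal n, a p.1 * ‖η p.2‖ ^ 2 ≤ 2 * Q / (1 - ν)) :=
        by
  obtain ⟨u, ξ, η, hu0, hu, hξ, hη0, hη⟩ :=
    exists_scheme h₁ hc (minSection φ₂) hab.left_zero_pos f u₀
  have hν : 0 < 1 - ν := by linarith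
  have hF0 : 0 ≤ F := (Finset.sum_nonneg fun p _ =>
    mul_nonneg (hab.left_nonneg _) (sq_nonneg _)).trans (hF 0)
  have hφ0 : ∀ w, 0 ≤ (φ₁ w).toReal := fun w => EReal.toReal_nonneg (hnn w)
  have hFd : 0 ≤ F / (2 * (1 - ν)) := by positivity
  have hQ0 : 0 ≤ Q := by linarith [hφ0 u₀]
  have hud : ∀ n, u (n + 1) ∈ effDom φ₁ := fun n => (hξ n).1
  have hus : ∀ n, u (n + 1) ∈ subdiffDom φ₁ := fun n => ⟨hud n, ⟨_, hξ n⟩⟩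
  -- This is where small data are used: Q/(1 - ν) ≤ ρ makes the growth bound available, and ξ n
  -- dominates the minimal section of ∂φ¹ at u (n + 1).
  have hηbd : ∀ n, φ₁ (u (n + 1)) ≤ ((Q / (1 - ν) : ℝ) : EReal) →
      ‖η (n + 1)‖ ≤ ν * ‖ξ n‖ := by
    intro n hn
    rw [hη]
    refine (hgrowth _ (hus n) (hn.trans (EReal.coe_le_coe_iff.mpr hQρ))).trans ?_
    exact mul_le_mul_of_nonneg_left ((minSection_isMinimal h₁ (hus n)).2 _ (hξ n)) hν₀
  set ψ : ℕ → ℝ := fun n => (φ₁ (u (n + 1))).toReal - (φ₁ u₀).toReal with hψ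
  have hchain : ∀ n, ∑ p ∈ Finset.HasAntidiagonal.antidiagonal n, backwardDiff b p.1 * ψ p.2
      ≤ inner ℝ (ξ n) (f n + η n - ξ n) := fun n =>
    hab.chain_rule h₁ hu₀ (u := fun n => u (n + 1)) (g := fun n => f n + η n - ξ n) hu hud (hξ n)
  -- the argument proceeds by strong induction over the time steps
  have main : ∀ n, (∑ p ∈ Finset.HasAntidiagonal.antidiagonal n, a p.1 * ‖ξ p.2‖ ^ 2 ≤ 2 * Q /
    (1 - ν)) ∧
      (φ₁ (u (n + 1)) ≤ ((Q / (1 - ν) : ℝ) : EReal)) := by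
    intro n
    induction n using Nat.strong_induction_on with
    | _ n ih =>
      have hηn : ∀ j ≤ n, ‖η j‖ ≤ ν * (match j with | 0 => 0 | j + 1 => ‖ξ j‖) := by
        rintro (_ | j) hj
        · simp [hη0]
        · exact hηbd j (ih j hj).2
      -- As φ² is treated explicitly, η j is controlled by ξ (j - 1). The value 0 at j = 0 matches η
      -- 0 = 0.
      set y : ℕ → ℝ := fun j => match j with | 0 => 0 | j + 1 => ‖ξ j‖ ^ 2 with hy
      have hstep : ∀ j ≤ n, ∑ q ∈ Finset.HasAntidiagonal.antidiagonal j, backwardDiff b q.1 * ψ q.2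
          ≤ -(1 / 2) * ‖ξ j‖ ^ 2 + ν / 2 * y j + 1 / (2 * (1 - ν)) * ‖f j‖ ^ 2 := by
        intro j hj
        refine (hchain j).trans ?_
        rw [inner_sub_right, inner_add_right, real_inner_self_eq_norm_sq]
        -- The Young weights (1 - ν)/2 here and ν/2 below add up to 1/2, so half of ‖ξ j‖² survives.
        have e1 : inner ℝ (ξ j) (f j) ≤ (1 - ν) / 2 * ‖ξ j‖ ^ 2
            + 1 / (2 * (1 - ν)) * ‖f j‖ ^ 2 := by
          refine (real_inner_le_norm _ _).trans ?_
          have : (1 - ν) / 2 * ‖ξ j‖ ^ 2 + 1 / (2 * (1 - ν)) * ‖f j‖ ^ 2 - ‖ξ j‖ * ‖f j‖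
              = ((1 - ν) * ‖ξ j‖ - ‖f j‖) ^ 2 / (2 * (1 - ν)) := by
            field_simp; ring
          have h3 : 0 ≤ ((1 - ν) * ‖ξ j‖ - ‖f j‖) ^ 2 / (2 * (1 - ν)) := by positivity
          linarith
        have e2 : inner ℝ (ξ j) (η j) ≤ ν / 2 * ‖ξ j‖ ^ 2 + ν / 2 * y j := by
          refine (real_inner_le_norm _ _).trans ?_
          have h3 := mul_le_mul_of_nonneg_left (hηn j hj) (norm_nonneg (ξ j))
          refine h3.trans ?_
          cases j with
          | zero => simp only [hy]; nlinarith [sq_nonneg ‖ξ 0‖]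
          | succ j =>
            simp only [hy]
            nlinarith [mul_nonneg hν₀ (sq_nonneg (‖ξ (j + 1)‖ - ‖ξ j‖))]
        linarith
      have hsum : ψ n ≤ -(1 / 2) * ∑ p ∈ Finset.HasAntidiagonal.antidiagonal n, a p.1 * ‖ξ p.2‖ ^ 2
          + ν / 2 * ∑ p ∈ Finset.HasAntidiagonal.antidiagonal n, a p.1 * y p.2
          + 1 / (2 * (1 - ν)) * ∑ p ∈ Finset.HasAntidiagonal.antidiagonal n, a p.1 * ‖f p.2‖ ^ 2 :=
            by
        -- Convolving the step inequalities with a undoes the backward difference on the left.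
        rw [hab.conv_backwardDiff_conv ψ n, Finset.mul_sum, Finset.mul_sum, Finset.mul_sum,
          ← Finset.sum_add_distrib, ← Finset.sum_add_distrib]
        refine Finset.sum_le_sum fun p hp => ?_
        have := mul_le_mul_of_nonneg_left (hstep p.2 (by
          rw [Finset.HasAntidiagonal.mem_antidiagonal] at hp; omega)) (hab.left_nonneg p.1)
        linarith
      have hG0 : 0 ≤ 2 * Q / (1 - ν) := by positivity
      have hys := hab.conv_succ_le (x := y) (y := fun j => ‖ξ j‖ ^ 2) (fun j => le_rfl) rfl hG0
        (fun j hj => (ih j hj).1)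
      have hfs : 1 / (2 * (1 - ν)) * ∑ p ∈ Finset.HasAntidiagonal.antidiagonal n, a p.1 * ‖f p.2‖ ^
        2
          ≤ F / (2 * (1 - ν)) := by
        have := mul_le_mul_of_nonneg_left (hF n) (show 0 ≤ 1 / (2 * (1 - ν)) by positivity)
        calc _ ≤ _ := this
          _ = _ := by ring
      have hν2 := mul_le_mul_of_nonneg_left hys (show 0 ≤ ν / 2 by positivity)
      have hX0 : 0 ≤ ∑ p ∈ Finset.HasAntidiagonal.antidiagonal n, a p.1 * ‖ξ p.2‖ ^ 2 :=
        Finset.sum_nonneg fun p _ =>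
        mul_nonneg (hab.left_nonneg _) (sq_nonneg _)
      -- 2Q/(1 - ν) is the fixed point of X ↦ 2Q + νX, so the bound on a * ‖ξ‖² reproduces itself
      -- from earlier steps to step n.
      have hid : Q + ν / 2 * (2 * Q / (1 - ν)) = Q / (1 - ν) := by field_simp; ring
      have hid2 : 2 * Q / (1 - ν) = 2 * (Q / (1 - ν)) := by ring
      have hφn := hφ0 (u (n + 1))
      simp only [hψ] at hsum
      constructor
      · linarith
      · rw [← h₁.coe_toReal (hud n), EReal.coe_le_coe_iff]
        linarith
  refine ⟨u, ξ, η, hu0, hu, hξ, fun n => ?_, ?_, fun n => (main n).1, fun n => ?_⟩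
  · rw [hη]; exact (minSection_isMinimal h₂ (hdom (hus n))).1
  · rintro (_ | n)
    · rw [hu0, ← h₁.coe_toReal hu₀, EReal.coe_le_coe_iff, le_div_iff₀ hν]
      nlinarith [hφ0 u₀]
    · exact (main n).2
  · refine hab.conv_succ_le (x := fun j => ‖η j‖ ^ 2) (y := fun j => ‖ξ j‖ ^ 2) (fun j => ?_)
      (by simp [hη0]) (by positivity) (fun j _ => (main j).1)
    have h1 := hηbd j (main j).2
    have h2 : ν * ‖ξ j‖ ≤ ‖ξ j‖ := mul_le_of_le_one_left (norm_nonneg _) hν₁.le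
    exact pow_le_pow_left₀ (norm_nonneg _) (h1.trans h2) 2

end Scheme

/-! ### Poisson weights: addition formula, tail and variance. -/

/-- The Poisson weights `e^{-λt} (λt)ⁿ / n!`. -/
noncomputable def poissonWeight (L : ℝ) (n : ℕ) (t : ℝ) : ℝ :=
  Real.exp (-(L * t)) * ((L * t) ^ n / n.factorial)

section PoissonWeight

variable {L t : ℝ}

theorem poissonWeight_nonneg (hL : 0 ≤ L) (ht : 0 ≤ t) (n : ℕ) : 0 ≤ poissonWeight L n t := by
  unfold poissonWeight; positivity

theorem poissonWeight_zero (L t : ℝ) : poissonWeight L 0 t = Real.exp (-(L * t)) := by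
  simp [poissonWeight]

@[fun_prop]
theorem continuous_poissonWeight (L : ℝ) (n : ℕ) : Continuous (poissonWeight L n) := by
  unfold poissonWeight; fun_prop

theorem hasSum_pow_div_factorial (x : ℝ) : HasSum (fun n : ℕ => x ^ n / n.factorial) (Real.exp x) :=
    by
  rw [Real.exp_eq_exp_ℝ]
  exact NormedSpace.expSeries_div_hasSum_exp x

theorem hasSum_poissonWeight (L t : ℝ) : HasSum (fun n => poissonWeight L n t) 1 := by
  have := (hasSum_pow_div_factorial (L * t)).mul_left (Real.exp (-(L * t)))
  rwa [← Real.exp_add, neg_add_cancel, Real.exp_zero] at this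

theorem sum_poissonWeight_le_one (hL : 0 ≤ L) (ht : 0 ≤ t) (s : Finset ℕ) :
    ∑ n ∈ s, poissonWeight L n t ≤ 1 :=
  sum_le_hasSum s (fun n _ => poissonWeight_nonneg hL ht n) (hasSum_poissonWeight L t)

theorem poissonWeight_le_one (hL : 0 ≤ L) (ht : 0 ≤ t) (n : ℕ) : poissonWeight L n t ≤ 1 := by
  simpa using sum_poissonWeight_le_one hL ht {n}

theorem abs_poissonWeight_le_one (hL : 0 ≤ L) (ht : 0 ≤ t) (n : ℕ) :
    |poissonWeight L n t| ≤ 1 := by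
  rw [abs_of_nonneg (poissonWeight_nonneg hL ht n)]; exact poissonWeight_le_one hL ht n

/-- The binomial theorem. This identity is the reason for choosing Poisson weights: it makes the
moments of a convolution a discrete convolution. -/
theorem poissonWeight_add (L s t : ℝ) (n : ℕ) :
    poissonWeight L n (s + t)
      = ∑ p ∈ Finset.HasAntidiagonal.antidiagonal n, poissonWeight L p.1 s * poissonWeight L p.2 t
        := by
  unfold poissonWeight
  rw [mul_add, neg_add, Real.exp_add, (Commute.all (L * s) (L * t)).add_pow', Finset.sum_div,
    Finset.mul_sum]
  refine Finset.sum_congr rfl fun p hp => ?_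
  rw [Finset.HasAntidiagonal.mem_antidiagonal] at hp
  have h1 : (n.choose p.1 : ℝ) * p.1.factorial * p.2.factorial = n.factorial := by
    have := Nat.choose_mul_factorial_mul_factorial (show p.1 ≤ n by omega)
    rw [show n - p.1 = p.2 by omega] at this
    exact_mod_cast this
  have hn : (n.factorial : ℝ) ≠ 0 := by positivity
  have h1' : (p.1.factorial : ℝ) ≠ 0 := by positivity
  have h2' : (p.2.factorial : ℝ) ≠ 0 := by positivity
  rw [nsmul_eq_mul]
  field_simp
  rw [← h1]; ring

theorem integrableOn_poissonWeight (hL : 0 < L) (n : ℕ) :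
    IntegrableOn (poissonWeight L n) (Ioi 0) := by
  have h := integrableOn_rpow_mul_exp_neg_mul_rpow (s := n) (p := 1) (b := L)
    (by have : (0 : ℝ) ≤ n := n.cast_nonneg
        linarith) zero_lt_one hL
  refine IntegrableOn.congr_fun (h.const_mul (L ^ n / n.factorial)) (fun t ht => ?_)
    measurableSet_Ioi
  simp only [Real.rpow_natCast, Real.rpow_one, poissonWeight, mul_pow]
  rw [neg_mul]; ring

theorem integral_poissonWeight (hL : 0 < L) (n : ℕ) :
    ∫ t in Ioi (0 : ℝ), poissonWeight L n t = L⁻¹ := by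
  have h := Real.integral_rpow_mul_exp_neg_mul_Ioi (a := n + 1) (by positivity) hL
  rw [Real.Gamma_nat_eq_factorial] at h
  have : ∫ t in Ioi (0 : ℝ), poissonWeight L n t
      = ∫ t in Ioi (0 : ℝ), L ^ n / n.factorial * (t ^ ((n : ℝ) + 1 - 1) * Real.exp (-(L * t))) :=
        by
    refine setIntegral_congr_fun measurableSet_Ioi fun t ht => ?_
    simp only [add_sub_cancel_right, Real.rpow_natCast, poissonWeight, mul_pow]
    ring
  rw [this, integral_const_mul, h, show (n : ℝ) + 1 = ((n + 1 : ℕ) : ℝ) by push_cast; ring,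
    Real.rpow_natCast]
  have hn : (n.factorial : ℝ) ≠ 0 := by positivity
  rw [one_div, inv_pow, pow_succ]
  field_simp

/-- Exhibits the single sign change, at t = (n + 1)/L, on which monotonicity of the moments rests.
-/
theorem poissonWeight_sub_succ (L t : ℝ) (n : ℕ) :
    poissonWeight L n t - poissonWeight L (n + 1) t
      = poissonWeight L n t * (1 - L * t / (n + 1)) := by
  unfold poissonWeight
  rw [pow_succ, Nat.factorial_succ]
  have hn : (n.factorial : ℝ) ≠ 0 := by positivity
  have hn' : (n : ℝ) + 1 ≠ 0 := by positivity
  push_cast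
  field_simp

/-- A Chernoff bound: multiply the i-th term by e^{(m-i)/L} ≥ 1 and sum the exponential series. It
supplies the majorant e^{-t/2}, uniform in L, for sums over n of order L. -/
theorem sum_range_poissonWeight_le (hL : 1 ≤ L) (ht : 0 ≤ t) (m : ℕ) :
    ∑ i ∈ Finset.range m, poissonWeight L i t ≤ Real.exp (m / L - t / 2) := by
  have hL0 : 0 < L := by linarith
  set q : ℝ := Real.exp (-L⁻¹) with hq
  have h1 : ∀ i ∈ Finset.range m, poissonWeight L i t
      ≤ Real.exp (m / L - L * t) * ((L * t * q) ^ i / i.factorial) := by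
    intro i hi
    have hi' : (i : ℝ) ≤ m := by exact_mod_cast (Finset.mem_range.mp hi).le
    have e1 : Real.exp (m / L - L * t) * ((L * t * q) ^ i / i.factorial)
        = poissonWeight L i t * Real.exp ((m - i) / L) := by
      unfold poissonWeight
      rw [mul_pow, hq, ← Real.exp_nat_mul, sub_eq_add_neg, Real.exp_add,
        show ((m : ℝ) - i) / L = m / L + i * -L⁻¹ by field_simp; ring, Real.exp_add]
      ring
    rw [e1]
    refine le_mul_of_one_le_right (poissonWeight_nonneg hL0.le ht i) (Real.one_le_exp ?_)
    exact div_nonneg (by linarith) hL0.le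
  refine (Finset.sum_le_sum h1).trans ?_
  rw [← Finset.mul_sum]
  have h2 : ∑ i ∈ Finset.range m, (L * t * q) ^ i / i.factorial ≤ Real.exp (L * t * q) :=
    sum_le_hasSum _ (fun i _ => by positivity) (hasSum_pow_div_factorial _)
  refine (mul_le_mul_of_nonneg_left h2 (Real.exp_nonneg _)).trans ?_
  rw [← Real.exp_add, Real.exp_le_exp]
  -- e^{-x} ≤ 1/(1 + x) ≤ 1 - x/2 for 0 < x ≤ 1, with x = 1/L.
  have h3 : q ≤ 1 - L⁻¹ / 2 := by
    have hx1 : L⁻¹ ≤ 1 := inv_le_one_of_one_le₀ hL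
    have hx0 : 0 < L⁻¹ := inv_pos.mpr hL0
    have h4 : q * (1 + L⁻¹) ≤ 1 := by
      have := mul_le_mul_of_nonneg_left (Real.add_one_le_exp L⁻¹) (Real.exp_nonneg (-L⁻¹))
      rw [← Real.exp_add, neg_add_cancel, Real.exp_zero] at this
      linarith
    have hq0 : 0 < q := Real.exp_pos _
    nlinarith
  have h5 : L * t * q ≤ L * t * (1 - L⁻¹ / 2) := mul_le_mul_of_nonneg_left h3 (by positivity)
  have h6 : L * t * (1 - L⁻¹ / 2) = L * t - t / 2 := by field_simp
  linarith

/-- The variance of the Poisson distribution. -/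
theorem hasSum_poissonWeight_mul_sq (hL : 0 < L) (t : ℝ) :
    HasSum (fun n : ℕ => poissonWeight L n t * (n / L - t) ^ 2) (t / L) := by
  set x := L * t with hx
  have h0 := hasSum_poissonWeight L t
  have hshift : ∀ n : ℕ, poissonWeight L (n + 1) t * (n + 1) = x * poissonWeight L n t := by
    intro n
    unfold poissonWeight
    rw [pow_succ, Nat.factorial_succ, ← hx]
    have hn : (n.factorial : ℝ) ≠ 0 := by positivity
    have hn' : (n : ℝ) + 1 ≠ 0 := by positivity
    push_cast
    field_simp
  have h1 : HasSum (fun n : ℕ => poissonWeight L n t * n) x := by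
    rw [← hasSum_nat_add_iff' 1]
    simp only [Finset.range_one, Finset.sum_singleton, Nat.cast_zero, mul_zero, sub_zero,
      Nat.cast_add, Nat.cast_one]
    simpa [hshift] using h0.mul_left x
  have h2 : HasSum (fun n : ℕ => poissonWeight L n t * n ^ 2) (x * (x + 1)) := by
    rw [← hasSum_nat_add_iff' 1]
    simp only [Finset.range_one, Finset.sum_singleton, Nat.cast_zero, mul_zero, sub_zero,
      Nat.cast_add, Nat.cast_one, ne_eq, OfNat.ofNat_ne_zero, not_false_eq_true, zero_pow]
    refine ((h1.add h0).mul_left x).congr_fun fun n => ?_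
    rw [sq, ← mul_assoc, hshift]; ring
  have h3 := ((h2.mul_left (L⁻¹ ^ 2)).add (h1.mul_left (-2 * t * L⁻¹))).add (h0.mul_left (t ^ 2))
  have e : t / L = L⁻¹ ^ 2 * (x * (x + 1)) + -2 * t * L⁻¹ * x + t ^ 2 * 1 := by
    rw [hx]; field_simp; ring
  rw [e]
  exact h3.congr_fun fun n => by field_simp; ring

end PoissonWeight

/-! ### Poisson moments of kernels and preservation of conjugacy. -/

/-- A nonnegative, nonincreasing, locally integrable kernel on the half-line. -/
structure IsKernel (k : ℝ → ℝ) : Prop where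
  locInt : LocallyIntegrableOn k (Ici 0)
  nonneg : ∀ t, 0 < t → 0 ≤ k t
  anti : AntitoneOn k (Ioi 0)

theorem ConjugateKernels.isKernel_left {k l : ℝ → ℝ} (h : ConjugateKernels k l) : IsKernel k :=
  ⟨h.k_locInt, h.k_nonneg, h.k_anti⟩

theorem ConjugateKernels.isKernel_right {k l : ℝ → ℝ} (h : ConjugateKernels k l) : IsKernel l :=
  ⟨h.l_locInt, h.l_nonneg, h.l_anti⟩

/-- The moments `∫₀^∞ k(t) e^{-Lt} (Lt)ⁿ / n! dt`. -/
noncomputable def poissonMoment (k : ℝ → ℝ) (L : ℝ) (n : ℕ) : ℝ :=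
  ∫ t in Ioi (0 : ℝ), k t * poissonWeight L n t

/-- A kernel as a measurable function on the line, vanishing on `(-∞, 0]`. -/
noncomputable def extKernel (k : ℝ → ℝ) : ℝ → ℝ≥0∞ :=
  (Ioi (0 : ℝ)).indicator fun t => ENNReal.ofReal (k t)

namespace IsKernel

variable {k : ℝ → ℝ} (hk : IsKernel k)
include hk

theorem integrableOn_Ioc (R : ℝ) : IntegrableOn k (Ioc 0 R) :=
  (hk.locInt.integrableOn_compact_subset (fun _ h => h.1)
    (isCompact_Icc (a := 0) (b := R))).mono_set
    Ioc_subset_Icc_self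

theorem aestronglyMeasurable : AEStronglyMeasurable k (volume.restrict (Ioi 0)) :=
  hk.locInt.aestronglyMeasurable.mono_set Ioi_subset_Ici_self

/-- On (0, 1] the kernel is integrable and q is bounded; on (1, ∞) the kernel is at most k 1 and q
is integrable. -/
theorem integrableOn_mul {q : ℝ → ℝ} {B : ℝ} (hq : IntegrableOn q (Ioi 0))
    (hB : ∀ t, 0 < t → |q t| ≤ B) : IntegrableOn (fun t => k t * q t) (Ioi 0) := by
  rw [← Ioc_union_Ioi_eq_Ioi (zero_le_one' ℝ)]
  refine IntegrableOn.union ?_ ?_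
  · refine Integrable.mul_bdd (c := B) (hk.integrableOn_Ioc 1)
      (hq.aestronglyMeasurable.mono_set Ioc_subset_Ioi_self) ?_
    filter_upwards [ae_restrict_mem measurableSet_Ioc] with t ht using hB t ht.1
  · refine Integrable.bdd_mul (c := k 1) (hq.mono_set (Ioi_subset_Ioi zero_le_one))
      (hk.aestronglyMeasurable.mono_set (Ioi_subset_Ioi zero_le_one)) ?_
    filter_upwards [ae_restrict_mem measurableSet_Ioi] with t ht
    have ht' : (1 : ℝ) < t := ht
    rw [Real.norm_eq_abs, abs_of_nonneg (hk.nonneg t (by linarith))]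
    exact hk.anti (show (0 : ℝ) < 1 by norm_num) (show (0 : ℝ) < t by linarith) ht'.le

theorem integrableOn_mul_poissonWeight {L : ℝ} (hL : 0 < L) (n : ℕ) :
    IntegrableOn (fun t => k t * poissonWeight L n t) (Ioi 0) :=
  hk.integrableOn_mul (integrableOn_poissonWeight hL n)
    fun _ ht => abs_poissonWeight_le_one hL.le ht.le n

theorem integrableOn_mul_exp {c : ℝ} (hc : 0 < c) :
    IntegrableOn (fun t => k t * Real.exp (-(c * t))) (Ioi 0) := by
  simpa only [poissonWeight_zero] using hk.integrableOn_mul_poissonWeight hc 0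

theorem poissonMoment_nonneg {L : ℝ} (hL : 0 ≤ L) (n : ℕ) : 0 ≤ poissonMoment k L n :=
  setIntegral_nonneg measurableSet_Ioi fun t ht =>
    mul_nonneg (hk.nonneg t ht) (poissonWeight_nonneg hL (le_of_lt ht) n)

/-- The difference of consecutive weights has integral zero and changes sign once, at (n + 1)/L.
Subtracting the constant k((n + 1)/L) from the nonincreasing k changes nothing and leaves a product
of factors of equal sign. -/
theorem poissonMoment_antitone {L : ℝ} (hL : 0 < L) : Antitone (poissonMoment k L) := by
  refine antitone_nat_of_succ_le fun n => ?_
  rw [← sub_nonneg]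
  have hI := hk.integrableOn_mul_poissonWeight hL
  have hP := integrableOn_poissonWeight hL
  set c : ℝ := k ((n + 1) / L)
  have h0 : ∫ t in Ioi (0 : ℝ), c * (poissonWeight L n t - poissonWeight L (n + 1) t) = 0 := by
    rw [integral_const_mul, integral_sub (hP n) (hP (n + 1)), integral_poissonWeight hL,
      integral_poissonWeight hL, sub_self, mul_zero]
  have h1 : poissonMoment k L n - poissonMoment k L (n + 1)
      = ∫ t in Ioi (0 : ℝ), (k t - c) * (poissonWeight L n t - poissonWeight L (n + 1) t) := by
    unfold poissonMoment
    have e : ∀ t, (k t - c) * (poissonWeight L n t - poissonWeight L (n + 1) t)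
        = (k t * poissonWeight L n t - k t * poissonWeight L (n + 1) t)
          - c * (poissonWeight L n t - poissonWeight L (n + 1) t) := fun t => by ring
    simp only [e]
    rw [← integral_sub (hI n) (hI (n + 1)), eq_comm, integral_sub, h0, sub_zero]
    · exact (hI n).sub (hI (n + 1))
    · exact ((hP n).sub (hP (n + 1))).const_mul c
  rw [h1]
  refine setIntegral_nonneg measurableSet_Ioi fun t ht => ?_
  have ht' : 0 < t := ht
  rw [poissonWeight_sub_succ]
  have hw := poissonWeight_nonneg hL.le ht'.le n
  have hn : (0 : ℝ) < n + 1 := by positivity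
  have hs : (0 : ℝ) < (n + 1) / L := by positivity
  rcases le_total t ((n + 1) / L) with h | h
  · have h2 : L * t / (n + 1) ≤ 1 := by
      rw [div_le_one hn]; rw [le_div_iff₀ hL] at h; linarith
    exact mul_nonneg (sub_nonneg.mpr (hk.anti ht' hs h)) (mul_nonneg hw (by linarith))
  · have h2 : 1 ≤ L * t / (n + 1) := by
      rw [one_le_div hn]; rw [div_le_iff₀ hL] at h; linarith
    exact mul_nonneg_of_nonpos_of_nonpos (sub_nonpos.mpr (hk.anti hs ht' h))
      (mul_nonpos_of_nonneg_of_nonpos hw (by linarith))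

theorem measurable_extKernel : Measurable (extKernel k) := by
  refine measurable_of_restrict_of_restrict_compl measurableSet_Ioi (s := Ioi (0 : ℝ)) ?_ ?_
  · have : (Ioi (0 : ℝ)).domRestrict (extKernel k)
        = fun t : Ioi (0 : ℝ) => ENNReal.ofReal (k t) := by
      ext t; simp [extKernel]
    rw [this]
    refine ENNReal.measurable_ofReal.comp (Antitone.measurable fun a b hab => ?_)
    exact hk.anti a.2 b.2 hab
  · have : (Ioi (0 : ℝ))ᶜ.domRestrict (extKernel k) = fun _ => 0 := by
      ext t; simp [extKernel, Set.indicator_of_notMem t.2]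
    rw [this]
    exact measurable_const

theorem lintegral_extKernel_mul {q : ℝ → ℝ} (hq : ∀ t, 0 < t → 0 ≤ q t)
    (hi : IntegrableOn (fun t => k t * q t) (Ioi 0)) :
    ∫⁻ t, extKernel k t * ENNReal.ofReal (q t) = ENNReal.ofReal (∫ t in Ioi 0, k t * q t) := by
  rw [ofReal_integral_eq_lintegral_ofReal hi, ← lintegral_indicator measurableSet_Ioi]
  · refine lintegral_congr fun t => ?_
    by_cases ht : t ∈ Ioi (0 : ℝ)
    · simp only [extKernel, Set.indicator_of_mem ht]
      rw [ENNReal.ofReal_mul (hk.nonneg t ht)]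
    · simp [extKernel, Set.indicator_of_notMem ht]
  · filter_upwards [ae_restrict_mem measurableSet_Ioi] with t ht
    exact mul_nonneg (hk.nonneg t ht) (hq t ht)

end IsKernel

/-- Tonelli's theorem for a convolution tested against a weight. -/
theorem lintegral_conv_mul {K W Θ : ℝ → ℝ≥0∞} (hK : Measurable K) (hW : Measurable W)
    (hΘ : Measurable Θ) :
    ∫⁻ t, (∫⁻ s, K (t - s) * W s) * Θ t = ∫⁻ s, ∫⁻ r, K r * W s * Θ (r + s) := by
  calc ∫⁻ t, (∫⁻ s, K (t - s) * W s) * Θ t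
      = ∫⁻ t, ∫⁻ s, K (t - s) * W s * Θ t := by
        refine lintegral_congr fun t => ?_
        rw [lintegral_mul_const]
        fun_prop
    _ = ∫⁻ s, ∫⁻ t, K (t - s) * W s * Θ t := by
        rw [lintegral_lintegral_swap]
        fun_prop
    _ = ∫⁻ s, ∫⁻ r, K r * W s * Θ (r + s) := by
        refine lintegral_congr fun s => ?_
        rw [← lintegral_sub_right_eq_self (fun r => K r * W s * Θ (r + s)) s]
        simp only [sub_add_cancel]

theorem measurable_poissonWeight_ofReal (L : ℝ) (n : ℕ) :
    Measurable fun t => ENNReal.ofReal (poissonWeight L n t) :=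
  ENNReal.measurable_ofReal.comp (continuous_poissonWeight L n).measurable

/-- Poisson moments turn convolutions into convolutions of sequences. -/
theorem lintegral_conv_mul_poissonWeight {K W : ℝ → ℝ≥0∞} (hK : Measurable K) (hW : Measurable W)
    (hK0 : ∀ t ≤ 0, K t = 0) (hW0 : ∀ t ≤ 0, W t = 0) {L : ℝ} (hL : 0 ≤ L) (n : ℕ) :
    ∫⁻ t, (∫⁻ s, K (t - s) * W s) * ENNReal.ofReal (poissonWeight L n t)
      = ∑ p ∈ Finset.HasAntidiagonal.antidiagonal n,
        (∫⁻ t, K t * ENNReal.ofReal (poissonWeight L p.1 t)) *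
          ∫⁻ t, W t * ENNReal.ofReal (poissonWeight L p.2 t) := by
  have hm := measurable_poissonWeight_ofReal L
  have hKm : ∀ j, Measurable fun t => K t * ENNReal.ofReal (poissonWeight L j t) := fun j =>
    hK.mul (hm j)
  have hWm : ∀ j, Measurable fun t => W t * ENNReal.ofReal (poissonWeight L j t) := fun j =>
    hW.mul (hm j)
  rw [lintegral_conv_mul hK hW (hm n)]
  have h1 : ∀ s r : ℝ, K r * W s * ENNReal.ofReal (poissonWeight L n (r + s))
      = ∑ p ∈ Finset.HasAntidiagonal.antidiagonal n,
        (K r * ENNReal.ofReal (poissonWeight L p.1 r)) *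
          (W s * ENNReal.ofReal (poissonWeight L p.2 s)) := by
    intro s r
    rcases le_or_gt r 0 with hr | hr
    · simp [hK0 r hr]
    rcases le_or_gt s 0 with hs | hs
    · simp [hW0 s hs]
    rw [poissonWeight_add, ENNReal.ofReal_sum_of_nonneg fun p _ =>
      mul_nonneg (poissonWeight_nonneg hL hr.le _) (poissonWeight_nonneg hL hs.le _),
      Finset.mul_sum]
    refine Finset.sum_congr rfl fun p _ => ?_
    rw [ENNReal.ofReal_mul (poissonWeight_nonneg hL hr.le _)]
    ring
  simp only [h1]
  have h2 : ∀ s : ℝ, ∫⁻ r, ∑ p ∈ Finset.HasAntidiagonal.antidiagonal n,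
        (K r * ENNReal.ofReal (poissonWeight L p.1 r)) *
          (W s * ENNReal.ofReal (poissonWeight L p.2 s))
      = ∑ p ∈ Finset.HasAntidiagonal.antidiagonal n,
        (∫⁻ r, K r * ENNReal.ofReal (poissonWeight L p.1 r)) *
          (W s * ENNReal.ofReal (poissonWeight L p.2 s)) := by
    intro s
    rw [lintegral_finsetSum _ fun p _ => ((hKm _).mul_const _)]
    exact Finset.sum_congr rfl fun p _ => lintegral_mul_const _ (hKm _)
  simp only [h2]
  rw [lintegral_finsetSum _ fun p _ => ((hWm _).const_mul _)]
  exact Finset.sum_congr rfl fun p _ => lintegral_const_mul _ (hWm _)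

theorem extKernel_of_nonpos (k : ℝ → ℝ) : ∀ t ≤ 0, extKernel k t = 0 := fun t ht =>
  Set.indicator_of_notMem (by simpa using ht) _

theorem lintegral_extKernel_conv (k w : ℝ → ℝ) {t : ℝ} (ht : 0 ≤ t)
    (hk : ∀ t, 0 < t → 0 ≤ k t) (hw : ∀ t, 0 < t → 0 ≤ w t)
    (hi : IntervalIntegrable (fun s => k (t - s) * w s) volume 0 t) :
    ∫⁻ s, extKernel k (t - s) * extKernel w s = ENNReal.ofReal (conv k w t) := by
  have hi' : IntegrableOn (fun s => k (t - s) * w s) (Ioo 0 t) :=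
    ((intervalIntegrable_iff_integrableOn_Ioc_of_le ht).mp hi).mono_set Ioo_subset_Ioc_self
  have hc : conv k w t = ∫ s in Ioo 0 t, k (t - s) * w s := by
    unfold conv
    rw [intervalIntegral.integral_of_le ht, integral_Ioc_eq_integral_Ioo]
    rfl
  have hnn : ∀ s ∈ Ioo 0 t, 0 ≤ k (t - s) * w s := fun s hs =>
    mul_nonneg (hk _ (sub_pos.mpr hs.2)) (hw s hs.1)
  rw [hc, ofReal_integral_eq_lintegral_ofReal hi'
    (by filter_upwards [ae_restrict_mem measurableSet_Ioo] with s hs using hnn s hs),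
    ← lintegral_indicator measurableSet_Ioo]
  refine lintegral_congr fun s => ?_
  by_cases hs : s ∈ Ioo 0 t
  · rw [Set.indicator_of_mem hs, extKernel, extKernel, Set.indicator_of_mem
    (show s ∈ Ioi 0 from hs.1),
      Set.indicator_of_mem (show t - s ∈ Ioi 0 from sub_pos.mpr hs.2),
      ENNReal.ofReal_mul (hk _ (sub_pos.mpr hs.2))]
  · rw [Set.indicator_of_notMem hs]
    rcases le_or_gt s 0 with h0 | h0
    · rw [extKernel_of_nonpos w s h0, mul_zero]
    · rw [extKernel_of_nonpos k (t - s) (by by_contra! h; exact hs ⟨h0, by linarith⟩), zero_mul]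

theorem lintegral_ofReal_poissonWeight {L : ℝ} (hL : 0 < L) (n : ℕ) :
    ∫⁻ t in Ioi (0 : ℝ), ENNReal.ofReal (poissonWeight L n t) = ENNReal.ofReal L⁻¹ := by
  rw [← integral_poissonWeight hL n,
    ofReal_integral_eq_lintegral_ofReal (integrableOn_poissonWeight hL n)]
  filter_upwards [ae_restrict_mem measurableSet_Ioi] with t ht
  exact poissonWeight_nonneg hL.le (le_of_lt ht) n

theorem IsKernel.lintegral_extKernel_mul_poissonWeight {k : ℝ → ℝ} (hk : IsKernel k) {L : ℝ}
    (hL : 0 < L) (n : ℕ) :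
    ∫⁻ t, extKernel k t * ENNReal.ofReal (poissonWeight L n t)
      = ENNReal.ofReal (poissonMoment k L n) :=
  hk.lintegral_extKernel_mul (fun _ ht => poissonWeight_nonneg hL.le ht.le n)
    (hk.integrableOn_mul_poissonWeight hL n)

/-- The Poisson moments of conjugate kernels are conjugate sequences. -/
theorem ConjugateKernels.conjugateSequences {k l : ℝ → ℝ} (h : ConjugateKernels k l) {L : ℝ}
    (hL : 0 < L) :
    ConjugateSequences (poissonMoment l L) (fun n => L * poissonMoment k L n) where
  left_nonneg := h.isKernel_right.poissonMoment_nonneg hL.le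
  left_anti := h.isKernel_right.poissonMoment_antitone hL
  right_nonneg n := mul_nonneg hL.le (h.isKernel_left.poissonMoment_nonneg hL.le n)
  right_anti := fun _ _ hmn =>
    mul_le_mul_of_nonneg_left (h.isKernel_left.poissonMoment_antitone hL hmn) hL.le
  conv_eq_one n := by
    have hk := h.isKernel_left
    have hl := h.isKernel_right
    have h1 := lintegral_conv_mul_poissonWeight hl.measurable_extKernel hk.measurable_extKernel
      (extKernel_of_nonpos l) (extKernel_of_nonpos k) hL.le n
    have h2 : ∀ t, (∫⁻ s, extKernel l (t - s) * extKernel k s)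
        * ENNReal.ofReal (poissonWeight L n t)
        = (Ioi (0 : ℝ)).indicator (fun t => ENNReal.ofReal (poissonWeight L n t)) t := by
      intro t
      by_cases ht : t ∈ Ioi (0 : ℝ)
      · have ht' : 0 < t := ht
        -- Were the product not integrable, the convolution would take the default value 0, not 1.
        have hi : IntervalIntegrable (fun s => k (t - s) * l s) volume 0 t := by
          by_contra hni
          have := h.conv_eq_one t ht
          simp only [conv, smul_eq_mul] at this
          rw [intervalIntegral.integral_undef hni] at this
          exact zero_ne_one this
        have h3 := lintegral_extKernel_conv k l ht'.le hk.nonneg hl.nonneg hi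
        rw [h.conv_eq_one t ht, ENNReal.ofReal_one,
          ← lintegral_sub_left_eq_self _ t] at h3
        simp only [sub_sub_cancel] at h3
        rw [Set.indicator_of_mem ht]
        simp only [mul_comm (extKernel l _), h3, one_mul]
      · rw [Set.indicator_of_notMem ht]
        have : ∀ s, extKernel l (t - s) * extKernel k s = 0 := by
          intro s
          rcases le_or_gt s 0 with h0 | h0
          · rw [extKernel_of_nonpos k s h0, mul_zero]
          · rw [extKernel_of_nonpos l (t - s) (by
              have : t ≤ 0 := not_lt.mp ht
              linarith), zero_mul]
        simp [this]
    simp only [h2] at h1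
    -- Each moment of the constant 1 equals 1/L, which explains the factor L in the second sequence.
    rw [lintegral_indicator measurableSet_Ioi, lintegral_ofReal_poissonWeight hL] at h1
    simp only [hl.lintegral_extKernel_mul_poissonWeight hL,
      hk.lintegral_extKernel_mul_poissonWeight hL] at h1
    have hnn : ∀ p : ℕ × ℕ, 0 ≤ poissonMoment l L p.1 * poissonMoment k L p.2 := fun p =>
      mul_nonneg (hl.poissonMoment_nonneg hL.le _) (hk.poissonMoment_nonneg hL.le _)
    simp only [← ENNReal.ofReal_mul (hl.poissonMoment_nonneg hL.le _)] at h1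
    rw [← ENNReal.ofReal_sum_of_nonneg fun p _ => hnn p,
      ENNReal.ofReal_eq_ofReal_iff (inv_nonneg.mpr hL.le)
        (Finset.sum_nonneg fun p _ => hnn p)] at h1
    have h4 : ∑ p ∈ Finset.HasAntidiagonal.antidiagonal n,
        poissonMoment l L p.1 * (L * poissonMoment k L p.2)
        = L * ∑ p ∈ Finset.HasAntidiagonal.antidiagonal n,
          poissonMoment l L p.1 * poissonMoment k L p.2 := by
      rw [Finset.mul_sum]
      exact Finset.sum_congr rfl fun p _ => by ring
    rw [h4, ← h1, mul_inv_cancel₀ hL.ne']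

/-- The moments of a function whose convolution with `l` is bounded. -/
theorem ConjugateKernels.sum_mul_lintegral_le {k l : ℝ → ℝ} (h : ConjugateKernels k l) {L : ℝ}
    (hL : 0 < L) {W : ℝ → ℝ≥0∞} (hW : Measurable W) (hW0 : ∀ t ≤ 0, W t = 0) {F : ℝ} (hF : 0 ≤ F)
    (hWF : ∀ᵐ t ∂volume.restrict (Ioi 0), ∫⁻ s, extKernel l (t - s) * W s ≤ ENNReal.ofReal F)
    (n : ℕ) :
    ∑ p ∈ Finset.HasAntidiagonal.antidiagonal n, ENNReal.ofReal (poissonMoment l L p.1)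
        * ∫⁻ t, W t * ENNReal.ofReal (poissonWeight L p.2 t)
      ≤ ENNReal.ofReal (F / L) := by
  have hl := h.isKernel_right
  have h1 := lintegral_conv_mul_poissonWeight hl.measurable_extKernel hW
      (extKernel_of_nonpos l) hW0 hL.le n
  simp only [hl.lintegral_extKernel_mul_poissonWeight hL] at h1
  rw [← h1]
  calc ∫⁻ t, (∫⁻ s, extKernel l (t - s) * W s) * ENNReal.ofReal (poissonWeight L n t)
      = ∫⁻ t in Ioi 0, (∫⁻ s, extKernel l (t - s) * W s) * ENNReal.ofReal (poissonWeight L n t) :=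
        by
        rw [← lintegral_indicator measurableSet_Ioi]
        refine lintegral_congr fun t => ?_
        by_cases ht : t ∈ Ioi (0 : ℝ)
        · rw [Set.indicator_of_mem ht]
        · rw [Set.indicator_of_notMem ht]
          have : ∀ s, extKernel l (t - s) * W s = 0 := by
            intro s
            rcases le_or_gt s 0 with h0 | h0
            · rw [hW0 s h0, mul_zero]
            · rw [extKernel_of_nonpos l (t - s) (by
                have : t ≤ 0 := not_lt.mp ht
                linarith), zero_mul]
          simp [this]
    _ ≤ ∫⁻ t in Ioi 0, ENNReal.ofReal F * ENNReal.ofReal (poissonWeight L n t) :=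
        lintegral_mono_ae (by filter_upwards [hWF] with t ht; gcongr)
    _ = ENNReal.ofReal (F / L) := by
        rw [lintegral_const_mul _ (measurable_poissonWeight_ofReal L n),
          lintegral_ofReal_poissonWeight hL, ← ENNReal.ofReal_mul hF, div_eq_mul_inv]

/-- The moment occurs in a bounded sum of nonnegative terms with the positive coefficient
`poissonMoment l L 0`. -/
theorem ConjugateKernels.lintegral_mul_poissonWeight_lt_top {k l : ℝ → ℝ}
    (h : ConjugateKernels k l) {L : ℝ} (hL : 0 < L) {W : ℝ → ℝ≥0∞} (hW : Measurable W)
    (hW0 : ∀ t ≤ 0, W t = 0) {F : ℝ} (hF : 0 ≤ F)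
    (hWF : ∀ᵐ t ∂volume.restrict (Ioi 0), ∫⁻ s, extKernel l (t - s) * W s ≤ ENNReal.ofReal F)
    (n : ℕ) : ∫⁻ t, W t * ENNReal.ofReal (poissonWeight L n t) < ⊤ := by
  have h1 := h.sum_mul_lintegral_le hL hW hW0 hF hWF n
  have h2 := (Finset.single_le_sum (fun p _ => zero_le) (by simp :
    ((0, n) : ℕ × ℕ) ∈ Finset.HasAntidiagonal.antidiagonal n)).trans h1
  by_contra hne
  rw [not_lt, top_le_iff] at hne
  simp only [hne] at h2
  rw [ENNReal.mul_top (by simpa using (h.conjugateSequences hL).left_zero_pos)] at h2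
  exact absurd h2 (by simp)

/-! ### Averaging the data against the weights. -/

section DiscreteData

theorem integrableOn_of_lintegral_extKernel_lt_top {E : Type*} [NormedAddCommGroup E] {f : ℝ → E}
    (hf : StronglyMeasurable f)
    {q : ℝ → ℝ} (hq : Continuous q) (hq0 : ∀ t, 0 < t → 0 ≤ q t)
    (h : ∫⁻ t, extKernel (fun t => ‖f t‖ ^ 2) t * ENNReal.ofReal (q t) < ⊤) :
    IntegrableOn (fun t => q t * ‖f t‖ ^ 2) (Ioi 0) := by
  have hm : StronglyMeasurable fun t => q t * ‖f t‖ ^ 2 :=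
    hq.stronglyMeasurable.mul (hf.norm.pow 2)
  refine ⟨hm.aestronglyMeasurable, ?_⟩
  rw [hasFiniteIntegral_iff_enorm, ← lintegral_indicator measurableSet_Ioi]
  refine lt_of_le_of_lt (lintegral_mono fun t => ?_) h
  by_cases ht : t ∈ Ioi (0 : ℝ)
  · rw [Set.indicator_of_mem ht, extKernel, Set.indicator_of_mem ht, Real.enorm_eq_ofReal
      (mul_nonneg (hq0 t ht) (sq_nonneg _)), mul_comm, ENNReal.ofReal_mul (sq_nonneg _)]
  · rw [Set.indicator_of_notMem ht]; exact zero_le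

theorem measurable_extKernel_norm_sq {E : Type*} [NormedAddCommGroup E] {f : ℝ → E}
    (hf : StronglyMeasurable f) :
    Measurable (extKernel fun t => ‖f t‖ ^ 2) :=
  (ENNReal.measurable_ofReal.comp (hf.norm.measurable.pow_const 2)).indicator measurableSet_Ioi

theorem ConjugateKernels.integrableOn_poissonWeight_mul_norm_sq {E : Type*}
    [NormedAddCommGroup E] {f : ℝ → E} {k l : ℝ → ℝ} {F : ℝ} (h : ConjugateKernels k l)
    (hf : StronglyMeasurable f) (hF : 0 ≤ F)
    (hWF : ∀ᵐ t ∂volume.restrict (Ioi 0),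
      ∫⁻ s, extKernel l (t - s) * extKernel (fun t => ‖f t‖ ^ 2) s ≤ ENNReal.ofReal F)
    {L : ℝ} (hL : 0 < L) (n : ℕ) :
    IntegrableOn (fun t => poissonWeight L n t * ‖f t‖ ^ 2) (Ioi 0) :=
  integrableOn_of_lintegral_extKernel_lt_top hf (continuous_poissonWeight L n)
    (fun _ ht => poissonWeight_nonneg hL.le ht.le n)
    (h.lintegral_mul_poissonWeight_lt_top hL (measurable_extKernel_norm_sq hf)
      (extKernel_of_nonpos _) hF hWF n)

variable {H : Type u} [NormedAddCommGroup H] [InnerProductSpace ℝ H]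

/-- The average of `f` against the Gamma density with Poisson weight `n`. -/
noncomputable def poissonAverage (f : ℝ → H) (L : ℝ) (n : ℕ) : H :=
  L • ∫ t in Ioi (0 : ℝ), poissonWeight L n t • f t

theorem IntegrableOn.smul_of_mul_norm_sq {f : ℝ → H} (hf : StronglyMeasurable f)
    {q : ℝ → ℝ} (hq : Continuous q) (hq0 : ∀ t, 0 < t → 0 ≤ q t) (hqi : IntegrableOn q (Ioi 0))
    (h : IntegrableOn (fun t => q t * ‖f t‖ ^ 2) (Ioi 0)) :
    IntegrableOn (fun t => q t • f t) (Ioi 0) := by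
  refine Integrable.mono' (hqi.add h)
    (hq.stronglyMeasurable.smul hf).aestronglyMeasurable ?_
  filter_upwards [ae_restrict_mem measurableSet_Ioi] with t ht
  rw [norm_smul, Real.norm_eq_abs, abs_of_nonneg (hq0 t ht), Pi.add_apply]
  have : ‖f t‖ ≤ 1 + ‖f t‖ ^ 2 := by nlinarith [sq_nonneg (‖f t‖ - 1), norm_nonneg (f t)]
  nlinarith [hq0 t ht]

/-- Jensen's inequality for Poisson averages. -/
theorem norm_poissonAverage_sq_le [CompleteSpace H] {f : ℝ → H} {L : ℝ} (hL : 0 < L) {n : ℕ}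
    (h1 : IntegrableOn (fun t => poissonWeight L n t • f t) (Ioi 0))
    (h2 : IntegrableOn (fun t => poissonWeight L n t * ‖f t‖ ^ 2) (Ioi 0)) :
    ‖poissonAverage f L n‖ ^ 2 ≤ L * ∫ t in Ioi (0 : ℝ), poissonWeight L n t * ‖f t‖ ^ 2 := by
  set c := poissonAverage f L n with hc
  have e1 : ∫ t in Ioi (0 : ℝ), inner ℝ c (poissonWeight L n t • f t) = L⁻¹ * ‖c‖ ^ 2 := by
    rw [integral_inner h1, ← real_inner_self_eq_norm_sq]
    nth_rewrite 3 [hc]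
    rw [poissonAverage, real_inner_smul_right]
    field_simp
  have h3 : IntegrableOn (fun t => 2 * inner ℝ c (poissonWeight L n t • f t)) (Ioi 0) :=
    (h1.const_inner c).const_mul 2
  have h4 : IntegrableOn (fun t => poissonWeight L n t * ‖c‖ ^ 2) (Ioi 0) :=
    (integrableOn_poissonWeight hL n).mul_const _
  -- Integrate the weighted inequality 0 ≤ ‖c - f t‖², where c is the average itself.
  have hle := setIntegral_mono_on h3 (h2.add h4) measurableSet_Ioi fun t ht => by
    have hw := poissonWeight_nonneg hL.le (le_of_lt (show (0 : ℝ) < t from ht)) n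
    have := sq_nonneg ‖c - f t‖
    rw [norm_sub_sq_real] at this
    simp only [Pi.add_apply]
    rw [real_inner_smul_right]
    nlinarith
  simp only [Pi.add_apply] at hle
  rw [integral_const_mul, e1, integral_add h2 h4, integral_mul_const,
    integral_poissonWeight hL] at hle
  have := mul_le_mul_of_nonneg_left hle hL.le
  have e2 : L * (2 * (L⁻¹ * ‖c‖ ^ 2)) = 2 * ‖c‖ ^ 2 := by field_simp
  have e3 : L * ((∫ t in Ioi (0 : ℝ), poissonWeight L n t * ‖f t‖ ^ 2) + L⁻¹ * ‖c‖ ^ 2)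
      = L * (∫ t in Ioi (0 : ℝ), poissonWeight L n t * ‖f t‖ ^ 2) + ‖c‖ ^ 2 := by field_simp
  linarith

variable {k l : ℝ → ℝ} {f : ℝ → H} {F : ℝ}

theorem ConjugateKernels.integrableOn_poissonWeight_smul (h : ConjugateKernels k l)
    (hf : StronglyMeasurable f) (hF : 0 ≤ F)
    (hWF : ∀ᵐ t ∂volume.restrict (Ioi 0),
      ∫⁻ s, extKernel l (t - s) * extKernel (fun t => ‖f t‖ ^ 2) s ≤ ENNReal.ofReal F)
    {L : ℝ} (hL : 0 < L) (n : ℕ) :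
    IntegrableOn (fun t => poissonWeight L n t • f t) (Ioi 0) :=
  IntegrableOn.smul_of_mul_norm_sq hf (continuous_poissonWeight L n)
    (fun _ ht => poissonWeight_nonneg hL.le ht.le n) (integrableOn_poissonWeight hL n)
    (h.integrableOn_poissonWeight_mul_norm_sq hf hF hWF hL n)

/-- The bound on `l * ‖f‖²` is inherited by the Poisson averages of `f`. -/
theorem ConjugateKernels.sum_mul_norm_poissonAverage_sq_le [CompleteSpace H]
    (h : ConjugateKernels k l) (hf : StronglyMeasurable f) (hF : 0 ≤ F)
    (hWF : ∀ᵐ t ∂volume.restrict (Ioi 0),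
      ∫⁻ s, extKernel l (t - s) * extKernel (fun t => ‖f t‖ ^ 2) s ≤ ENNReal.ofReal F)
    {L : ℝ} (hL : 0 < L) (n : ℕ) :
    ∑ p ∈ Finset.HasAntidiagonal.antidiagonal n,
      poissonMoment l L p.1 * ‖poissonAverage f L p.2‖ ^ 2 ≤ F := by
  have hl := h.isKernel_right
  have h1 := h.sum_mul_lintegral_le hL (measurable_extKernel_norm_sq hf) (extKernel_of_nonpos _)
    hF hWF n
  have hi := fun j => h.integrableOn_poissonWeight_mul_norm_sq hf hF hWF hL j
  have hI0 : ∀ j, 0 ≤ ∫ t in Ioi (0 : ℝ), poissonWeight L j t * ‖f t‖ ^ 2 := fun j =>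
    setIntegral_nonneg measurableSet_Ioi fun t ht =>
      mul_nonneg (poissonWeight_nonneg hL.le (le_of_lt ht) j) (sq_nonneg _)
  have h2 : ∀ j, ∫⁻ t, extKernel (fun t => ‖f t‖ ^ 2) t * ENNReal.ofReal (poissonWeight L j t)
      = ENNReal.ofReal (∫ t in Ioi (0 : ℝ), poissonWeight L j t * ‖f t‖ ^ 2) := by
    intro j
    rw [ofReal_integral_eq_lintegral_ofReal (hi j), ← lintegral_indicator measurableSet_Ioi]
    · refine lintegral_congr fun t => ?_
      by_cases ht : t ∈ Ioi (0 : ℝ)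
      · simp only [extKernel, Set.indicator_of_mem ht]
        rw [mul_comm, ENNReal.ofReal_mul (poissonWeight_nonneg hL.le (le_of_lt ht) j)]
      · simp [extKernel, Set.indicator_of_notMem ht]
    · filter_upwards [ae_restrict_mem measurableSet_Ioi] with t ht
      exact mul_nonneg (poissonWeight_nonneg hL.le (le_of_lt ht) j) (sq_nonneg _)
  simp only [h2, ← ENNReal.ofReal_mul (hl.poissonMoment_nonneg hL.le _)] at h1
  rw [← ENNReal.ofReal_sum_of_nonneg fun p _ =>
    mul_nonneg (hl.poissonMoment_nonneg hL.le _) (hI0 _),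
    ENNReal.ofReal_le_ofReal_iff (by positivity), le_div_iff₀ hL, Finset.sum_mul] at h1
  refine (Finset.sum_le_sum fun p _ => ?_).trans h1
  have := mul_le_mul_of_nonneg_left (norm_poissonAverage_sq_le hL
    (h.integrableOn_poissonWeight_smul hf hF hWF hL p.2) (hi p.2))
    (hl.poissonMoment_nonneg hL.le p.1)
  refine this.trans (le_of_eq ?_)
  ring

end DiscreteData

/-! ### Concentration of Poisson weights and convergence of discrete convolutions. -/

section LawOfLargeNumbers

/-- Poisson averages concentrate at the mean. -/
theorem tendsto_sum_poissonWeight_mul {r M ℓ : ℝ} (hr : 0 ≤ r) {c : ℝ → ℕ → ℝ} {m : ℝ → ℕ}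
    (hM : ∀ L n, |c L n| ≤ M) (hm : ∀ L n, m L ≤ n → c L n = 0)
    (hc : ∀ ε > 0, ∃ δ > 0, ∀ᶠ L in atTop, ∀ n : ℕ, |n / L - r| < δ → |c L n - ℓ| ≤ ε) :
    Tendsto (fun L => ∑ n ∈ Finset.range (m L), poissonWeight L n r * c L n) atTop (𝓝 ℓ) := by
  have hM0 : 0 ≤ M := (abs_nonneg _).trans (hM 0 0)
  rw [Metric.tendsto_nhds]
  intro ε hε
  obtain ⟨δ, hδ, hev⟩ := hc (ε / 2) (by positivity)
  -- Chebyshev: A(n/L - r)² dominates |c - ℓ| outside the δ-window, and its mean is A r/L → 0.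
  set A := (M + |ℓ|) / δ ^ 2 with hA
  have hlim : Tendsto (fun L : ℝ => A * (r / L)) atTop (𝓝 (A * 0)) :=
    (tendsto_const_nhds.div_atTop tendsto_id).const_mul A
  rw [mul_zero] at hlim
  filter_upwards [hev, hlim.eventually (gt_mem_nhds (show (0 : ℝ) < ε / 2 by positivity)),
    eventually_gt_atTop 0] with L hL1 hL2 hL0
  have hfin : HasSum (fun n => poissonWeight L n r * c L n)
      (∑ n ∈ Finset.range (m L), poissonWeight L n r * c L n) :=
    hasSum_sum_of_ne_finset_zero fun n hn => by
      rw [hm L n (by simpa using hn), mul_zero]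
  have hdiff := hfin.sub ((hasSum_poissonWeight L r).mul_right ℓ)
  have hbd := ((hasSum_poissonWeight L r).mul_right (ε / 2)).add
    ((hasSum_poissonWeight_mul_sq hL0 r).mul_left A)
  have hpt : ∀ n : ℕ, |c L n - ℓ| ≤ ε / 2 + A * (n / L - r) ^ 2 := by
    intro n
    have hA0 : 0 ≤ A := by positivity
    rcases lt_or_ge |n / L - r| δ with h | h
    · have := hL1 n h
      have : 0 ≤ A * (n / L - r) ^ 2 := by positivity
      linarith
    · have h1 : |c L n - ℓ| ≤ M + |ℓ| := (abs_sub _ _).trans (by linarith [hM L n])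
      have h2 : δ ^ 2 ≤ (n / L - r) ^ 2 := by
        rw [← sq_abs (n / L - r)]; exact pow_le_pow_left₀ hδ.le h 2
      have h3 : A * δ ^ 2 = M + |ℓ| := by rw [hA]; field_simp
      nlinarith
  have hw := fun n => poissonWeight_nonneg hL0.le hr n
  rw [Real.dist_eq, abs_lt]
  constructor
  · have := hasSum_le (fun n => ?_) hbd.neg hdiff
    · rw [one_mul, one_mul] at this; linarith
    · have := mul_le_mul_of_nonneg_left ((neg_le_of_abs_le (hpt n))) (hw n)
      linarith
  · have := hasSum_le (fun n => ?_) hdiff hbd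
    · rw [one_mul, one_mul] at this; linarith
    · have := mul_le_mul_of_nonneg_left ((le_abs_self _).trans (hpt n)) (hw n)
      linarith

theorem poissonWeight_le_exp {L t : ℝ} (hL : 1 ≤ L) (ht : 0 ≤ t) (n : ℕ) :
    poissonWeight L n t ≤ Real.exp ((n + 1 : ℕ) / L - t / 2) :=
  (Finset.single_le_sum (f := fun i => poissonWeight L i t)
    (fun i _ => poissonWeight_nonneg (by linarith) ht i) (Finset.self_mem_range_succ n)).trans
    (sum_range_poissonWeight_le hL ht (n + 1))

variable {q : ℝ → ℝ}

theorem aestronglyMeasurable_of_mul_exp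
    (hq : IntegrableOn (fun t => q t * Real.exp (-(t / 2))) (Ioi 0)) :
    AEStronglyMeasurable q (volume.restrict (Ioi 0)) := by
  have h := hq.aestronglyMeasurable.mul
    (show Continuous fun t : ℝ => Real.exp (t / 2) by fun_prop).aestronglyMeasurable
  refine h.congr (ae_of_all _ fun t => ?_)
  simp only [Pi.mul_apply]
  rw [mul_assoc, ← Real.exp_add, neg_add_cancel, Real.exp_zero, mul_one]

theorem integrableOn_mul_poissonWeight_of_mul_exp
    (hq : IntegrableOn (fun t => q t * Real.exp (-(t / 2))) (Ioi 0)) {L : ℝ} (hL : 1 ≤ L)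
    (n : ℕ) : IntegrableOn (fun t => q t * poissonWeight L n t) (Ioi 0) := by
  refine Integrable.mono' (hq.norm.const_mul (Real.exp ((n + 1 : ℕ) / L)))
    ((aestronglyMeasurable_of_mul_exp hq).mul
      (continuous_poissonWeight L n).aestronglyMeasurable) ?_
  filter_upwards [ae_restrict_mem measurableSet_Ioi] with t ht
  have ht' : 0 < t := ht
  rw [norm_mul, norm_mul, Real.norm_of_nonneg (Real.exp_nonneg _),
    Real.norm_of_nonneg (poissonWeight_nonneg (by linarith) ht'.le n)]
  have := poissonWeight_le_exp hL ht'.le n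
  rw [sub_eq_add_neg, Real.exp_add] at this
  calc ‖q t‖ * poissonWeight L n t ≤ ‖q t‖ * _ := mul_le_mul_of_nonneg_left this (norm_nonneg _)
    _ = _ := by ring

/-- After exchanging sum and integral the integrand converges by concentration. Only indices up to
(S + 1)L enter, so the Chernoff bound gives a majorant proportional to |q r| e^{-r/2}. -/
theorem tendsto_sum_mul_integral_poissonWeight
    (hq : IntegrableOn (fun t => q t * Real.exp (-(t / 2))) (Ioi 0)) {M S : ℝ} {ℓ : ℝ → ℝ}
    {c : ℝ → ℕ → ℝ} {m : ℝ → ℕ} (hM : ∀ L n, |c L n| ≤ M) (hm : ∀ L n, m L ≤ n → c L n = 0)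
    (hmS : ∀ᶠ L in atTop, (m L : ℝ) ≤ (S + 1) * L)
    (hc : ∀ᵐ r : ℝ ∂volume.restrict (Ioi 0), ∀ ε > 0, ∃ δ > 0, ∀ᶠ L in atTop, ∀ n : ℕ,
      |n / L - r| < δ → |c L n - ℓ r| ≤ ε) :
    Tendsto (fun L => ∑ n ∈ Finset.range (m L),
        c L n * ∫ r in Ioi (0 : ℝ), q r * poissonWeight L n r) atTop
      (𝓝 (∫ r in Ioi (0 : ℝ), q r * ℓ r)) := by
  have hM0 : 0 ≤ M := (abs_nonneg _).trans (hM 0 0)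
  have hmeas := aestronglyMeasurable_of_mul_exp hq
  have hlim : Tendsto (fun L => ∫ r in Ioi (0 : ℝ),
      q r * ∑ n ∈ Finset.range (m L), poissonWeight L n r * c L n) atTop
      (𝓝 (∫ r in Ioi (0 : ℝ), q r * ℓ r)) := by
    refine tendsto_integral_filter_of_dominated_convergence
      (fun r => M * Real.exp (S + 1) * ‖q r * Real.exp (-(r / 2))‖) ?_ ?_
      (hq.norm.const_mul _) ?_
    · refine Eventually.of_forall fun L => hmeas.mul ?_
      exact (show Continuous fun r => ∑ n ∈ Finset.range (m L), poissonWeight L n r * c L n from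
        continuous_finsetSum _ fun n _ => (continuous_poissonWeight L n).mul_const
          _).aestronglyMeasurable
    · filter_upwards [hmS, eventually_ge_atTop 1] with L hL1 hL2
      have hL0 : 0 < L := by linarith
      filter_upwards [ae_restrict_mem measurableSet_Ioi] with r hr
      have hr' : 0 < r := hr
      have h1 : |∑ n ∈ Finset.range (m L), poissonWeight L n r * c L n|
          ≤ M * Real.exp (S + 1) * Real.exp (-(r / 2)) := by
        refine (Finset.abs_sum_le_sum_abs _ _).trans ?_
        have h2 : ∀ n ∈ Finset.range (m L), |poissonWeight L n r * c L n|
            ≤ M * poissonWeight L n r := fun n _ => by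
          have hw := poissonWeight_nonneg hL0.le hr'.le n
          rw [abs_mul, abs_of_nonneg hw, mul_comm]
          exact mul_le_mul_of_nonneg_right (hM L n) hw
        refine (Finset.sum_le_sum h2).trans ?_
        rw [← Finset.mul_sum, mul_assoc, ← Real.exp_add]
        refine mul_le_mul_of_nonneg_left
          ((sum_range_poissonWeight_le hL2 hr'.le _).trans (Real.exp_le_exp.mpr ?_)) hM0
        have : (m L : ℝ) / L ≤ S + 1 := by rwa [div_le_iff₀ hL0]
        linarith
      rw [norm_mul, norm_mul, Real.norm_of_nonneg (Real.exp_nonneg _), Real.norm_eq_abs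
        (∑ n ∈ _, _)]
      calc ‖q r‖ * |∑ n ∈ Finset.range (m L), poissonWeight L n r * c L n|
          ≤ ‖q r‖ * (M * Real.exp (S + 1) * Real.exp (-(r / 2))) :=
            mul_le_mul_of_nonneg_left h1 (norm_nonneg _)
        _ = _ := by ring
    · filter_upwards [hc, ae_restrict_mem measurableSet_Ioi] with r hr hr0
      exact (tendsto_sum_poissonWeight_mul (le_of_lt hr0) hM hm hr).const_mul _
  refine hlim.congr' ?_
  filter_upwards [eventually_ge_atTop 1] with L hL
  simp only [Finset.mul_sum]
  rw [integral_finsetSum _ fun n _ => ?_]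
  · refine Finset.sum_congr rfl fun n _ => ?_
    rw [← integral_const_mul]
    exact integral_congr_ae (ae_of_all _ fun r => by ring)
  · have := (integrableOn_mul_poissonWeight_of_mul_exp hq hL n).mul_const (c L n)
    simpa only [mul_assoc] using this

/-- Partial sums of Poisson moments converge to the primitive. -/
theorem tendsto_sum_integral_poissonWeight
    (hq : IntegrableOn (fun t => q t * Real.exp (-(t / 2))) (Ioi 0)) {S : ℝ} (hS : 0 ≤ S) :
    Tendsto (fun L : ℝ => ∑ n ∈ Finset.range ⌊S * L⌋₊,
        ∫ r in Ioi (0 : ℝ), q r * poissonWeight L n r) atTop (𝓝 (∫ r in Ioc 0 S, q r)) := by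
  have h := tendsto_sum_mul_integral_poissonWeight (M := 1) (S := S) hq
    (ℓ := (Iic S).indicator 1) (c := fun L n => if n < ⌊S * L⌋₊ then 1 else 0)
    (m := fun L => ⌊S * L⌋₊) (fun L n => by split_ifs <;> simp)
    (fun L n h => if_neg (by omega)) ?_ ?_
  · have e : ∫ r in Ioi (0 : ℝ), q r * (Iic S).indicator 1 r = ∫ r in Ioc 0 S, q r := by
      rw [← Ioi_inter_Iic, ← setIntegral_indicator measurableSet_Iic]
      refine integral_congr_ae (ae_of_all _ fun r => ?_)
      by_cases hr : r ∈ Iic S <;> simp [hr, Set.indicator_of_mem, Set.indicator_of_notMem]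
    rw [e] at h
    refine h.congr fun L => Finset.sum_congr rfl fun n hn => ?_
    rw [if_pos (Finset.mem_range.mp hn), one_mul]
  · filter_upwards [eventually_ge_atTop 0] with L hL
    have := Nat.floor_le (mul_nonneg hS hL)
    linarith
  · have hne : ∀ᵐ r : ℝ ∂volume.restrict (Ioi 0), r ≠ S :=
      ae_restrict_of_ae (Measure.ae_ne volume S)
    filter_upwards [hne] with r hr ε hε
    rcases lt_or_gt_of_ne hr with h | h
    · refine ⟨(S - r) / 2, by linarith, ?_⟩
      filter_upwards [eventually_gt_atTop 0, eventually_ge_atTop (2 / (S - r))] with L hL0 hL1 n hn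
      have hn1 : (n : ℝ) < (r + (S - r) / 2) * L := by
        rw [← div_lt_iff₀ hL0]
        linarith [(abs_lt.mp hn).2]
      have h2 : 1 ≤ (S - r) / 2 * L := by
        rw [div_le_iff₀ (by linarith)] at hL1
        linarith
      have : n < ⌊S * L⌋₊ := by
        rw [← Nat.succ_le_iff, Nat.le_floor_iff (by positivity)]
        push_cast
        nlinarith
      rw [if_pos this, Set.indicator_of_mem (show r ∈ Iic S from h.le)]
      simpa using hε.le
    · refine ⟨r - S, by linarith, ?_⟩
      filter_upwards [eventually_gt_atTop 0] with L hL0 n hn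
      have hn1 : S * L < n := by
        rw [← lt_div_iff₀ hL0]
        linarith [(abs_lt.mp hn).1]
      have : ¬ n < ⌊S * L⌋₊ := fun hlt => by
        have h3 := Nat.floor_le (mul_nonneg hS hL0.le)
        have h4 : (n : ℝ) < ⌊S * L⌋₊ := by exact_mod_cast hlt
        linarith
      rw [if_neg this, Set.indicator_of_notMem (show r ∉ Iic S from not_le.mpr h)]
      simpa using hε.le

theorem IsKernel.integrableOn_mul_exp_half {k : ℝ → ℝ} (hk : IsKernel k) :
    IntegrableOn (fun t => k t * Real.exp (-(t / 2))) (Ioi 0) := by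
  have := hk.integrableOn_mul_exp (c := 1 / 2) (by norm_num)
  refine this.congr_fun (fun t _ => ?_) measurableSet_Ioi
  simp only
  congr 3; ring

/-- The Chernoff bound integrated against k. With m of order L the right side does not depend on the
discretisation. -/
theorem IsKernel.sum_poissonMoment_le {k : ℝ → ℝ} (hk : IsKernel k) {L : ℝ} (hL : 1 ≤ L) (m : ℕ) :
    ∑ i ∈ Finset.range m, poissonMoment k L i
      ≤ Real.exp (m / L) * ∫ t in Ioi (0 : ℝ), k t * Real.exp (-(t / 2)) := by
  have hL0 : 0 < L := by linarith
  unfold poissonMoment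
  rw [← integral_finsetSum _ fun i _ => hk.integrableOn_mul_poissonWeight hL0 i,
    ← integral_const_mul]
  refine setIntegral_mono_on (integrable_finsetSum _ fun i _ =>
    hk.integrableOn_mul_poissonWeight hL0 i) (hk.integrableOn_mul_exp_half.const_mul _)
    measurableSet_Ioi fun t ht => ?_
  have ht' : 0 < t := ht
  rw [← Finset.mul_sum]
  have := mul_le_mul_of_nonneg_left (sum_range_poissonWeight_le hL ht'.le m) (hk.nonneg t ht')
  rw [sub_eq_add_neg, Real.exp_add] at this
  linarith

/-- Discrete convolutions with the Poisson moments of `k` converge to the convolution with `k`. -/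
theorem IsKernel.tendsto_sum_poissonMoment_mul {k : ℝ → ℝ} (hk : IsKernel k) {w : ℝ → ℝ}
    (hw : Continuous w) (hw0 : ∀ t ≤ 0, w t = 0) {M : ℝ} (hM : ∀ t, |w t| ≤ M) {S : ℝ}
    (hS : 0 ≤ S) :
    Tendsto (fun L : ℝ => ∑ n ∈ Finset.range (⌊S * L⌋₊ + 1),
      w (S - n / L) * poissonMoment k L n) atTop (𝓝 (conv k w S)) := by
  have h := tendsto_sum_mul_integral_poissonWeight (M := M) (S := S) hk.integrableOn_mul_exp_half
    (ℓ := fun r => w (S - r))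
    (c := fun L n => if n < ⌊S * L⌋₊ + 1 then w (S - n / L) else 0)
    (m := fun L => ⌊S * L⌋₊ + 1)
    (fun L n => by
      split_ifs
      · exact hM _
      · simpa using (abs_nonneg _).trans (hM 0))
    (fun L n h => if_neg (by omega)) ?_ ?_
  · have e : ∫ r in Ioi (0 : ℝ), k r * w (S - r) = conv k w S := by
      have h1 := intervalIntegral.integral_comp_sub_left (a := 0) (b := S)
        (fun r => k r * w (S - r)) S
      simp only [sub_sub_cancel, sub_self, sub_zero] at h1
      unfold conv
      simp only [smul_eq_mul]
      rw [h1, intervalIntegral.integral_of_le hS, ← Ioi_inter_Iic,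
        ← setIntegral_indicator measurableSet_Iic]
      refine integral_congr_ae (ae_of_all _ fun r => ?_)
      by_cases hr : r ∈ Iic S
      · simp only [Set.indicator_of_mem hr]
      · simp only [Set.indicator_of_notMem hr]
        have : S < r := not_le.mp hr
        rw [hw0 (S - r) (by linarith), mul_zero]
    rw [e] at h
    refine h.congr fun L => Finset.sum_congr rfl fun n hn => ?_
    rw [if_pos (Finset.mem_range.mp hn)]
    rfl
  · filter_upwards [eventually_ge_atTop 1] with L hL
    have := Nat.floor_le (mul_nonneg hS (zero_le_one.trans hL))
    push_cast
    linarith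
  · refine ae_of_all _ fun r ε hε => ?_
    obtain ⟨δ, hδ, hd⟩ := Metric.continuous_iff.mp hw (S - r) ε hε
    refine ⟨δ, hδ, ?_⟩
    filter_upwards [eventually_gt_atTop 0] with L hL0 n hn
    have h1 : |w (S - n / L) - w (S - r)| ≤ ε := by
      have := hd (S - n / L) (by
        rw [Real.dist_eq, show S - n / L - (S - r) = -(n / L - r) by ring, abs_neg]; exact hn)
      rw [Real.dist_eq] at this
      exact this.le
    split_ifs with hlt
    · exact h1
    -- Beyond the truncation S - n/L ≤ 0, where w vanishes, so the cut-off creates no jump.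
    · rwa [hw0 (S - n / L) ?_] at h1
      rw [sub_nonpos, le_div_iff₀ hL0]
      have h2 := Nat.lt_floor_add_one (S * L)
      have h3 : ((⌊S * L⌋₊ + 1 : ℕ) : ℝ) ≤ n := by exact_mod_cast not_lt.mp hlt
      push_cast at h3
      linarith

end LawOfLargeNumbers

/-! ### Weak limits along an ultrafilter. -/

section WeakCompactness

/-- Banach–Alaoglu through the Riesz isomorphism. With an ultrafilter neither separability nor
subsequences are needed. -/
theorem exists_weak_limit_of_bounded {E : Type*} [NormedAddCommGroup E] [InnerProductSpace ℝ E]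
    [CompleteSpace E] {ι : Type*} (U : Ultrafilter ι) {x : ι → E} {C : ℝ} (hC : ∀ i, ‖x i‖ ≤ C) :
    ∃ z : E, ∀ y : E, Tendsto (fun i => inner ℝ (x i) y) U (𝓝 (inner ℝ z y)) := by
  set Λ : ι → WeakDual ℝ E := fun i =>
    StrongDual.toWeakDual (InnerProductSpace.toDual ℝ E (x i)) with hΛ
  have hmem : ∀ i, Λ i ∈ WeakDual.toStrongDual ⁻¹' Metric.closedBall (0 : StrongDual ℝ E) C := by
    intro i
    simp only [hΛ, mem_preimage, mem_closedBall_zero_iff]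
    exact ((InnerProductSpace.toDual ℝ E).norm_map (x i)).le.trans (hC i)
  obtain ⟨z, -, hz⟩ := (WeakDual.isCompact_closedBall (𝕜 := ℝ) (0 : StrongDual ℝ E)
    C).ultrafilter_le_nhds
    (U.map Λ) (by
      rw [le_principal_iff]
      exact Filter.mem_map.mpr (Filter.univ_mem' hmem))
  have hz' : Tendsto Λ U (𝓝 z) := hz
  refine ⟨(InnerProductSpace.toDual ℝ E).symm (WeakDual.toStrongDual z), fun y => ?_⟩
  rw [InnerProductSpace.toDual_symm_apply]
  exact ((WeakDual.eval_continuous y).tendsto z).comp hz'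

variable {H : Type u} [NormedAddCommGroup H] [InnerProductSpace ℝ H]

theorem memLp_two_of_lintegral_sq {E : Type*} [NormedAddCommGroup E] {μ : Measure ℝ} {x : ℝ → E}
    (hx : AEStronglyMeasurable x μ) {C : ℝ≥0∞} (hC : ∫⁻ t, ‖x t‖ₑ ^ 2 ∂μ ≤ C) (hCt : C < ⊤) :
    MemLp x 2 μ := by
  refine ⟨hx, ?_⟩
  rw [eLpNorm_lt_top_iff_lintegral_rpow_enorm_lt_top (by norm_num) (by norm_num)]
  simpa using lt_of_le_of_lt hC hCt

theorem norm_toLp_sq_le {E : Type*} [NormedAddCommGroup E] {μ : Measure ℝ} {x : ℝ → E} {C : ℝ}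
    (hx : MemLp x 2 μ) (hC0 : 0 ≤ C) (hC : ∫⁻ t, ‖x t‖ₑ ^ 2 ∂μ ≤ ENNReal.ofReal C) :
    ‖hx.toLp x‖ ≤ √C := by
  rw [Lp.norm_toLp, eLpNorm_eq_lintegral_rpow_enorm_toReal (by norm_num) (by norm_num)]
  refine ENNReal.toReal_le_of_le_ofReal (Real.sqrt_nonneg _) ?_
  have h1 : ∫⁻ t, ‖x t‖ₑ ^ (2 : ℝ≥0∞).toReal ∂μ = ∫⁻ t, ‖x t‖ₑ ^ 2 ∂μ := by simp
  rw [h1, Real.sqrt_eq_rpow, ← ENNReal.ofReal_rpow_of_nonneg hC0 (by norm_num)]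
  simpa using ENNReal.rpow_le_rpow hC (show (0 : ℝ) ≤ 1 / 2 by norm_num)

/-- Weak compactness in a weighted `L²` space over the half-line. -/
theorem exists_weak_limit_weighted [CompleteSpace H] (U : Ultrafilter ℕ) {x : ℕ → ℝ → H}
    (hm : ∀ N, StronglyMeasurable (x N)) {C : ℝ} (hC0 : 0 ≤ C)
    (hC : ∀ N, ∫⁻ t in Ioi (0 : ℝ), ‖Real.exp (-t) • x N t‖ₑ ^ 2 ≤ ENNReal.ofReal C) :
    ∃ z : ℝ → H, StronglyMeasurable z ∧ (∀ t ≤ 0, z t = 0) ∧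
      (∀ S, MemLp z 2 (volume.restrict (Iic S))) ∧
      ∀ y : ℝ → H, ∀ S, MemLp y 2 (volume.restrict (Ioc 0 S)) →
        Tendsto (fun N => ∫ t in Ioc 0 S, inner ℝ (x N t) (y t)) U
          (𝓝 (∫ t in Ioc 0 S, inner ℝ (z t) (y t))) := by
  have hexp : Continuous fun t : ℝ => Real.exp (-t) := by fun_prop
  have hX : ∀ N, MemLp (fun t => Real.exp (-t) • x N t) 2 (volume.restrict (Ioi 0)) := fun N =>
    memLp_two_of_lintegral_sq (hexp.stronglyMeasurable.smul (hm N)).aestronglyMeasurable (hC N)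
      ENNReal.ofReal_lt_top
  obtain ⟨ζ, hζ⟩ := exists_weak_limit_of_bounded U (x := fun N => (hX N).toLp _)
    fun N => norm_toLp_sq_le (hX N) hC0 (hC N)
  set ζ' : ℝ → H := fun t => ζ t with hζ'
  have hζm : StronglyMeasurable ζ' := Lp.stronglyMeasurable ζ
  -- The weight e^{-t} is removed from the limit here and moved to the test function as e^t below,
  -- which is bounded on (0, S].
  set z : ℝ → H := (Ioi (0 : ℝ)).indicator fun t => Real.exp t • ζ' t with hz
  have hzm : StronglyMeasurable z :=
    (Real.continuous_exp.stronglyMeasurable.smul hζm).indicator measurableSet_Ioi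
  refine ⟨z, hzm, fun t ht => Set.indicator_of_notMem (by simpa using ht) _, fun S => ?_,
    fun y S hy => ?_⟩
  · have h1 : MemLp ((Ioi (0 : ℝ)).indicator ζ') 2 volume :=
      (memLp_indicator_iff_restrict measurableSet_Ioi).mpr (Lp.memLp ζ)
    have h2 := (h1.restrict (Iic S)).norm.const_mul (Real.exp S)
    refine h2.mono hzm.aestronglyMeasurable ?_
    filter_upwards [ae_restrict_mem measurableSet_Iic] with t ht
    by_cases h : t ∈ Ioi (0 : ℝ)
    · rw [hz, Set.indicator_of_mem h, Set.indicator_of_mem h, norm_smul, norm_mul, norm_norm,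
        Real.norm_of_nonneg (Real.exp_nonneg _), Real.norm_of_nonneg (Real.exp_nonneg _)]
      exact mul_le_mul_of_nonneg_right (Real.exp_le_exp.mpr ht) (norm_nonneg _)
    · rw [hz, Set.indicator_of_notMem h, norm_zero]; positivity
  · set Y : ℝ → H := (Ioc 0 S).indicator fun t => Real.exp t • y t with hY
    have hYm : MemLp Y 2 (volume.restrict (Ioi 0)) := by
      refine MemLp.restrict _ ((memLp_indicator_iff_restrict measurableSet_Ioc).mpr ?_)
      refine (hy.norm.const_mul (Real.exp S)).mono
        (Real.continuous_exp.aestronglyMeasurable.smul hy.aestronglyMeasurable) ?_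
      filter_upwards [ae_restrict_mem measurableSet_Ioc] with t ht
      rw [norm_smul, norm_mul, norm_norm,
        Real.norm_of_nonneg (Real.exp_nonneg _), Real.norm_of_nonneg (Real.exp_nonneg _)]
      exact mul_le_mul_of_nonneg_right (Real.exp_le_exp.mpr ht.2) (norm_nonneg _)
    have key := hζ (hYm.toLp _)
    have hsub : Ioc 0 S ⊆ Ioi 0 := Ioc_subset_Ioi_self
    have hcomp : ∀ (w : ℝ → H) (W : ℝ → H), (∀ t ∈ Ioc 0 S, inner ℝ (W t) (Real.exp t • y t)
        = inner ℝ (w t) (y t)) →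
        ∫ t in Ioi (0 : ℝ), inner ℝ (W t) (Y t) = ∫ t in Ioc 0 S, inner ℝ (w t) (y t) := by
      intro w W h
      rw [setIntegral_eq_of_subset_of_forall_sdiff_eq_zero (s := Ioc 0 S) measurableSet_Ioi hsub]
      · refine setIntegral_congr_fun measurableSet_Ioc fun t ht => ?_
        simp only [hY, Set.indicator_of_mem ht]
        exact h t ht
      · intro t ht
        simp only [hY, Set.indicator_of_notMem ht.2, inner_zero_right]
    have e1 : ∀ N, inner ℝ ((hX N).toLp _) (hYm.toLp _) = ∫ t in Ioc 0 S, inner ℝ (x N t) (y t) :=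
      by
      intro N
      rw [L2.inner_def, ← hcomp (x N) fun t => Real.exp (-t) • x N t]
      · refine integral_congr_ae ?_
        filter_upwards [(hX N).coeFn_toLp, hYm.coeFn_toLp] with t h1 h2
        rw [h1, h2]
      · intro t _
        rw [real_inner_smul_left, real_inner_smul_right, ← mul_assoc, ← Real.exp_add,
          neg_add_cancel, Real.exp_zero, one_mul]
    have e2 : inner ℝ ζ (hYm.toLp _) = ∫ t in Ioc 0 S, inner ℝ (z t) (y t) := by
      rw [L2.inner_def, ← hcomp z ζ']
      · refine integral_congr_ae ?_
        filter_upwards [hYm.coeFn_toLp] with t h2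
        rw [h2]
      · intro t ht
        rw [hz, Set.indicator_of_mem (hsub ht), real_inner_smul_left, real_inner_smul_right]
    simp only [e1, e2] at key
    exact key

end WeakCompactness

/-! ### Integrals of step functions with mesh 1/L. -/

section StepFunctions

/-- The last, possibly incomplete cell is counted in full, hence the range up to ⌊L * S⌋₊ + 1. -/
theorem lintegral_step_le {h : ℕ → ℝ≥0∞} {L : ℝ} (hL : 0 < L) (S : ℝ) :
    ∫⁻ t in Ioc 0 S, h ⌊L * t⌋₊
      ≤ ENNReal.ofReal L⁻¹ * ∑ n ∈ Finset.range (⌊L * S⌋₊ + 1), h n := by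
  have hpt : ∀ t ∈ Ioc 0 S, h ⌊L * t⌋₊ ≤ ∑ n ∈ Finset.range (⌊L * S⌋₊ + 1),
      (Ico ((n : ℝ) / L) ((n + 1) / L)).indicator (fun _ => h n) t := by
    intro t ht
    have hmem : ⌊L * t⌋₊ ∈ Finset.range (⌊L * S⌋₊ + 1) := by
      rw [Finset.mem_range, Nat.lt_succ_iff]
      exact Nat.floor_le_floor (mul_le_mul_of_nonneg_left ht.2 hL.le)
    refine le_trans (le_of_eq ?_) (Finset.single_le_sum (fun n _ => zero_le) hmem)
    rw [Set.indicator_of_mem]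
    refine ⟨?_, ?_⟩
    · rw [div_le_iff₀ hL, mul_comm t L]; exact Nat.floor_le (mul_nonneg hL.le ht.1.le)
    · rw [lt_div_iff₀ hL, mul_comm t L]; exact Nat.lt_floor_add_one _
  calc ∫⁻ t in Ioc 0 S, h ⌊L * t⌋₊
      ≤ ∫⁻ t in Ioc 0 S, ∑ n ∈ Finset.range (⌊L * S⌋₊ + 1),
        (Ico ((n : ℝ) / L) ((n + 1) / L)).indicator (fun _ => h n) t :=
        setLIntegral_mono' measurableSet_Ioc hpt
    _ ≤ ∫⁻ t, ∑ n ∈ Finset.range (⌊L * S⌋₊ + 1),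
        (Ico ((n : ℝ) / L) ((n + 1) / L)).indicator (fun _ => h n) t :=
        setLIntegral_le_lintegral _ _
    _ = ∑ n ∈ Finset.range (⌊L * S⌋₊ + 1), h n * ENNReal.ofReal L⁻¹ := by
        rw [lintegral_finsetSum _ fun n _ => measurable_const.indicator measurableSet_Ico]
        refine Finset.sum_congr rfl fun n _ => ?_
        rw [lintegral_indicator_const measurableSet_Ico, Real.volume_Ico]
        congr 2; field_simp; ring
    _ = _ := by rw [← Finset.sum_mul, mul_comm]

theorem measurable_floor_mul (L : ℝ) : Measurable fun t : ℝ => ⌊L * t⌋₊ :=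
  Nat.measurable_floor.comp (measurable_const_mul L)

theorem stronglyMeasurable_step {E : Type*} [TopologicalSpace E] (x : ℕ → E) (L : ℝ) :
    StronglyMeasurable fun t : ℝ => x ⌊L * t⌋₊ :=
  StronglyMeasurable.comp_measurable (StronglyMeasurable.of_discrete (f := x))
    (measurable_floor_mul L)

theorem integral_step {E : Type*} [NormedAddCommGroup E] [NormedSpace ℝ E] [CompleteSpace E]
    (x : ℕ → E) {L : ℝ} (hL : 0 < L) {S : ℝ} (hS : 0 ≤ S) :
    ∫ t in Ioc 0 S, x ⌊L * t⌋₊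
      = L⁻¹ • ∑ n ∈ Finset.range ⌊L * S⌋₊, x n + (S - ⌊L * S⌋₊ / L) • x ⌊L * S⌋₊ := by
  have hcell : ∀ (n : ℕ) (a b : ℝ), (n : ℝ) / L ≤ a → a ≤ b → b ≤ (n + 1) / L →
      IntervalIntegrable (fun t => x ⌊L * t⌋₊) volume a b ∧
        ∫ t in a..b, x ⌊L * t⌋₊ = (b - a) • x n := by
    intro n a b ha hab hb
    have hae : ∀ᵐ t ∂volume.restrict (Ioc a b), x n = x ⌊L * t⌋₊ := by
      rw [← restrict_Ioo_eq_restrict_Ioc]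
      filter_upwards [ae_restrict_mem measurableSet_Ioo] with t ht
      congr 1
      symm
      rw [div_le_iff₀ hL] at ha
      rw [le_div_iff₀ hL] at hb
      have h1 := mul_lt_mul_of_pos_right ht.1 hL
      have h2 := mul_lt_mul_of_pos_right ht.2 hL
      rw [Nat.floor_eq_iff (by nlinarith [n.cast_nonneg (α := ℝ)])]
      constructor <;> linarith
    constructor
    · rw [intervalIntegrable_iff_integrableOn_Ioc_of_le hab]
      exact (integrable_const (x n)).congr hae
    · rw [intervalIntegral.integral_of_le hab, ← integral_congr_ae hae, setIntegral_const]
      simp [Measure.real, Real.volume_Ioc, hab]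
  rw [← intervalIntegral.integral_of_le hS]
  have hfl : (⌊L * S⌋₊ : ℝ) / L ≤ S := by
    rw [div_le_iff₀ hL, mul_comm S L]; exact Nat.floor_le (mul_nonneg hL.le hS)
  have hfl' : S ≤ (⌊L * S⌋₊ + 1) / L := by
    rw [le_div_iff₀ hL, mul_comm S L]; exact (Nat.lt_floor_add_one _).le
  have hc : ∀ n : ℕ, IntervalIntegrable (fun t => x ⌊L * t⌋₊) volume ((n : ℝ) / L) ((n + 1 : ℕ) / L)
    ∧
        ∫ t in ((n : ℝ) / L)..((n + 1 : ℕ) / L), x ⌊L * t⌋₊ = L⁻¹ • x n := by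
    intro n
    have := hcell n (n / L) ((n + 1) / L) le_rfl (by gcongr; linarith) le_rfl
    push_cast
    refine ⟨this.1, this.2.trans ?_⟩
    congr 1; field_simp; ring
  have hlast := hcell ⌊L * S⌋₊ _ S le_rfl hfl hfl'
  have hsum := intervalIntegral.sum_integral_adjacent_intervals (f := fun t => x ⌊L * t⌋₊)
    (μ := volume) (a := fun n : ℕ => (n : ℝ) / L) (n := ⌊L * S⌋₊) fun n _ => (hc n).1
  have hint := IntervalIntegrable.trans_iterate (f := fun t => x ⌊L * t⌋₊)
    (μ := volume) (a := fun n : ℕ => (n : ℝ) / L) (n := ⌊L * S⌋₊) fun n _ => (hc n).1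
  simp only [Nat.cast_zero, zero_div, (hc _).2] at hsum hint
  rw [← intervalIntegral.integral_add_adjacent_intervals hint hlast.1, ← hsum, hlast.2,
    Finset.smul_sum]

/-- Cut the half-line into unit intervals: the weight is at most e^{-2i} on the i-th one, against
growth e^i, which leaves a geometric series. -/
theorem lintegral_exp_mul_le {h : ℝ → ℝ≥0∞} (hm : Measurable h) {C : ℝ≥0∞}
    (hC : ∀ i : ℕ, ∫⁻ t in Ioc (0 : ℝ) (i + 1), h t ≤ C * ENNReal.ofReal (Real.exp i)) :
    ∫⁻ t in Ioi (0 : ℝ), ENNReal.ofReal (Real.exp (-(2 * t))) * h t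
      ≤ C * ENNReal.ofReal (∑' i : ℕ, Real.exp (-1) ^ i) := by
  have hU : Ioi (0 : ℝ) = ⋃ i : ℕ, Ioc (i : ℝ) (i + 1) := by
    ext t
    simp only [mem_Ioi, mem_iUnion, mem_Ioc]
    constructor
    · intro ht
      have hc : 0 < ⌈t⌉₊ := Nat.ceil_pos.mpr ht
      refine ⟨⌈t⌉₊ - 1, ?_, ?_⟩
      · have : ⌈t⌉₊ - 1 < ⌈t⌉₊ := by omega
        exact Nat.lt_ceil.mp this
      · have : ((⌈t⌉₊ - 1 : ℕ) : ℝ) + 1 = ⌈t⌉₊ := by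
          rw [Nat.cast_sub (by omega)]; simp
        rw [this]; exact Nat.le_ceil t
    · rintro ⟨i, hi, -⟩
      exact lt_of_le_of_lt i.cast_nonneg hi
  have hs : Summable fun i : ℕ => Real.exp (-1) ^ i :=
    summable_geometric_of_lt_one (Real.exp_nonneg _) (by rw [Real.exp_lt_one_iff]; norm_num)
  rw [hU, ENNReal.ofReal_tsum_of_nonneg (fun i => by positivity) hs, ← ENNReal.tsum_mul_left]
  refine (lintegral_iUnion_le _ _).trans (ENNReal.tsum_le_tsum fun i => ?_)
  calc ∫⁻ t in Ioc (i : ℝ) (i + 1), ENNReal.ofReal (Real.exp (-(2 * t))) * h t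
      ≤ ∫⁻ t in Ioc (i : ℝ) (i + 1), ENNReal.ofReal (Real.exp (-(2 * i))) * h t := by
        refine setLIntegral_mono' measurableSet_Ioc fun t ht => ?_
        gcongr
        exact ht.1.le
    _ = ENNReal.ofReal (Real.exp (-(2 * i))) * ∫⁻ t in Ioc (i : ℝ) (i + 1), h t :=
        lintegral_const_mul _ hm
    _ ≤ ENNReal.ofReal (Real.exp (-(2 * i))) * (C * ENNReal.ofReal (Real.exp i)) := by
        gcongr
        refine (lintegral_mono_set (Ioc_subset_Ioc_left i.cast_nonneg)).trans (hC i)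
    _ = C * ENNReal.ofReal (Real.exp (-1) ^ i) := by
        rw [mul_left_comm, ← ENNReal.ofReal_mul (Real.exp_nonneg _), ← Real.exp_add,
          ← Real.exp_nat_mul]
        congr 3; ring

end StepFunctions

/-! ### A modulus of continuity for discrete convolutions. -/

section ModulusOfContinuity

theorem norm_sum_smul_le {ι : Type*} {H : Type*} [NormedAddCommGroup H] [NormedSpace ℝ H]
    (s : Finset ι) {w : ι → ℝ} (hw : ∀ i ∈ s, 0 ≤ w i) (g : ι → H) {A G : ℝ}
    (hA : ∑ i ∈ s, w i ≤ A) (hG : ∑ i ∈ s, w i * ‖g i‖ ^ 2 ≤ G) :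
    ‖∑ i ∈ s, w i • g i‖ ≤ √(A * G) := by
  have h0 : 0 ≤ ∑ i ∈ s, w i := Finset.sum_nonneg hw
  have h1 : ‖∑ i ∈ s, w i • g i‖ ≤ ∑ i ∈ s, √(w i) * (√(w i) * ‖g i‖) := by
    refine (norm_sum_le _ _).trans (Finset.sum_le_sum fun i hi => ?_)
    rw [norm_smul, Real.norm_of_nonneg (hw i hi), ← mul_assoc, Real.mul_self_sqrt (hw i hi)]
  refine h1.trans (Real.le_sqrt_of_sq_le ?_)
  refine (Finset.sum_mul_sq_le_sq_mul_sq s _ _).trans ?_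
  have e1 : ∑ i ∈ s, √(w i) ^ 2 = ∑ i ∈ s, w i :=
    Finset.sum_congr rfl fun i hi => Real.sq_sqrt (hw i hi)
  have e2 : ∑ i ∈ s, (√(w i) * ‖g i‖) ^ 2 = ∑ i ∈ s, w i * ‖g i‖ ^ 2 :=
    Finset.sum_congr rfl fun i hi => by rw [mul_pow, Real.sq_sqrt (hw i hi)]
  rw [e1, e2]
  exact mul_le_mul hA hG (Finset.sum_nonneg fun i hi => mul_nonneg (hw i hi) (sq_nonneg _))
    (h0.trans hA)

/-- Modulus of continuity of a discrete convolution with a nonincreasing kernel. -/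
theorem norm_conv_sub_le {H : Type*} [NormedAddCommGroup H] [NormedSpace ℝ H] {a : ℕ → ℝ}
    (ha : ∀ n, 0 ≤ a n) (ha' : Antitone a) {g : ℕ → H} {G : ℝ}
    (hG : ∀ n, ∑ j ∈ Finset.range n, a (n - 1 - j) * ‖g j‖ ^ 2 ≤ G) (n m : ℕ) :
    ‖∑ j ∈ Finset.range (n + m), a (n + m - 1 - j) • g j
        - ∑ j ∈ Finset.range n, a (n - 1 - j) • g j‖
      ≤ 2 * √((∑ i ∈ Finset.range m, a i) * G) := by
  -- The increment consists of m new terms and of the loss of weight on the n old ones. As a is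
  -- nonincreasing both weights are nonnegative, each has total mass at most ∑_{i<m} a i, and both
  -- are dominated by weights covered by `hG`.
  have hsplit : ∑ j ∈ Finset.range (n + m), a (n + m - 1 - j) • g j
        - ∑ j ∈ Finset.range n, a (n - 1 - j) • g j
      = ∑ j ∈ Finset.range m, a (m - 1 - j) • g (n + j)
        - ∑ j ∈ Finset.range n, (a (n - 1 - j) - a (n + m - 1 - j)) • g j := by
    rw [Finset.sum_range_add]
    simp only [sub_smul, Finset.sum_sub_distrib]
    have : ∀ j, n + m - 1 - (n + j) = m - 1 - j := fun j => by omega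
    simp only [this]
    abel
  rw [hsplit]
  refine (norm_sub_le _ _).trans ?_
  rw [two_mul]
  refine add_le_add (norm_sum_smul_le _ (fun j _ => ha _) _ ?_ ?_)
    (norm_sum_smul_le _ (fun j hj => ?_) _ ?_ ?_)
  · rw [Finset.sum_range_reflect]
  · refine le_trans ?_ (hG (n + m))
    rw [Finset.sum_range_add]
    have : ∀ j, n + m - 1 - (n + j) = m - 1 - j := fun j => by omega
    simp only [this]
    exact le_add_of_nonneg_left (Finset.sum_nonneg fun j _ => mul_nonneg (ha _) (sq_nonneg _))
  · exact sub_nonneg.mpr (ha' (by omega))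
  · rw [Finset.sum_sub_distrib, Finset.sum_range_reflect a n]
    have e : ∑ j ∈ Finset.range n, a (n + m - 1 - j) = ∑ i ∈ Finset.range n, a (m + i) := by
      rw [← Finset.sum_range_reflect (fun i => a (m + i)) n]
      refine Finset.sum_congr rfl fun j hj => ?_
      rw [Finset.mem_range] at hj
      congr 1; omega
    rw [e, sub_le_iff_le_add, ← Finset.sum_range_add]
    exact Finset.sum_le_sum_of_subset_of_nonneg (Finset.range_mono (by omega)) fun i _ _ => ha i
  · refine (Finset.sum_le_sum fun j _ => ?_).trans (hG n)
    exact mul_le_mul_of_nonneg_right (sub_le_self _ (ha _)) (sq_nonneg _)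

end ModulusOfContinuity

/-! ### Limits of asymptotically equicontinuous families. -/

section Equicontinuity

variable {E : Type*} [NormedAddCommGroup E] {U : Filter ℕ} {x : ℕ → ℝ → E} {u : ℝ → E}

theorem norm_sub_le_of_tendsto [NeBot U] (hpt : ∀ t, Tendsto (fun N => x N t) U (𝓝 (u t)))
    {s t ε : ℝ} (h : ∀ᶠ N in U, ‖x N s - x N t‖ ≤ ε) : ‖u s - u t‖ ≤ ε :=
  le_of_tendsto ((hpt s).sub (hpt t)).norm h

/-- The approximants are discontinuous step functions. Their oscillation below δ is small only
eventually along U, and this suffices for the limit. -/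
theorem continuous_of_asymptotically_equicontinuous [NeBot U]
    (hpt : ∀ t, Tendsto (fun N => x N t) U (𝓝 (u t)))
    (heq : ∀ ε > 0, ∃ δ > 0, ∀ᶠ N in U, ∀ s t : ℝ, |s - t| < δ → ‖x N s - x N t‖ ≤ ε) :
    Continuous u := by
  rw [Metric.continuous_iff]
  intro t ε hε
  obtain ⟨δ, hδ, h⟩ := heq (ε / 2) (by positivity)
  refine ⟨δ, hδ, fun s hs => ?_⟩
  rw [dist_eq_norm]
  refine lt_of_le_of_lt (norm_sub_le_of_tendsto hpt (h.mono fun N hN => hN s t ?_))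
    (half_lt_self hε)
  rwa [← Real.dist_eq]

/-- Pointwise convergence of an asymptotically equicontinuous family is locally uniform. -/
theorem eventually_forall_norm_sub_le [NeBot U]
    (hpt : ∀ t, Tendsto (fun N => x N t) U (𝓝 (u t)))
    (heq : ∀ ε > 0, ∃ δ > 0, ∀ᶠ N in U, ∀ s t : ℝ, |s - t| < δ → ‖x N s - x N t‖ ≤ ε)
    (S : ℝ) {ε : ℝ} (hε : 0 < ε) : ∀ᶠ N in U, ∀ t ∈ Icc 0 S, ‖x N t - u t‖ ≤ ε := by
  obtain ⟨δ, hδ, h⟩ := heq (ε / 3) (by positivity)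
  set d := δ / 2 with hd
  have hd0 : 0 < d := by positivity
  have hfin : ∀ᶠ N in U, ∀ i ∈ Finset.range (⌊S / d⌋₊ + 1), ‖x N (i * d) - u (i * d)‖ < ε / 3 := by
    rw [Filter.eventually_all_finset]
    intro i _
    have := (hpt (i * d)).sub_const (u (i * d))
    rw [sub_self] at this
    have := this.norm
    rw [norm_zero] at this
    exact this.eventually (gt_mem_nhds (by positivity))
  filter_upwards [h, hfin] with N h1 h2 t ht
  set i := ⌊t / d⌋₊ with hi
  have hi1 : (i : ℝ) * d ≤ t := by
    rw [← le_div_iff₀ hd0]; exact Nat.floor_le (div_nonneg ht.1 hd0.le)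
  have hi2 : t < (i + 1) * d := by
    rw [← div_lt_iff₀ hd0]; exact Nat.lt_floor_add_one _
  have hdist : |t - i * d| < δ := by
    rw [abs_lt]; constructor <;> linarith
  have e1 := h1 t (i * d) hdist
  have e2 := h2 i (by
    rw [Finset.mem_range, Nat.lt_succ_iff]
    exact Nat.floor_le_floor (by gcongr; exact ht.2))
  have e3 : ‖u t - u (i * d)‖ ≤ ε / 3 :=
    norm_sub_le_of_tendsto hpt (h.mono fun N hN => hN t _ hdist)
  have : x N t - u t = (x N t - x N (i * d)) + (x N (i * d) - u (i * d)) - (u t - u (i * d)) := by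
    abel
  rw [this]
  refine (norm_sub_le _ _).trans ?_
  have := norm_add_le (x N t - x N (i * d)) (x N (i * d) - u (i * d))
  linarith

end Equicontinuity

/-! ### Closedness of the subdifferential under weak limits. -/

section Identification

variable {H : Type u} [NormedAddCommGroup H] [InnerProductSpace ℝ H]

theorem memLp_two_of_continuous {E : Type*} [NormedAddCommGroup E] {u : ℝ → E} (hu : Continuous u)
    {s : Set ℝ} {a b : ℝ} (hs : s ⊆ Icc a b) (hsm : MeasurableSet s) :
    MemLp u 2 (volume.restrict s) := by
  obtain ⟨C, hC⟩ := (isCompact_Icc (a := a) (b := b)).exists_bound_of_continuousOn hu.continuousOn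
  have hfin : IsFiniteMeasure (volume.restrict s) :=
    ⟨by simpa using (measure_mono hs).trans_lt measure_Icc_lt_top⟩
  refine MemLp.of_bound hu.aestronglyMeasurable C ?_
  filter_upwards [ae_restrict_mem hsm] with t ht using hC t (hs ht)

theorem locallyIntegrable_of_memLp_two {z : ℝ → H} (hz : ∀ S, MemLp z 2 (volume.restrict (Iic S)))
    {u : ℝ → H} (hu : Continuous u) :
    LocallyIntegrable z volume ∧ LocallyIntegrable (fun t => inner ℝ (z t) (u t)) volume := by
  have h1 : ∀ K : Set ℝ, IsCompact K → IntegrableOn z K := by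
    intro K hK
    obtain ⟨b, hb⟩ := hK.bddAbove
    have hfin : IsFiniteMeasure (volume.restrict K) := ⟨by simpa using hK.measure_lt_top⟩
    exact ((hz b).mono_measure (Measure.restrict_mono (fun t ht => hb ht) le_rfl)).integrable
      one_le_two
  refine ⟨locallyIntegrable_iff.mpr h1, locallyIntegrable_iff.mpr fun K hK => ?_⟩
  obtain ⟨C, hC⟩ := hK.exists_bound_of_continuousOn hu.continuousOn
  refine Integrable.mono' ((h1 K hK).norm.mul_const C)
    ((h1 K hK).aestronglyMeasurable.inner hu.aestronglyMeasurable) ?_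
  filter_upwards [ae_restrict_mem hK.measurableSet] with t ht
  exact (norm_inner_le_norm _ _).trans (mul_le_mul_of_nonneg_left (hC t ht) (norm_nonneg _))

/-- Closedness of the subdifferential under locally uniform convergence of the arguments and weak
convergence of the subgradients. -/
theorem ae_mem_subdiff_of_tendsto [CompleteSpace H] {φ : H → EReal} (hφ : ProperConvexLSC φ)
    {U : Filter ℕ} [NeBot U] {v x : ℕ → ℝ → H} {u z : ℝ → H} (hu : Continuous u)
    (hunif : ∀ S, ∀ ε > 0, ∀ᶠ N in U, ∀ t ∈ Icc 0 S, ‖v N t - u t‖ ≤ ε)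
    (hxi : ∀ N S, IntegrableOn (x N) (Ioc 0 S))
    (hxb : ∀ S, ∃ C, ∀ N, ∫ t in Ioc 0 S, ‖x N t‖ ≤ C)
    (hz : ∀ S, MemLp z 2 (volume.restrict (Iic S)))
    (hweak : ∀ y : ℝ → H, ∀ S, MemLp y 2 (volume.restrict (Ioc 0 S)) →
        Tendsto (fun N => ∫ t in Ioc 0 S, inner ℝ (x N t) (y t)) U
          (𝓝 (∫ t in Ioc 0 S, inner ℝ (z t) (y t))))
    (hmem : ∀ t₀ > 0, ∀ᶠ N in U, ∀ t ≥ t₀, x N t ∈ subdiff φ (v N t)) :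
    ∀ᵐ t ∂volume.restrict (Ioi 0), z t ∈ subdiff φ (u t) := by
  obtain ⟨hzl, hzul⟩ := locallyIntegrable_of_memLp_two hz hu
  -- Work at a common Lebesgue point of z and of ⟨z, u⟩: the limit inequality is averaged over small
  -- balls around it.
  have hT1 := IsUnifLocDoublingMeasure.ae_tendsto_average (μ := volume) hzl 1
  have hT2 := IsUnifLocDoublingMeasure.ae_tendsto_average (μ := volume) hzul 1
  filter_upwards [ae_restrict_of_ae hT1, ae_restrict_of_ae hT2, ae_restrict_mem measurableSet_Ioi]
    with t ht1 ht2 ht0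
  have ht0' : 0 < t := ht0
  have hball : ∀ᶠ h : ℝ in 𝓝[>] 0, t ∈ Metric.closedBall t (1 * h) := by
    filter_upwards [self_mem_nhdsWithin] with h hh
    have : (0 : ℝ) < h := hh
    simp [this.le]
  have ht1' := ht1 (fun _ => t) id tendsto_id hball
  have ht2' := ht2 (fun _ => t) id tendsto_id hball
  -- the approximate inequality on a small interval around `t`
  have key : ∀ w ∈ effDom φ, ∀ c : ℝ, (c : EReal) < φ (u t) →
      c + inner ℝ (z t) (w - u t) ≤ (φ w).toReal := by
    intro w hw c hc
    set r := (φ w).toReal with hr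
    -- Lower semicontinuity makes c a lower bound of φ near u t. Working with c instead of φ (u t)
    -- avoids assuming that the latter is finite.
    obtain ⟨ρ, hρ, hρc⟩ := Metric.eventually_nhds_iff.mp (hφ.lsc (u t) c hc)
    obtain ⟨δ, hδ, hδu⟩ := Metric.continuous_iff.mp hu t (ρ / 2) (by positivity)
    have hsmall : ∀ᶠ h : ℝ in 𝓝[>] 0,
        c + (inner ℝ (⨍ s in Metric.closedBall t h, z s) w
          - ⨍ s in Metric.closedBall t h, inner ℝ (z s) (u s)) ≤ r := by
      filter_upwards [Ioo_mem_nhdsGT (show 0 < min (t / 2) (δ / 2) by positivity)] with h hh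
      have hh0 : 0 < h := hh.1
      have hh1 : h < t / 2 := hh.2.trans_le (min_le_left _ _)
      have hh2 : h < δ / 2 := hh.2.trans_le (min_le_right _ _)
      set I := Metric.closedBall t h with hI
      have hIcc : I = Icc (t - h) (t + h) := Real.closedBall_eq_Icc
      have hIm : MeasurableSet I := measurableSet_closedBall
      have hIsub : I ⊆ Ioc 0 (t + h) := by
        rw [hIcc]; exact fun s hs => ⟨by linarith [hs.1], hs.2⟩
      have hvol : volume.real I = 2 * h := by
        rw [hIcc, Real.volume_real_Icc_of_le (by linarith)]; ring
      obtain ⟨C, hC⟩ := hxb (t + h)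
      set y : ℝ → H := I.indicator fun s => w - u s with hy
      have hyL : MemLp y 2 (volume.restrict (Ioc 0 (t + h))) := by
        refine MemLp.indicator hIm (memLp_two_of_continuous (by fun_prop) Ioc_subset_Icc_self
          measurableSet_Ioc)
      have hyint : ∀ ζ : ℝ → H, ∫ s in Ioc 0 (t + h), inner ℝ (ζ s) (y s)
          = ∫ s in I, inner ℝ (ζ s) (w - u s) := by
        intro ζ
        rw [setIntegral_eq_of_subset_of_forall_sdiff_eq_zero (s := I) measurableSet_Ioc hIsub]
        · refine setIntegral_congr_fun hIm fun s hs => ?_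
          simp only [hy, Set.indicator_of_mem hs]
        · intro s hs
          simp only [hy, Set.indicator_of_notMem hs.2, inner_zero_right]
      have hlim := hweak y (t + h) hyL
      simp only [hyint] at hlim
      have hconst : ∀ a : ℝ, ∫ s in I, a = 2 * h * a := fun a => by
        rw [setIntegral_const, hvol, smul_eq_mul]
      have hIfin : volume I ≠ ⊤ := by rw [hIcc]; exact measure_Icc_lt_top.ne
      -- The term ε * C is the price of replacing v N by u in the inner product, using the L¹ bound
      -- on x N.
      have hineq : ∀ ε > 0, ε < ρ / 2 →
          2 * h * c + ∫ s in I, inner ℝ (z s) (w - u s) ≤ 2 * h * r + ε * C := by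
        intro ε hε hερ
        refine le_of_tendsto (hlim.const_add (2 * h * c)) ?_
        filter_upwards [hunif (t + h) ε hε, hmem (t - h) (by linarith)] with N hN1 hN2
        have hxI : IntegrableOn (x N) I := (hxi N (t + h)).mono_set hIsub
        have hpt : ∀ s ∈ I, c + inner ℝ (x N s) (w - u s) ≤ r + ε * ‖x N s‖ := by
          intro s hs
          have hs' := hIsub hs
          have hsI : s ∈ Icc (t - h) (t + h) := hIcc ▸ hs
          have hd1 : ‖v N s - u s‖ ≤ ε := hN1 s ⟨hs'.1.le, hs'.2⟩
          have hd2 : dist (u s) (u t) < ρ / 2 := hδu s (by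
            rw [Real.dist_eq, abs_lt]; constructor <;> linarith [hsI.1, hsI.2])
          have hd3 : (c : EReal) < φ (v N s) := hρc (by
            refine (dist_triangle _ (u s) _).trans_lt ?_
            rw [dist_eq_norm (v N s)]
            linarith)
          obtain ⟨hvd, hsub⟩ := (mem_subdiff_iff hφ).mp (hN2 s hsI.1)
          rw [← hφ.coe_toReal hvd, EReal.coe_lt_coe_iff] at hd3
          have h1 := hsub w hw
          have h2 : inner ℝ (x N s) (w - u s)
              = inner ℝ (x N s) (w - v N s) + inner ℝ (x N s) (v N s - u s) := by
            rw [← inner_add_right]; congr 1; abel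
          have h3 : inner ℝ (x N s) (v N s - u s) ≤ ε * ‖x N s‖ := by
            refine (real_inner_le_norm _ _).trans ?_
            rw [mul_comm]; exact mul_le_mul_of_nonneg_right hd1 (norm_nonneg _)
          linarith
        have hint1 : IntegrableOn (fun s => inner ℝ (x N s) (w - u s)) I := by
          obtain ⟨B, hB⟩ := (isCompact_closedBall t h).exists_bound_of_continuousOn
            (f := fun s => w - u s) (by fun_prop)
          refine Integrable.mono' (hxI.norm.mul_const B) (hxI.aestronglyMeasurable.inner
            (show Continuous fun s => w - u s by fun_prop).aestronglyMeasurable) ?_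
          filter_upwards [ae_restrict_mem hIm] with s hs
          exact (norm_inner_le_norm _ _).trans (mul_le_mul_of_nonneg_left (hB s hs) (norm_nonneg _))
        have hc1 : IntegrableOn (fun _ : ℝ => c) I := integrableOn_const hIfin
        have hr1 : IntegrableOn (fun _ : ℝ => r) I := integrableOn_const hIfin
        have hm := setIntegral_mono_on (hc1.add hint1) (hr1.add (hxI.norm.const_mul ε)) hIm hpt
        simp only [Pi.add_apply] at hm
        rw [integral_add hc1 hint1, integral_add hr1 (hxI.norm.const_mul ε), hconst, hconst,
          integral_const_mul] at hm
        have hm2 : ∫ s in I, ‖x N s‖ ≤ C := (setIntegral_mono_set (hxi N (t + h)).norm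
          (ae_of_all _ fun s => norm_nonneg _) hIsub.eventuallyLE).trans (hC N)
        have := mul_le_mul_of_nonneg_left hm2 hε.le
        linarith
      have hineq0 : 2 * h * c + ∫ s in I, inner ℝ (z s) (w - u s) ≤ 2 * h * r := by
        have hlim2 : Tendsto (fun ε : ℝ => 2 * h * r + ε * C) (𝓝[>] 0) (𝓝 (2 * h * r + 0 * C)) :=
          (Continuous.tendsto (by fun_prop) 0).mono_left nhdsWithin_le_nhds
        rw [zero_mul, add_zero] at hlim2
        refine ge_of_tendsto hlim2 ?_
        filter_upwards [Ioo_mem_nhdsGT (show 0 < ρ / 2 by positivity)] with ε hε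
          using hineq ε hε.1 hε.2
      have hz1 : IntegrableOn z I := hzl.integrableOn_isCompact (isCompact_closedBall t h)
      have hz2 : IntegrableOn (fun s => inner ℝ (z s) (u s)) I :=
        hzul.integrableOn_isCompact (isCompact_closedBall t h)
      have hsplit : ∫ s in I, inner ℝ (z s) (w - u s)
          = inner ℝ (∫ s in I, z s) w - ∫ s in I, inner ℝ (z s) (u s) := by
        simp only [inner_sub_right]
        rw [integral_sub (hz1.inner_const w) hz2]
        congr 1
        rw [real_inner_comm, ← integral_inner hz1]
        simp only [real_inner_comm]
      rw [hsplit] at hineq0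
      rw [setAverage_eq, setAverage_eq, hvol, real_inner_smul_left, smul_eq_mul, ← mul_sub]
      have h2h : 0 < 2 * h := by positivity
      have h4 := mul_le_mul_of_nonneg_left hineq0 (inv_nonneg.mpr h2h.le)
      rw [mul_add, ← mul_assoc, ← mul_assoc (2 * h)⁻¹ (2 * h) r, inv_mul_cancel₀ h2h.ne', one_mul,
        one_mul] at h4
      exact h4
    have hlim : Tendsto (fun h : ℝ => c + (inner ℝ (⨍ s in Metric.closedBall t h, z s) w
          - ⨍ s in Metric.closedBall t h, inner ℝ (z s) (u s))) (𝓝[>] 0)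
        (𝓝 (c + (inner ℝ (z t) w - inner ℝ (z t) (u t)))) :=
      ((ht1'.inner tendsto_const_nhds).sub ht2').const_add c
    rw [← inner_sub_right] at hlim
    exact le_of_tendsto hlim hsmall
  -- If φ (u t) were ⊤, every real c would be allowed in `key`, which contradicts finiteness of φ at
  -- one point.
  have hd : u t ∈ effDom φ := by
    by_contra hne
    have htop : φ (u t) = ⊤ := top_le_iff.mp (not_lt.mp hne)
    obtain ⟨w, hw⟩ := hφ.proper
    have := key w hw ((φ w).toReal - inner ℝ (z t) (w - u t) + 1) (htop ▸ EReal.coe_lt_top _)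
    linarith
  refine (mem_subdiff_iff hφ).mpr ⟨hd, fun w hw => ?_⟩
  refine le_of_forall_lt_imp_le_of_dense fun c hc => ?_
  have h1 := key w hw (c - inner ℝ (z t) (w - u t)) (by
    rw [← hφ.coe_toReal hd, EReal.coe_lt_coe_iff]
    linarith)
  linarith

end Identification

/-! ### Weak derivatives of primitives. -/

section WeakDerivative

variable {H : Type u} [NormedAddCommGroup H] [InnerProductSpace ℝ H]

/-- A primitive has the weak derivative one expects. -/
theorem isWeakDeriv_of_eq_integral [CompleteSpace H] {v g : ℝ → H}
    (hg : ∀ S, IntegrableOn g (Ioc 0 S)) (hv : ∀ S, 0 < S → v S = ∫ s in Ioc 0 S, g s) :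
    IsWeakDeriv (Ioi 0) v g := by
  intro ψ hψ hψc hψs
  obtain ⟨R, hR⟩ := hψc.isCompact.bddAbove
  have hψ0 : ∀ t, t ∉ Ioc 0 R → ψ t = 0 := fun t ht => by
    by_contra hne
    have h1 := subset_tsupport ψ (Function.mem_support.mpr hne)
    exact ht ⟨hψs h1, hR h1⟩
  have hdψ0 : ∀ t, t ∉ Ioc 0 R → deriv ψ t = 0 := fun t ht => by
    by_contra hne
    have h1 := tsupport_deriv_subset (subset_tsupport _ (Function.mem_support.mpr hne))
    exact ht ⟨hψs h1, hR h1⟩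
  have hdc : Continuous (deriv ψ) := hψ.continuous_deriv (by simp)
  -- The endpoint R + 1 lies beyond the support of ψ, so no boundary term appears after Fubini on
  -- the triangle s ≤ t.
  have hsub : Ioc 0 (R + 1) ⊆ Ioi 0 := Ioc_subset_Ioi_self
  have hR1 : Ioc 0 R ⊆ Ioc 0 (R + 1) := Ioc_subset_Ioc_right (by linarith)
  rw [setIntegral_eq_of_subset_of_forall_sdiff_eq_zero (s := Ioc 0 (R + 1)) measurableSet_Ioi hsub
      fun t ht => by rw [hdψ0 t fun h => ht.2 (hR1 h), zero_smul],
    setIntegral_eq_of_subset_of_forall_sdiff_eq_zero (s := Ioc 0 (R + 1)) measurableSet_Ioi hsub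
      fun t ht => by rw [hψ0 t fun h => ht.2 (hR1 h), zero_smul]]
  set μ := volume.restrict (Ioc 0 (R + 1)) with hμ
  have hmeas : MeasurableSet {p : ℝ × ℝ | p.2 ≤ p.1} := measurableSet_le measurable_snd
    measurable_fst
  have hG : Integrable (Function.uncurry fun t s : ℝ =>
      {p : ℝ × ℝ | p.2 ≤ p.1}.indicator (fun p => deriv ψ p.1 • g p.2) (t, s)) (μ.prod μ) := by
    have h1 : Integrable (fun p : ℝ × ℝ => deriv ψ p.1 • g p.2) (μ.prod μ) :=
      Integrable.smul_prod
        ((hdc.continuousOn.integrableOn_compact isCompact_Icc).mono_set Ioc_subset_Icc_self)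
        (hg (R + 1))
    exact h1.indicator hmeas
  have hswap := integral_integral_swap hG
  have hL : ∀ t ∈ Ioc 0 (R + 1), ∫ s, {p : ℝ × ℝ | p.2 ≤ p.1}.indicator
      (fun p => deriv ψ p.1 • g p.2) (t, s) ∂μ = deriv ψ t • v t := by
    intro t ht
    rw [hv t ht.1, ← integral_smul, hμ]
    rw [setIntegral_eq_of_subset_of_forall_sdiff_eq_zero (s := Ioc 0 t) measurableSet_Ioc
      (Ioc_subset_Ioc_right ht.2)]
    · refine setIntegral_congr_fun measurableSet_Ioc fun s hs => ?_
      exact Set.indicator_of_mem (show (t, s) ∈ {p : ℝ × ℝ | p.2 ≤ p.1} from hs.2) _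
    · intro s hs
      exact Set.indicator_of_notMem (s := {p : ℝ × ℝ | p.2 ≤ p.1}) (a := (t, s))
        (fun h => hs.2 ⟨hs.1.1, h⟩) fun p => deriv ψ p.1 • g p.2
  have hRr : ∀ s ∈ Ioc 0 (R + 1), ∫ t, {p : ℝ × ℝ | p.2 ≤ p.1}.indicator
      (fun p => deriv ψ p.1 • g p.2) (t, s) ∂μ = -(ψ s • g s) := by
    intro s hs
    have h1 : ∀ t, {p : ℝ × ℝ | p.2 ≤ p.1}.indicator (fun p => deriv ψ p.1 • g p.2) (t, s)
        = (Ici s).indicator (deriv ψ) t • g s := by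
      intro t
      by_cases h : s ≤ t
      · rw [Set.indicator_of_mem (show (t, s) ∈ {p : ℝ × ℝ | p.2 ≤ p.1} from h),
          Set.indicator_of_mem (show t ∈ Ici s from h)]
      · rw [Set.indicator_of_notMem (show (t, s) ∉ {p : ℝ × ℝ | p.2 ≤ p.1} from h),
          Set.indicator_of_notMem (show t ∉ Ici s from h), zero_smul]
    simp only [h1]
    rw [integral_smul_const, ← neg_smul, hμ, setIntegral_indicator measurableSet_Ici]
    congr 1
    have h2 : Ioc 0 (R + 1) ∩ Ici s = Icc s (R + 1) := by
      ext t
      simp only [mem_inter_iff, mem_Ioc, mem_Ici, mem_Icc]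
      exact ⟨fun h => ⟨h.2, h.1.2⟩, fun h => ⟨⟨hs.1.trans_le h.1, h.2⟩, h.1⟩⟩
    rw [h2, integral_Icc_eq_integral_Ioc, ← intervalIntegral.integral_of_le hs.2,
      intervalIntegral.integral_deriv_eq_sub
        (fun t _ => (hψ.differentiable (by simp)) t) (hdc.intervalIntegrable _ _),
      hψ0 (R + 1) fun h => by linarith [h.2], zero_sub]
  rw [← setIntegral_congr_fun measurableSet_Ioc hL, hswap,
    setIntegral_congr_fun measurableSet_Ioc hRr, integral_neg]

end WeakDerivative

/-! ### Discrete solutions: time regularity and integrated equation. -/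

/-- A solution of the discrete problem together with its a priori bounds. -/
structure IsDiscreteSolution {H : Type u} [NormedAddCommGroup H] [InnerProductSpace ℝ H]
    (φ₁ φ₂ : H → EReal) (a : ℕ → ℝ) (f : ℕ → H) (u₀ : H) (R G : ℝ) (u ξ η : ℕ → H) : Prop where
  zero : u 0 = u₀
  succ : ∀ n, u (n + 1) = u₀ + ∑ p ∈ Finset.HasAntidiagonal.antidiagonal n,
    a p.1 • (f p.2 + η p.2 - ξ p.2)
  left : ∀ n, ξ n ∈ subdiff φ₁ (u (n + 1))
  right : ∀ n, η (n + 1) ∈ subdiff φ₂ (u (n + 1))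
  bound : ∀ n, φ₁ (u n) ≤ (R : EReal)
  left_sq : ∀ n, ∑ p ∈ Finset.HasAntidiagonal.antidiagonal n, a p.1 * ‖ξ p.2‖ ^ 2 ≤ G
  right_sq : ∀ n, ∑ p ∈ Finset.HasAntidiagonal.antidiagonal n, a p.1 * ‖η p.2‖ ^ 2 ≤ G
  data_sq : ∀ n, ∑ p ∈ Finset.HasAntidiagonal.antidiagonal n, a p.1 * ‖f p.2‖ ^ 2 ≤ G

theorem sum_antidiagonal_eq_sum_range {M : Type*} [AddCommMonoid M] (F : ℕ → ℕ → M) (n : ℕ) :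
    ∑ p ∈ Finset.HasAntidiagonal.antidiagonal n, F p.1 p.2
      = ∑ j ∈ Finset.range (n + 1), F (n - j) j := by
  rw [← Finset.Nat.sum_antidiagonal_swap, Finset.Nat.sum_antidiagonal_eq_sum_range_succ_mk]
  rfl

theorem norm_add_sub_sq_le {E : Type*} [NormedAddCommGroup E] (x y z : E) :
    ‖x + y - z‖ ^ 2 ≤ 3 * (‖x‖ ^ 2 + ‖y‖ ^ 2 + ‖z‖ ^ 2) := by
  have h1 : ‖x + y - z‖ ≤ ‖x‖ + ‖y‖ + ‖z‖ :=
    (norm_sub_le _ _).trans (by linarith [norm_add_le x y])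
  have h2 := pow_le_pow_left₀ (norm_nonneg _) h1 2
  nlinarith [sq_nonneg (‖x‖ - ‖y‖), sq_nonneg (‖y‖ - ‖z‖), sq_nonneg (‖x‖ - ‖z‖)]

section Discrete

variable {H : Type u} [NormedAddCommGroup H] [InnerProductSpace ℝ H] {φ₁ φ₂ : H → EReal}
  {f : ℕ → H} {u₀ : H} {R G : ℝ} {u ξ η : ℕ → H}

/-- The increment f + η - ξ has three parts, each with a * ‖·‖² ≤ G. Squaring the sum costs a factor
3, hence 9 G. -/
theorem IsDiscreteSolution.norm_sub_le {a b : ℕ → ℝ} (hab : ConjugateSequences a b)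
    (h : IsDiscreteSolution φ₁ φ₂ a f u₀ R G u ξ η) (n m : ℕ) :
    ‖u (n + m) - u n‖ ≤ 2 * √((∑ i ∈ Finset.range m, a i) * (9 * G)) := by
  set g : ℕ → H := fun j => f j + η j - ξ j with hg
  have hG0 : 0 ≤ G := (Finset.sum_nonneg fun p _ =>
    mul_nonneg (hab.left_nonneg _) (sq_nonneg _)).trans (h.left_sq 0)
  have hu : ∀ n, u n = u₀ + ∑ j ∈ Finset.range n, a (n - 1 - j) • g j := by
    rintro (_ | n)
    · simp [h.zero]
    · rw [h.succ, sum_antidiagonal_eq_sum_range fun i j => a i • (f j + η j - ξ j)]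
      simp only [Nat.add_sub_cancel, hg]
  have hgG : ∀ n, ∑ j ∈ Finset.range n, a (n - 1 - j) * ‖g j‖ ^ 2 ≤ 9 * G := by
    rintro (_ | n)
    · simpa using hG0
    · simp only [Nat.add_sub_cancel]
      rw [← sum_antidiagonal_eq_sum_range fun i j => a i * ‖g j‖ ^ 2]
      have h3 : ∑ p ∈ Finset.HasAntidiagonal.antidiagonal n, a p.1 * ‖g p.2‖ ^ 2
          ≤ ∑ p ∈ Finset.HasAntidiagonal.antidiagonal n,
            (3 * (a p.1 * ‖f p.2‖ ^ 2) + 3 * (a p.1 * ‖η p.2‖ ^ 2)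
              + 3 * (a p.1 * ‖ξ p.2‖ ^ 2)) := Finset.sum_le_sum fun p _ => by
        have := mul_le_mul_of_nonneg_left (norm_add_sub_sq_le (f p.2) (η p.2) (ξ p.2))
          (hab.left_nonneg p.1)
        refine this.trans (le_of_eq ?_)
        ring
      rw [Finset.sum_add_distrib, Finset.sum_add_distrib, ← Finset.mul_sum, ← Finset.mul_sum,
        ← Finset.mul_sum] at h3
      linarith [h.left_sq n, h.right_sq n, h.data_sq n]
  have := norm_conv_sub_le hab.left_nonneg hab.left_anti hgG n m
  rw [hu (n + m), hu n, add_sub_add_left_eq_sub]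
  exact this

/-- Convolving a * x ≤ G with b turns the left side into partial sums of x. This trades the
kernel-weighted bounds for plain L² bounds. -/
theorem ConjugateSequences.sum_range_le {a b : ℕ → ℝ} (hab : ConjugateSequences a b) {x : ℕ → ℝ}
    (hx : ∀ n, ∑ p ∈ Finset.HasAntidiagonal.antidiagonal n, a p.1 * x p.2 ≤ G) (m : ℕ) :
    ∑ j ∈ Finset.range m, x j ≤ G * ∑ i ∈ Finset.range m, b i := by
  cases m with
  | zero => simp
  | succ m =>
    rw [hab.sum_eq (x := fun n => ∑ p ∈ Finset.HasAntidiagonal.antidiagonal n, a p.1 * x p.2)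
      fun n => rfl]
    rw [Finset.Nat.sum_antidiagonal_eq_sum_range_succ_mk, Finset.mul_sum]
    refine Finset.sum_le_sum fun i _ => ?_
    rw [mul_comm G]
    exact mul_le_mul_of_nonneg_left (hx _) (hab.right_nonneg i)

variable {k l : ℝ → ℝ}

/-- The primitive of the discrete time derivative. -/
theorem IsDiscreteSolution.sum_inner_eq (hkl : ConjugateKernels k l) {L : ℝ} (hL : 0 < L)
    (h : IsDiscreteSolution φ₁ φ₂ (poissonMoment l L) f u₀ R G u ξ η) (v : H) (n : ℕ) :
    L⁻¹ * ∑ j ∈ Finset.range n, inner ℝ (f j + η j - ξ j) v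
      = ∑ i ∈ Finset.range (n + 1), inner ℝ (u (n - i) - u₀) v * poissonMoment k L i := by
  have hab := hkl.conjugateSequences hL
  cases n with
  | zero => simp [h.zero]
  | succ n =>
    -- The top index contributes nothing because u 0 = u₀. What remains is the deconvolution of u (·
    -- + 1) - u₀.
    rw [Finset.sum_range_succ _ (n + 1), Nat.sub_self, h.zero, sub_self, inner_zero_left, zero_mul,
      add_zero, hab.sum_eq (x := fun n => inner ℝ (u (n + 1) - u₀) v) (fun n => ?_) n,
      Finset.Nat.sum_antidiagonal_eq_sum_range_succ_mk, Finset.mul_sum]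
    · refine Finset.sum_congr rfl fun i hi => ?_
      rw [Finset.mem_range] at hi
      simp only
      rw [show n + 1 - i = n - i + 1 by omega]
      field_simp
    · rw [h.succ, add_sub_cancel_left, sum_inner]
      simp only [real_inner_smul_left]

end Discrete

/-! ### Weighted L² bounds uniform in the mesh. -/

section StepBounds

variable {H : Type u} [NormedAddCommGroup H] [InnerProductSpace ℝ H] {k l : ℝ → ℝ}

/-- C depends only on G and k. The factor L in b cancels the mesh size, and the moments of k sum to
at most a multiple of e^{m/L}. -/
theorem ConjugateKernels.inv_mul_sum_norm_sq_le {E : Type*} [NormedAddCommGroup E]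
    (hkl : ConjugateKernels k l) {G : ℝ} (hG0 : 0 ≤ G) :
    ∃ C, 0 ≤ C ∧ ∀ L : ℝ, 1 ≤ L → ∀ x : ℕ → E,
      (∀ n, ∑ p ∈ Finset.HasAntidiagonal.antidiagonal n, poissonMoment l L p.1 * ‖x p.2‖ ^ 2 ≤ G) →
      ∀ m : ℕ, L⁻¹ * ∑ j ∈ Finset.range m, ‖x j‖ ^ 2 ≤ C * Real.exp (m / L) := by
  have hk := hkl.isKernel_left
  set K := ∫ t in Ioi (0 : ℝ), k t * Real.exp (-(t / 2)) with hK
  have hK0 : 0 ≤ K := setIntegral_nonneg measurableSet_Ioi fun t ht =>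
    mul_nonneg (hk.nonneg t ht) (Real.exp_nonneg _)
  refine ⟨G * K, by positivity, fun L hL x hx m => ?_⟩
  have hL0 : 0 < L := by linarith
  have h1 := (hkl.conjugateSequences hL0).sum_range_le (x := fun j => ‖x j‖ ^ 2) hx m
  rw [← Finset.mul_sum] at h1
  have h2 := hk.sum_poissonMoment_le hL m
  calc L⁻¹ * ∑ j ∈ Finset.range m, ‖x j‖ ^ 2
      ≤ L⁻¹ * (G * (L * ∑ i ∈ Finset.range m, poissonMoment k L i)) :=
        mul_le_mul_of_nonneg_left h1 (inv_nonneg.mpr hL0.le)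
    _ = G * ∑ i ∈ Finset.range m, poissonMoment k L i := by field_simp
    _ ≤ G * (Real.exp (m / L) * K) := mul_le_mul_of_nonneg_left h2 hG0
    _ = _ := by ring

/-- A weighted `L²` bound for step functions, uniform in the step size. -/
theorem lintegral_exp_smul_step_le {C : ℝ} (hC0 : 0 ≤ C) {L : ℝ} (hL : 1 ≤ L) {x : ℕ → H}
    (hx : ∀ m : ℕ, L⁻¹ * ∑ j ∈ Finset.range m, ‖x j‖ ^ 2 ≤ C * Real.exp (m / L)) :
    ∫⁻ t in Ioi (0 : ℝ), ‖Real.exp (-t) • x ⌊L * t⌋₊‖ₑ ^ 2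
      ≤ ENNReal.ofReal (C * Real.exp 2 * ∑' i : ℕ, Real.exp (-1) ^ i) := by
  have hL0 : 0 < L := by linarith
  have e1 : ∀ t : ℝ, ‖Real.exp (-t) • x ⌊L * t⌋₊‖ₑ ^ 2
      = ENNReal.ofReal (Real.exp (-(2 * t))) * ‖x ⌊L * t⌋₊‖ₑ ^ 2 := by
    intro t
    rw [enorm_smul, mul_pow, Real.enorm_eq_ofReal (Real.exp_nonneg _),
      ← ENNReal.ofReal_pow (Real.exp_nonneg _), ← Real.exp_nat_mul]
    congr 3; push_cast; ring
  simp only [e1]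
  rw [ENNReal.ofReal_mul (by positivity)]
  refine lintegral_exp_mul_le ((stronglyMeasurable_step x L).enorm.pow_const 2) fun i => ?_
  refine (lintegral_step_le (h := fun n => ‖x n‖ₑ ^ 2) hL0 (i + 1)).trans ?_
  have e2 : ∀ n, ‖x n‖ₑ ^ 2 = ENNReal.ofReal (‖x n‖ ^ 2) := fun n => by
    rw [ENNReal.ofReal_pow (norm_nonneg _), ofReal_norm]
  simp only [e2]
  rw [← ENNReal.ofReal_sum_of_nonneg fun n _ => sq_nonneg _,
    ← ENNReal.ofReal_mul (inv_nonneg.mpr hL0.le), ← ENNReal.ofReal_mul (by positivity)]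
  refine ENNReal.ofReal_le_ofReal ((hx _).trans ?_)
  rw [mul_assoc, ← Real.exp_add]
  -- (⌊L(i + 1)⌋ + 1)/L ≤ i + 2 because L ≥ 1, which is where e² comes from.
  refine mul_le_mul_of_nonneg_left (Real.exp_le_exp.mpr ?_) hC0
  rw [div_le_iff₀ hL0]
  have := Nat.floor_le (show 0 ≤ L * (i + 1) by positivity)
  push_cast
  nlinarith

theorem integrableOn_of_lintegral_exp_smul_le {x : ℝ → H} (hx : StronglyMeasurable x) {C : ℝ}
    (hC : ∫⁻ t in Ioi (0 : ℝ), ‖Real.exp (-t) • x t‖ₑ ^ 2 ≤ ENNReal.ofReal C) (hC0 : 0 ≤ C)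
    (S : ℝ) :
    IntegrableOn x (Ioc 0 S) ∧ ∫ t in Ioc 0 S, ‖x t‖ ≤ max S 0 + Real.exp S * Real.exp S * C := by
  have h1 : ∫⁻ t in Ioc 0 S, ‖x t‖ₑ
      ≤ ENNReal.ofReal (max S 0 + Real.exp S * Real.exp S * C) := by
    have hpt : ∀ t ∈ Ioc 0 S, ‖x t‖ₑ ≤ 1 + ENNReal.ofReal (Real.exp S * Real.exp S)
        * ‖Real.exp (-t) • x t‖ₑ ^ 2 := by
      intro t ht
      rw [enorm_smul, mul_pow, Real.enorm_eq_ofReal (Real.exp_nonneg _), ← mul_assoc,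
        ← ENNReal.ofReal_pow (Real.exp_nonneg _), ← ENNReal.ofReal_mul (by positivity),
        ← ofReal_norm, ← ENNReal.ofReal_pow (norm_nonneg _), ← ENNReal.ofReal_mul (by positivity),
        ← ENNReal.ofReal_one, ← ENNReal.ofReal_add zero_le_one (by positivity)]
      refine ENNReal.ofReal_le_ofReal ?_
      have h2 : 1 ≤ Real.exp S * Real.exp S * Real.exp (-t) ^ 2 := by
        rw [sq, ← Real.exp_add, ← Real.exp_add, ← Real.exp_add]
        exact Real.one_le_exp (by linarith [ht.2])
      nlinarith [sq_nonneg (‖x t‖ - 1), norm_nonneg (x t), sq_nonneg ‖x t‖]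
    have hm : Measurable fun t => ‖Real.exp (-t) • x t‖ₑ ^ 2 :=
      (((show Continuous fun t : ℝ => Real.exp (-t) by fun_prop).stronglyMeasurable.smul
        hx).enorm).pow_const 2
    refine (setLIntegral_mono' measurableSet_Ioc hpt).trans ?_
    rw [lintegral_add_left measurable_const, lintegral_const, one_mul, lintegral_const_mul _ hm,
      ENNReal.ofReal_add (le_max_right _ _) (by positivity)]
    refine add_le_add (le_of_eq ?_) ?_
    · rw [Measure.restrict_apply MeasurableSet.univ, univ_inter, Real.volume_Ioc, sub_zero]
      rcases le_total 0 S with h | h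
      · rw [max_eq_left h]
      · rw [max_eq_right h, ENNReal.ofReal_of_nonpos h, ENNReal.ofReal_zero]
    · rw [ENNReal.ofReal_mul (p := Real.exp S * Real.exp S) (by positivity)]
      gcongr
      exact (lintegral_mono_set Ioc_subset_Ioi_self).trans hC
  have hint : IntegrableOn x (Ioc 0 S) := ⟨hx.aestronglyMeasurable, h1.trans_lt
    ENNReal.ofReal_lt_top⟩
  refine ⟨hint, ?_⟩
  rw [integral_norm_eq_lintegral_enorm hx.aestronglyMeasurable]
  exact ENNReal.toReal_le_of_le_ofReal (by positivity) h1

end StepBounds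

/-! ### Equicontinuity of the discrete solutions. -/

section Equicontinuity

variable {H : Type u} [NormedAddCommGroup H] [InnerProductSpace ℝ H] {φ₁ φ₂ : H → EReal}
  {k l : ℝ → ℝ} {f : ℝ → H} {u₀ : H} {R G : ℝ} {u ξ η : ℕ → ℕ → H}

theorem IsKernel.exists_integral_lt (hl : IsKernel l) {ε : ℝ} (hε : 0 < ε) :
    ∃ S > 0, ∫ t in Ioc 0 S, l t < ε := by
  have hc : ContinuousOn (fun x => ∫ t in Ioc 0 x, l t) (Icc 0 1) :=
    intervalIntegral.continuousOn_primitive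
      (hl.locInt.integrableOn_compact_subset (fun _ h => h.1) isCompact_Icc)
  have h0 := hc 0 ⟨le_rfl, zero_le_one⟩
  have h1 : ∀ᶠ x in 𝓝[Icc (0 : ℝ) 1] 0, ∫ t in Ioc 0 x, l t < ε :=
    h0.eventually (gt_mem_nhds (by simpa using hε))
  have h2 : 𝓝[>] (0 : ℝ) ≤ 𝓝[Icc (0 : ℝ) 1] 0 := by
    rw [nhdsWithin_le_iff]
    exact mem_of_superset (Ioo_mem_nhdsGT (zero_lt_one' ℝ)) Ioo_subset_Icc_self
  obtain ⟨S, hS, hS0⟩ := ((h1.filter_mono h2).and self_mem_nhdsWithin).exists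
  exact ⟨S, hS0, hS⟩

theorem tendsto_natCast_add_one : Tendsto (fun N : ℕ => (N : ℝ) + 1) atTop atTop :=
  tendsto_atTop_add_const_right _ _ tendsto_natCast_atTop_atTop

/-- Over m steps the oscillation is governed by ∑_{i<m} a i. For m ≤ S L this sum is at most the one
up to S L, which tends to ∫₀^S l and so is small for small S. -/
theorem asymptotically_equicontinuous_step (hkl : ConjugateKernels k l)
    (hD : ∀ N : ℕ, IsDiscreteSolution φ₁ φ₂ (poissonMoment l ((N : ℝ) + 1))
      (poissonAverage f ((N : ℝ) + 1)) u₀ R G (u N) (ξ N) (η N)) {ε : ℝ} (hε : 0 < ε) :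
    ∃ δ > 0, ∀ᶠ N : ℕ in atTop, ∀ s t : ℝ, |s - t| < δ →
      ‖u N ⌊((N : ℝ) + 1) * s⌋₊ - u N ⌊((N : ℝ) + 1) * t⌋₊‖ ≤ ε := by
  have hl := hkl.isKernel_right
  have hab : ∀ N : ℕ, _ := fun N => hkl.conjugateSequences
    (show (0 : ℝ) < (N : ℝ) + 1 by positivity)
  have hG0 : 0 ≤ G := (Finset.sum_nonneg fun p _ =>
    mul_nonneg ((hab 0).left_nonneg _) (sq_nonneg _)).trans ((hD 0).left_sq 0)
  -- Chosen so that 2√(9G · ε²/(36G + 1)) ≤ ε; the +1 covers G = 0.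
  obtain ⟨S, hS, hSl⟩ := hl.exists_integral_lt (ε := ε ^ 2 / (36 * G + 1)) (by positivity)
  have hlim := (tendsto_sum_integral_poissonWeight hl.integrableOn_mul_exp_half hS.le).comp
    tendsto_natCast_add_one
  refine ⟨S / 2, by positivity, ?_⟩
  filter_upwards [hlim.eventually (gt_mem_nhds hSl),
    tendsto_natCast_add_one.eventually_ge_atTop (2 / S)] with N hN1 hN2
  set L : ℝ := (N : ℝ) + 1 with hL
  have hL0 : 0 < L := by positivity
  have hmain : ∀ s t : ℝ, s ≤ t → t - s < S / 2 → ‖u N ⌊L * t⌋₊ - u N ⌊L * s⌋₊‖ ≤ ε := by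
    intro s t hst hts
    have hfl : ⌊L * s⌋₊ ≤ ⌊L * t⌋₊ := Nat.floor_le_floor (mul_le_mul_of_nonneg_left hst hL0.le)
    obtain ⟨m, hm⟩ := Nat.exists_eq_add_of_le hfl
    -- Rounding adds at most one step: m ≤ L(t - s) + 1, and 1 ≤ L S/2 for large N, which is why δ =
    -- S/2.
    have hmS : m ≤ ⌊S * L⌋₊ := by
      rcases le_or_gt t 0 with ht | ht
      · have : ⌊L * t⌋₊ = 0 := Nat.floor_of_nonpos (mul_nonpos_of_nonneg_of_nonpos hL0.le ht)
        omega
      · refine Nat.le_floor ?_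
        have h1 := Nat.floor_le (mul_nonneg hL0.le ht.le)
        have h2 := Nat.lt_floor_add_one (L * s)
        rw [hm] at h1
        push_cast at h1
        have h3 : 2 ≤ L * S := by rwa [div_le_iff₀ hS] at hN2
        nlinarith
    have hsum : ∑ i ∈ Finset.range m, poissonMoment l L i ≤ ε ^ 2 / (36 * G + 1) := by
      refine (Finset.sum_le_sum_of_subset_of_nonneg (Finset.range_mono hmS)
        fun i _ _ => (hab N).left_nonneg i).trans hN1.le
    rw [hm]
    refine ((hD N).norm_sub_le (hab N) _ m).trans ?_
    have h4 : √((∑ i ∈ Finset.range m, poissonMoment l L i) * (9 * G)) ≤ ε / 2 := by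
      refine Real.sqrt_le_iff.mpr ⟨by positivity, ?_⟩
      refine (mul_le_mul_of_nonneg_right hsum (by positivity)).trans ?_
      rw [div_mul_eq_mul_div, div_le_iff₀ (by positivity)]
      nlinarith [sq_nonneg ε]
    linarith
  intro s t hst
  rw [abs_lt] at hst
  rcases le_total s t with h | h
  · rw [norm_sub_rev]; exact hmain s t h (by linarith)
  · exact hmain t s h (by linarith)

end Equicontinuity

/-! ### Passage to the limit in the integrated equation. -/

section Limits

variable {H : Type u} [NormedAddCommGroup H] [InnerProductSpace ℝ H] {k l : ℝ → ℝ}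
  {U : Filter ℕ}

/-- Sum and integral differ by the incomplete last cell. There L⁻¹‖x‖² is bounded, so L⁻¹‖x‖ is of
order L^{-1/2}. -/
theorem tendsto_inv_mul_sum_inner (hU : U ≤ atTop) {x : ℕ → ℕ → H} {z : ℝ → H} {C : ℝ}
    (hx : ∀ N m : ℕ, ((N : ℝ) + 1)⁻¹ * ∑ j ∈ Finset.range m, ‖x N j‖ ^ 2
      ≤ C * Real.exp (m / ((N : ℝ) + 1))) (hC0 : 0 ≤ C) {S : ℝ} (hS : 0 ≤ S) (w : H)
    (hweak : Tendsto (fun N : ℕ => ∫ t in Ioc 0 S, inner ℝ (x N ⌊((N : ℝ) + 1) * t⌋₊) w) U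
      (𝓝 (∫ t in Ioc 0 S, inner ℝ (z t) w))) :
    Tendsto (fun N : ℕ => ((N : ℝ) + 1)⁻¹ *
      ∑ j ∈ Finset.range ⌊S * ((N : ℝ) + 1)⌋₊, inner ℝ (x N j) w) U
      (𝓝 (∫ t in Ioc 0 S, inner ℝ (z t) w)) := by
  have hrem : Tendsto (fun N : ℕ => √(((N : ℝ) + 1)⁻¹ * (C * Real.exp (S + 1))) * ‖w‖) U (𝓝 0) := by
    have h1 : Tendsto (fun N : ℕ => ((N : ℝ) + 1)⁻¹) U (𝓝 0) :=
      (tendsto_inv_atTop_zero.comp tendsto_natCast_add_one).mono_left hU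
    have h2 := ((h1.mul_const (C * Real.exp (S + 1))).sqrt).mul_const ‖w‖
    simpa using h2
  have hdiff : Tendsto (fun N : ℕ => (∫ t in Ioc 0 S, inner ℝ (x N ⌊((N : ℝ) + 1) * t⌋₊) w)
      - ((N : ℝ) + 1)⁻¹ * ∑ j ∈ Finset.range ⌊S * ((N : ℝ) + 1)⌋₊, inner ℝ (x N j) w) U
      (𝓝 0) := by
    refine squeeze_zero_norm (fun N => ?_) hrem
    rw [mul_comm S]
    set L : ℝ := (N : ℝ) + 1 with hL
    have hL0 : 0 < L := by positivity
    have hL1 : 1 ≤ L := by simp [hL]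
    set n := ⌊L * S⌋₊ with hn
    have hn1 : (n : ℝ) ≤ L * S := Nat.floor_le (by positivity)
    have hn2 : L * S < n + 1 := Nat.lt_floor_add_one _
    have e1 := integral_step (fun j => inner ℝ (x N j) w) hL0 hS
    simp only [smul_eq_mul] at e1
    rw [e1, ← hn, add_sub_cancel_left, norm_mul]
    have h1 : ‖S - n / L‖ ≤ L⁻¹ := by
      rw [Real.norm_eq_abs, abs_of_nonneg (sub_nonneg.mpr (by rw [div_le_iff₀ hL0]; linarith)),
        sub_le_iff_le_add, inv_eq_one_div, ← add_div, le_div_iff₀ hL0]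
      linarith
    have h2 : ‖inner ℝ (x N n) w‖ ≤ ‖x N n‖ * ‖w‖ := norm_inner_le_norm _ _
    have h3 : L⁻¹ * ‖x N n‖ ^ 2 ≤ C * Real.exp (S + 1) := by
      refine (mul_le_mul_of_nonneg_left ?_ (inv_nonneg.mpr hL0.le)).trans
        ((hx N (n + 1)).trans (mul_le_mul_of_nonneg_left (Real.exp_le_exp.mpr ?_) hC0))
      · rw [Finset.sum_range_succ]
        exact le_add_of_nonneg_left (Finset.sum_nonneg fun _ _ => sq_nonneg _)
      · rw [div_le_iff₀ hL0]
        push_cast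
        nlinarith
    have h4 : L⁻¹ * ‖x N n‖ ≤ √(L⁻¹ * (C * Real.exp (S + 1))) := by
      refine Real.le_sqrt_of_sq_le ?_
      rw [mul_pow, sq L⁻¹, mul_assoc]
      exact mul_le_mul_of_nonneg_left h3 (inv_nonneg.mpr hL0.le)
    calc ‖S - n / L‖ * ‖inner ℝ (x N n) w‖ ≤ L⁻¹ * (‖x N n‖ * ‖w‖) :=
          mul_le_mul h1 h2 (norm_nonneg _) (inv_nonneg.mpr hL0.le)
      _ = L⁻¹ * ‖x N n‖ * ‖w‖ := by ring
      _ ≤ _ := mul_le_mul_of_nonneg_right h4 (norm_nonneg _)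
  have := hweak.sub hdiff
  simpa using this

theorem tendsto_inv_mul_sum_inner_poissonAverage [CompleteSpace H] {f : ℝ → H}
    (hf : ∀ L : ℝ, 0 < L → ∀ n, IntegrableOn (fun t => poissonWeight L n t • f t) (Ioi 0))
    {S : ℝ} (hS : 0 ≤ S) (w : H) :
    Tendsto (fun L : ℝ => L⁻¹ * ∑ j ∈ Finset.range ⌊S * L⌋₊, inner ℝ (poissonAverage f L j) w) atTop
      (𝓝 (∫ t in Ioc 0 S, inner ℝ (f t) w)) := by
  have hq : IntegrableOn (fun t => inner ℝ (f t) w * Real.exp (-(t / 2))) (Ioi 0) := by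
    -- The weight with L = 1/2 and n = 0 is e^{-t/2}.
    refine ((hf (1 / 2) (by norm_num) 0).inner_const w).congr (ae_of_all _ fun t => ?_)
    simp only [poissonWeight_zero, real_inner_smul_left]
    rw [mul_comm, show 1 / 2 * t = t / 2 by ring]
  refine (tendsto_sum_integral_poissonWeight hq hS).congr' ?_
  filter_upwards [eventually_gt_atTop 0] with L hL
  rw [Finset.mul_sum]
  refine Finset.sum_congr rfl fun n _ => ?_
  rw [poissonAverage, real_inner_smul_left, ← mul_assoc, inv_mul_cancel₀ hL.ne', one_mul,
    real_inner_comm, ← integral_inner (hf L hL n)]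
  refine integral_congr_ae (ae_of_all _ fun t => ?_)
  simp only [real_inner_smul_right]
  rw [real_inner_comm, mul_comm]

/-- Uniform convergence lets u be replaced by v at the grid points, since the moments of k involved
have bounded sum. For fixed v the discrete convolution converges by concentration. -/
theorem tendsto_sum_inner_mul_poissonMoment (hU : U ≤ atTop) (hk : IsKernel k) {u : ℕ → ℕ → H}
    {v : ℝ → H} {u₀ : H} (hv : Continuous v) (hv0 : ∀ t ≤ 0, v t = u₀) {M : ℝ}
    (hM : ∀ t, ‖v t - u₀‖ ≤ M)
    {S : ℝ} (hS : 0 ≤ S)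
    (hunif : ∀ ε > 0, ∀ᶠ N : ℕ in U, ∀ t ∈ Icc 0 S, ‖u N ⌊((N : ℝ) + 1) * t⌋₊ - v t‖ ≤ ε) (w : H) :
    Tendsto (fun N : ℕ => ∑ i ∈ Finset.range (⌊S * ((N : ℝ) + 1)⌋₊ + 1),
      inner ℝ (u N (⌊S * ((N : ℝ) + 1)⌋₊ - i) - u₀) w * poissonMoment k ((N : ℝ) + 1) i) U
      (𝓝 (conv k (fun t => inner ℝ (v t - u₀) w) S)) := by
  set K := ∫ t in Ioi (0 : ℝ), k t * Real.exp (-(t / 2)) with hK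
  have hK0 : 0 ≤ K := setIntegral_nonneg measurableSet_Ioi fun t ht =>
    mul_nonneg (hk.nonneg t ht) (Real.exp_nonneg _)
  have hlim := ((hk.tendsto_sum_poissonMoment_mul (w := fun t => inner ℝ (v t - u₀) w)
    (by fun_prop) (fun t ht => by simp only [hv0 t ht, sub_self, inner_zero_left]) (M := M * ‖w‖)
    (fun t => (abs_real_inner_le_norm _ _).trans
      (mul_le_mul_of_nonneg_right (hM t) (norm_nonneg _))) hS).comp
        tendsto_natCast_add_one).mono_left hU
  have hdiff : Tendsto (fun N : ℕ => ∑ i ∈ Finset.range (⌊S * ((N : ℝ) + 1)⌋₊ + 1),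
      inner ℝ (u N (⌊S * ((N : ℝ) + 1)⌋₊ - i) - u₀) w * poissonMoment k ((N : ℝ) + 1) i
      - ∑ i ∈ Finset.range (⌊S * ((N : ℝ) + 1)⌋₊ + 1),
        inner ℝ (v (S - i / ((N : ℝ) + 1)) - u₀) w * poissonMoment k ((N : ℝ) + 1) i) U (𝓝 0) := by
    rw [Metric.tendsto_nhds]
    intro ε hε
    have hB : 0 ≤ ‖w‖ * (Real.exp (S + 1) * K) := by positivity
    filter_upwards [hunif (ε / (‖w‖ * (Real.exp (S + 1) * K) + 1)) (by positivity)] with N hN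
    set L : ℝ := (N : ℝ) + 1 with hL
    have hL0 : 0 < L := by positivity
    have hL1 : 1 ≤ L := by simp [hL]
    set n := ⌊S * L⌋₊ with hn
    have hn1 : (n : ℝ) ≤ S * L := Nat.floor_le (by positivity)
    set δ := ε / (‖w‖ * (Real.exp (S + 1) * K) + 1) with hδ
    have hterm : ∀ i ∈ Finset.range (n + 1),
        ‖inner ℝ (u N (n - i) - u₀) w * poissonMoment k L i
          - inner ℝ (v (S - i / L) - u₀) w * poissonMoment k L i‖
        ≤ δ * ‖w‖ * poissonMoment k L i := by
      intro i hi
      have hi' : i ≤ n := Nat.lt_succ_iff.mp (Finset.mem_range.mp hi)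
      have hi1 : (i : ℝ) ≤ S * L := (Nat.cast_le.mpr hi').trans hn1
      have hfl : ⌊L * (S - i / L)⌋₊ = n - i := by
        rw [mul_sub, mul_div_cancel₀ _ hL0.ne', Nat.floor_sub_natCast, hn, mul_comm S L]
      have h1 := hN (S - i / L) ⟨sub_nonneg.mpr (by rwa [div_le_iff₀ hL0]), by
        rw [sub_le_self_iff]; positivity⟩
      rw [hfl] at h1
      rw [← sub_mul, ← inner_sub_left, sub_sub_sub_cancel_right, norm_mul,
        Real.norm_of_nonneg (hk.poissonMoment_nonneg hL0.le i)]
      refine mul_le_mul_of_nonneg_right ?_ (hk.poissonMoment_nonneg hL0.le i)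
      exact (norm_inner_le_norm _ _).trans (mul_le_mul_of_nonneg_right h1 (norm_nonneg _))
    rw [dist_zero_right, ← Finset.sum_sub_distrib]
    refine (norm_sum_le_of_le _ hterm).trans_lt ?_
    rw [← Finset.mul_sum]
    have h2 : ∑ i ∈ Finset.range (n + 1), poissonMoment k L i ≤ Real.exp (S + 1) * K := by
      refine (hk.sum_poissonMoment_le hL1 (n + 1)).trans
        (mul_le_mul_of_nonneg_right (Real.exp_le_exp.mpr ?_) hK0)
      rw [div_le_iff₀ hL0]
      push_cast
      nlinarith
    calc δ * ‖w‖ * ∑ i ∈ Finset.range (n + 1), poissonMoment k L i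
        ≤ δ * ‖w‖ * (Real.exp (S + 1) * K) := mul_le_mul_of_nonneg_left h2 (by positivity)
      _ = ε * (‖w‖ * (Real.exp (S + 1) * K) / (‖w‖ * (Real.exp (S + 1) * K) + 1)) := by
          rw [hδ]; ring
      _ < ε * 1 := by
          refine mul_lt_mul_of_pos_left ?_ hε
          rw [div_lt_one (by positivity)]
          linarith
      _ = ε := mul_one ε
  have := hdiff.add hlim
  simpa [Function.comp_def] using this

theorem IsKernel.intervalIntegrable_smul {E : Type*} [NormedAddCommGroup E] [NormedSpace ℝ E]
    (hk : IsKernel k) {g : ℝ → E} (hg : Continuous g) {S : ℝ} (hS : 0 ≤ S) :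
    IntervalIntegrable (fun s => k (S - s) • g s) volume 0 S := by
  have h1 : IntervalIntegrable k volume 0 S := by
    rw [intervalIntegrable_iff_integrableOn_Ioc_of_le hS]
    exact hk.integrableOn_Ioc S
  have h2 := (h1.comp_sub_left S).symm
  simp only [sub_self, sub_zero] at h2
  exact h2.smul_continuousOn hg.continuousOn

theorem inner_conv [CompleteSpace H] (hk : IsKernel k) {g : ℝ → H} (hg : Continuous g) {S : ℝ}
    (hS : 0 ≤ S) (w : H) : inner ℝ (conv k g S) w = conv k (fun t => inner ℝ (g t) w) S := by
  have hi := hk.intervalIntegrable_smul hg hS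
  rw [intervalIntegrable_iff_integrableOn_Ioc_of_le hS] at hi
  rw [conv, conv, intervalIntegral.integral_of_le hS, intervalIntegral.integral_of_le hS,
    real_inner_comm, ← integral_inner hi]
  refine integral_congr_ae (ae_of_all _ fun t => ?_)
  simp only [real_inner_smul_right, smul_eq_mul, real_inner_comm]

end Limits

/-! ### From the integrated equation to strong solutions. -/

section StrongSolution

variable {H : Type u} [NormedAddCommGroup H] {φ₁ φ₂ : H → EReal}
  {k l : ℝ → ℝ} {f : ℝ → H} {u₀ : H}

theorem memL2_of_continuousOn {w : ℝ → H} {S : ℝ} (hw : ContinuousOn w (Icc 0 S)) : MemL2 S w := by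
  obtain ⟨C, hC⟩ := isCompact_Icc.exists_bound_of_continuousOn hw
  have hfin : IsFiniteMeasure (volume.restrict (Ioo 0 S)) := ⟨by simp⟩
  refine MemLp.of_bound ((hw.mono Ioo_subset_Icc_self).aestronglyMeasurable measurableSet_Ioo) C ?_
  filter_upwards [ae_restrict_mem measurableSet_Ioo] with t ht using hC t (Ioo_subset_Icc_self ht)

theorem MemL2.integrableOn {w : ℝ → H} {S : ℝ} (hw : MemL2 S w) : IntegrableOn w (Ioc 0 S) := by
  have hfin : IsFiniteMeasure (volume.restrict (Ioo 0 S)) := ⟨by simp⟩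
  rw [integrableOn_Ioc_iff_integrableOn_Ioo]
  exact MemLp.integrable one_le_two hw

theorem memL2Loc_of_memLp_Iic {z : ℝ → H} (hz : ∀ S, MemLp z 2 (volume.restrict (Iic S))) :
    MemL2Loc z := fun S _ =>
  (hz S).mono_measure (Measure.restrict_mono (fun _ h => h.2.le) le_rfl)

/-- The zeroth Poisson moment of ‖f‖² with L = 1 is finite, and its weight e^{-t} is at least e^{-S}
on (0, S). -/
theorem ConjugateKernels.memL2Loc {F : ℝ} (h : ConjugateKernels k l) (hf : StronglyMeasurable f)
    (hF : 0 ≤ F) (hWF : ∀ᵐ t ∂volume.restrict (Ioi 0),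
      ∫⁻ s, extKernel l (t - s) * extKernel (fun t => ‖f t‖ ^ 2) s ≤ ENNReal.ofReal F) :
    MemL2Loc f := by
  intro S hS
  have h1 := h.integrableOn_poissonWeight_mul_norm_sq hf hF hWF one_pos 0
  refine (memLp_two_iff_integrable_sq_norm hf.aestronglyMeasurable).mpr ?_
  refine Integrable.mono' ((h1.mono_set Ioo_subset_Ioi_self).const_mul (Real.exp S))
    (hf.norm.pow 2).aestronglyMeasurable ?_
  filter_upwards [ae_restrict_mem measurableSet_Ioo] with t ht
  rw [Real.norm_of_nonneg (sq_nonneg _), poissonWeight_zero, ← mul_assoc, ← Real.exp_add]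
  exact le_mul_of_one_le_left (sq_nonneg _) (Real.one_le_exp (by linarith [ht.2]))

variable [InnerProductSpace ℝ H]

/-- The identity presents k * (v - u₀) as the primitive, vanishing at 0, of a locally square
integrable function. Continuity, zero trace and weak derivative all follow from this. -/
theorem isGlobalStrongSolution_of_conv_eq [CompleteSpace H] {v ξ η : ℝ → H} (hv : Continuous v)
    (hf : MemL2Loc f) (hξ : MemL2Loc ξ) (hη : MemL2Loc η)
    (hξs : ∀ᵐ t ∂volume.restrict (Ioi 0), ξ t ∈ subdiff φ₁ (v t))
    (hηs : ∀ᵐ t ∂volume.restrict (Ioi 0), η t ∈ subdiff φ₂ (v t))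
    (hconv : ∀ S, 0 < S → conv k (fun t => v t - u₀) S = ∫ t in Ioc 0 S, (f t + η t - ξ t)) :
    IsGlobalStrongSolution φ₁ φ₂ k u₀ f v := by
  have hgL : MemL2Loc fun t => f t + η t - ξ t := fun S hS =>
    ((hf S hS).add (hη S hS)).sub (hξ S hS)
  have hgi : ∀ S, IntegrableOn (fun t => f t + η t - ξ t) (Ioc 0 S) := fun S => by
    rcases le_or_gt S 0 with h | h
    · rw [Ioc_eq_empty (not_lt.mpr h)]; exact integrableOn_empty
    · exact (hgL S h).integrableOn
  have hcc : ∀ S, ContinuousOn (conv k fun t => v t - u₀) (Icc 0 S) := fun S => by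
    refine (intervalIntegral.continuousOn_primitive (μ := volume) (f := fun t => f t + η t - ξ t)
      (a := 0) (b := S) ?_).congr fun t ht => ?_
    · rw [integrableOn_Icc_iff_integrableOn_Ioc]; exact hgi S
    · rcases ht.1.eq_or_lt with h | h
      · subst h; simp [conv]
      · exact hconv t h
  refine ⟨fun S _ => memL2_of_continuousOn hv.continuousOn, fun S _ => memL2_of_continuousOn
    (hcc S),
    fun S _ => ⟨_, hcc S, EventuallyEq.rfl, by simp [conv]⟩, ?_, fun t => f t + η t - ξ t, ξ, η,
      hgL,
    isWeakDeriv_of_eq_integral hgi hconv, hξ, hη, ?_⟩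
  · filter_upwards [hξs, hηs] with t h1 h2 using ⟨⟨h1.1, _, h1⟩, ⟨h2.1, _, h2⟩⟩
  · filter_upwards [hξs, hηs] with t h1 h2 using ⟨h1, h2, by abel⟩

end StrongSolution

/-! ### Compactness and the global solution. -/

section Compactness

variable {H : Type u} [NormedAddCommGroup H] [InnerProductSpace ℝ H] {φ₁ φ₂ : H → EReal}
  {k l : ℝ → ℝ} {f : ℝ → H} {u₀ : H} {R G : ℝ} {u ξ η : ℕ → ℕ → H}

/-- Arzelà–Ascoli along an ultrafilter. Two versions of uniform convergence are needed because ξ n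
is a subgradient at u (n + 1), while η n is one at u n; they differ by a time shift 1/L. -/
theorem exists_continuous_limit (h₁ : ProperConvexLSC φ₁) (hc : PrecompactSublevels φ₁)
    (hkl : ConjugateKernels k l)
    (hD : ∀ N : ℕ, IsDiscreteSolution φ₁ φ₂ (poissonMoment l ((N : ℝ) + 1))
      (poissonAverage f ((N : ℝ) + 1)) u₀ R G (u N) (ξ N) (η N))
    {U : Ultrafilter ℕ} (hU : (U : Filter ℕ) ≤ atTop) :
    ∃ v : ℝ → H, Continuous v ∧ (∀ t ≤ 0, v t = u₀) ∧ (∀ t, φ₁ (v t) ≤ (R : EReal)) ∧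
      (∃ M, ∀ t, ‖v t - u₀‖ ≤ M) ∧
      (∀ S, ∀ ε > 0, ∀ᶠ N : ℕ in (U : Filter ℕ), ∀ t ∈ Icc 0 S,
        ‖u N ⌊((N : ℝ) + 1) * t⌋₊ - v t‖ ≤ ε) ∧
      (∀ S, ∀ ε > 0, ∀ᶠ N : ℕ in (U : Filter ℕ), ∀ t ∈ Icc 0 S,
        ‖u N (⌊((N : ℝ) + 1) * t⌋₊ + 1) - v t‖ ≤ ε) := by
  have hlim : ∀ t : ℝ, ∃ y ∈ closure {w | φ₁ w ≤ (R : EReal)},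
      Tendsto (fun N : ℕ => u N ⌊((N : ℝ) + 1) * t⌋₊) U (𝓝 y) := fun t =>
    (hc R).ultrafilter_le_nhds (U.map fun N : ℕ => u N ⌊((N : ℝ) + 1) * t⌋₊)
      (le_principal_iff.mpr (Filter.univ_mem' (f := (U : Filter ℕ))
        fun N => subset_closure ((hD N).bound _)))
  choose v hvR hpt using hlim
  have heq : ∀ ε > 0, ∃ δ > 0, ∀ᶠ N : ℕ in (U : Filter ℕ), ∀ s t : ℝ, |s - t| < δ →
      ‖u N ⌊((N : ℝ) + 1) * s⌋₊ - u N ⌊((N : ℝ) + 1) * t⌋₊‖ ≤ ε := fun ε hε => by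
    obtain ⟨δ, hδ, h⟩ := asymptotically_equicontinuous_step hkl hD hε
    exact ⟨δ, hδ, h.filter_mono hU⟩
  have hcl : IsClosed {w | φ₁ w ≤ (R : EReal)} := h₁.lsc.isClosed_preimage R
  have hunif : ∀ S, ∀ ε > 0, ∀ᶠ N : ℕ in (U : Filter ℕ), ∀ t ∈ Icc 0 S,
      ‖u N ⌊((N : ℝ) + 1) * t⌋₊ - v t‖ ≤ ε := fun S ε hε =>
    eventually_forall_norm_sub_le hpt heq S hε
  refine ⟨v, continuous_of_asymptotically_equicontinuous hpt heq, fun t ht => ?_, fun t => ?_, ?_,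
    hunif, fun S ε hε => ?_⟩
  · refine tendsto_nhds_unique (hpt t) ?_
    have : ∀ N : ℕ, u N ⌊((N : ℝ) + 1) * t⌋₊ = u₀ := fun N => by
      rw [Nat.floor_of_nonpos (mul_nonpos_of_nonneg_of_nonpos (by positivity) ht), (hD N).zero]
    simp only [this]
    exact tendsto_const_nhds
  · exact (hcl.closure_eq ▸ hvR t : v t ∈ {w | φ₁ w ≤ (R : EReal)})
  · obtain ⟨B, hB⟩ := (hc R).isBounded.exists_norm_le
    exact ⟨B + ‖u₀‖, fun t => (norm_sub_le _ _).trans (by gcongr; exact hB _ (hvR t))⟩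
  · obtain ⟨δ, hδ, h⟩ := heq (ε / 2) (by positivity)
    have h2 : ∀ᶠ N : ℕ in (U : Filter ℕ), δ⁻¹ < (N : ℝ) + 1 :=
      (tendsto_natCast_add_one.eventually_gt_atTop δ⁻¹).filter_mono hU
    filter_upwards [h, h2, hunif S (ε / 2) (by positivity)] with N hN1 hN2 hN3 t ht
    have hL0 : (0 : ℝ) < (N : ℝ) + 1 := by positivity
    have h3 := hN1 (t + ((N : ℝ) + 1)⁻¹) t (by
      rw [add_sub_cancel_left, abs_of_pos (inv_pos.mpr hL0)]
      exact inv_lt_of_inv_lt₀ hδ hN2)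
    rw [mul_add, mul_inv_cancel₀ hL0.ne', Nat.floor_add_one (mul_nonneg hL0.le ht.1)] at h3
    calc _ = ‖(u N (⌊((N : ℝ) + 1) * t⌋₊ + 1) - u N ⌊((N : ℝ) + 1) * t⌋₊)
          + (u N ⌊((N : ℝ) + 1) * t⌋₊ - v t)‖ := by rw [sub_add_sub_cancel]
      _ ≤ ε / 2 + ε / 2 := (norm_add_le _ _).trans (add_le_add h3 (hN3 t ht))
      _ = ε := add_halves ε

/-- Weak limits of the step functions of a sequence with the discrete weighted bound. -/
theorem exists_subgradient_limit [CompleteSpace H] {φ : H → EReal} (hφ : ProperConvexLSC φ)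
    {U : Ultrafilter ℕ} (hU : (U : Filter ℕ) ≤ atTop) {x : ℕ → ℕ → H} {C : ℝ} (hC0 : 0 ≤ C)
    (hx : ∀ N m : ℕ, ((N : ℝ) + 1)⁻¹ * ∑ j ∈ Finset.range m, ‖x N j‖ ^ 2
      ≤ C * Real.exp (m / ((N : ℝ) + 1))) {v : ℝ → H} (hv : Continuous v) {y : ℕ → ℝ → H}
    (hunif : ∀ S, ∀ ε > 0, ∀ᶠ N : ℕ in (U : Filter ℕ), ∀ t ∈ Icc 0 S, ‖y N t - v t‖ ≤ ε)
    (hmem : ∀ t₀ > 0, ∀ᶠ N : ℕ in (U : Filter ℕ), ∀ t ≥ t₀,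
      x N ⌊((N : ℝ) + 1) * t⌋₊ ∈ subdiff φ (y N t)) :
    ∃ z : ℝ → H, MemL2Loc z ∧ (∀ᵐ t ∂volume.restrict (Ioi 0), z t ∈ subdiff φ (v t)) ∧
      ∀ S, 0 ≤ S → ∀ w, Tendsto (fun N : ℕ => ((N : ℝ) + 1)⁻¹ *
        ∑ j ∈ Finset.range ⌊S * ((N : ℝ) + 1)⌋₊, inner ℝ (x N j) w) U
        (𝓝 (∫ t in Ioc 0 S, inner ℝ (z t) w)) := by
  have hL1 : ∀ N : ℕ, (1 : ℝ) ≤ (N : ℝ) + 1 := fun N => by simp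
  have hD0 : 0 ≤ C * Real.exp 2 * ∑' i : ℕ, Real.exp (-1) ^ i :=
    mul_nonneg (by positivity) (tsum_nonneg fun i => by positivity)
  have hb : ∀ N : ℕ, _ := fun N => lintegral_exp_smul_step_le hC0 (hL1 N) (hx N)
  have hsm : ∀ N : ℕ, _ := fun N => stronglyMeasurable_step (x N) ((N : ℝ) + 1)
  obtain ⟨z, -, -, hz, hweak⟩ := exists_weak_limit_weighted U hsm hD0 hb
  refine ⟨z, memL2Loc_of_memLp_Iic hz, ae_mem_subdiff_of_tendsto hφ hv hunif
    (fun N S => (integrableOn_of_lintegral_exp_smul_le (hsm N) (hb N) hD0 S).1)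
    (fun S => ⟨_, fun N => (integrableOn_of_lintegral_exp_smul_le (hsm N) (hb N) hD0 S).2⟩)
    hz hweak hmem, fun S hS w => ?_⟩
  have hfin : IsFiniteMeasure (volume.restrict (Ioc 0 S)) := ⟨by simp⟩
  exact tendsto_inv_mul_sum_inner hU hx hC0 hS w (hweak (fun _ => w) S (memLp_const w))

theorem exists_global_solution [CompleteSpace H]
    (h₁ : ProperConvexLSC φ₁) (h₂ : ProperConvexLSC φ₂) (hnn : ∀ w, 0 ≤ φ₁ w)
    (hc : PrecompactSublevels φ₁) (hdom : subdiffDom φ₁ ⊆ subdiffDom φ₂) {ν ρ : ℝ} (hν₀ : 0 ≤ ν)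
    (hν₁ : ν < 1)
    (hgrowth : ∀ w ∈ subdiffDom φ₁, φ₁ w ≤ (ρ : EReal) →
      ‖minSection φ₂ w‖ ≤ ν * ‖minSection φ₁ w‖)
    (hkl : ConjugateKernels k l) (hf : StronglyMeasurable f) {F : ℝ} (hF : 0 ≤ F)
    (hWF : ∀ᵐ t ∂volume.restrict (Ioi 0),
      ∫⁻ s, extKernel l (t - s) * extKernel (fun t => ‖f t‖ ^ 2) s ≤ ENNReal.ofReal F)
    (hu₀ : u₀ ∈ effDom φ₁) {Q : ℝ} (hQ : (φ₁ u₀).toReal + F / (2 * (1 - ν)) ≤ Q)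
    (hQρ : Q / (1 - ν) ≤ ρ) :
    ∃ v : ℝ → H, Continuous v ∧ v 0 = u₀ ∧ (∀ t, φ₁ (v t) ≤ ((Q / (1 - ν) : ℝ) : EReal)) ∧
      IsGlobalStrongSolution φ₁ φ₂ k u₀ f v := by
  have hLpos : ∀ N : ℕ, (0 : ℝ) < (N : ℝ) + 1 := fun N => by positivity
  have hL1 : ∀ N : ℕ, (1 : ℝ) ≤ (N : ℝ) + 1 := fun N => by simp
  have hdata : ∀ (L : ℝ), 0 < L → ∀ n, _ := fun L hL n =>
    hkl.sum_mul_norm_poissonAverage_sq_le hf hF hWF hL n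
  have h1ν : 0 < 1 - ν := by linarith
  have hφ0 : 0 ≤ (φ₁ u₀).toReal := EReal.toReal_nonneg (hnn u₀)
  have hQ0 : 0 ≤ Q := le_trans (by positivity) hQ
  have hDN : ∀ N : ℕ, ∃ u ξ η : ℕ → H, IsDiscreteSolution φ₁ φ₂ (poissonMoment l ((N : ℝ) + 1))
      (poissonAverage f ((N : ℝ) + 1)) u₀ (Q / (1 - ν)) (F + 2 * Q / (1 - ν)) u ξ η := fun N => by
    obtain ⟨u, ξ, η, e1, e2, e3, e4, e5, e6, e7⟩ := exists_discrete_solution h₁ h₂ hnn hc hdom hν₀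
      hν₁
      hgrowth (hkl.conjugateSequences (hLpos N)) (hdata _ (hLpos N)) hu₀ hQ hQρ
    exact ⟨u, ξ, η, e1, e2, e3, e4, e5, fun n => (e6 n).trans (by linarith),
      fun n => (e7 n).trans (by linarith),
      fun n => (hdata _ (hLpos N) n).trans (le_add_of_nonneg_right (by positivity))⟩
  choose u ξ η hD using hDN
  set U : Ultrafilter ℕ := hyperfilter ℕ
  have hU : (U : Filter ℕ) ≤ atTop := Nat.hyperfilter_le_atTop
  obtain ⟨v, hv, hv0, hvR, ⟨M, hM⟩, hun, hun1⟩ := exists_continuous_limit h₁ hc hkl hD hU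
  obtain ⟨C, hC0, hC⟩ := hkl.inv_mul_sum_norm_sq_le (E := H)
    (show 0 ≤ F + 2 * Q / (1 - ν) by positivity)
  obtain ⟨zξ, hξL, hξs, hξ⟩ := exists_subgradient_limit h₁ hU hC0
    (fun N m => hC _ (hL1 N) (ξ N) (hD N).left_sq m) hv hun1
    (fun t₀ _ => Eventually.of_forall fun N t _ => (hD N).left _)
  obtain ⟨zη, hηL, hηs, hη⟩ := exists_subgradient_limit h₂ hU hC0
    -- η 0 need not be a subgradient. For t ≥ t₀ and L ≥ 1/t₀ the index ⌊L t⌋ is at least 1.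
    (fun N m => hC _ (hL1 N) (η N) (hD N).right_sq m) hv hun (fun t₀ ht₀ => by
      filter_upwards [(tendsto_natCast_add_one.eventually_ge_atTop t₀⁻¹).filter_mono hU]
        with N hN t ht
      have h1 : 1 ≤ ⌊((N : ℝ) + 1) * t⌋₊ := by
        rw [Nat.one_le_floor_iff]
        calc (1 : ℝ) = t₀⁻¹ * t₀ := (inv_mul_cancel₀ ht₀.ne').symm
          _ ≤ _ := mul_le_mul hN ht ht₀.le (hLpos N).le
      obtain ⟨n, hn⟩ := Nat.exists_eq_add_of_le' h1
      rw [hn]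
      exact (hD N).right n)
  have hfL := hkl.memL2Loc hf hF hWF
  refine ⟨v, hv, hv0 0 le_rfl, hvR, isGlobalStrongSolution_of_conv_eq hv hfL hξL hηL hξs hηs
    fun S hS => ext_inner_right ℝ fun w => ?_⟩
  have hif := (hfL S hS).integrableOn
  have hiη := (hηL S hS).integrableOn
  have hiξ := (hξL S hS).integrableOn
  have hint : Integrable (fun t => f t + zη t - zξ t) (volume.restrict (Ioc 0 S)) :=
    (hif.add hiη).sub hiξ
  -- By `sum_inner_eq` both limits concern the same sequence, so uniqueness of limits gives the
  -- integrated equation tested with w.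
  have hlim1 := tendsto_sum_inner_mul_poissonMoment hU hkl.isKernel_left hv hv0 hM hS.le (hun S) w
  have hlim2 := ((((tendsto_inv_mul_sum_inner_poissonAverage
    (fun L hL n => hkl.integrableOn_poissonWeight_smul hf hF hWF hL n) hS.le w).comp
    tendsto_natCast_add_one).mono_left hU).add (hη S hS.le w)).sub (hξ S hS.le w)
  rw [inner_conv hkl.isKernel_left (by fun_prop) hS.le,
    tendsto_nhds_unique hlim1 (hlim2.congr fun N => by
      rw [← (hD N).sum_inner_eq hkl (hLpos N)]
      simp only [Function.comp_apply, inner_sub_left, inner_add_left, Finset.sum_sub_distrib,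
        Finset.sum_add_distrib]
      ring), real_inner_comm,
    ← integral_inner hint, ← integral_add (hif.inner_const w) (hiη.inner_const w),
    ← integral_sub ((hif.inner_const w).add (hiη.inner_const w)) (hiξ.inner_const w)]
  refine integral_congr_ae (ae_of_all _ fun t => ?_)
  simp only [inner_sub_right, inner_add_right, real_inner_comm w]

end Compactness

/-! ### The essential norm of l * ‖f‖² and cutting off the data. -/

section DataNorm

variable {E : Type*} [NormedAddCommGroup E] {f : ℝ → E} {l : ℝ → ℝ}

theorem IsKernel.lintegral_eq_enorm_conv (hl : IsKernel l) (hf : StronglyMeasurable f) {t : ℝ}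
    (ht : 0 ≤ t)
    (h : ∫⁻ s, extKernel l (t - s) * extKernel (fun t => ‖f t‖ ^ 2) s < ⊤) :
    ∫⁻ s, extKernel l (t - s) * extKernel (fun t => ‖f t‖ ^ 2) s
      = ‖conv l (fun t => ‖f t‖ ^ 2) t‖ₑ := by
  have hm : Measurable fun s => extKernel l (t - s) * extKernel (fun t => ‖f t‖ ^ 2) s :=
    (hl.measurable_extKernel.comp (measurable_const.sub measurable_id)).mul
      (measurable_extKernel_norm_sq hf)
  have hi : IntervalIntegrable (fun s => l (t - s) * ‖f s‖ ^ 2) volume 0 t := by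
    rw [intervalIntegrable_iff_integrableOn_Ioo_of_le ht]
    refine (integrable_toReal_of_lintegral_ne_top hm.aemeasurable h.ne).integrableOn.congr ?_
    filter_upwards [ae_restrict_mem measurableSet_Ioo] with s hs
    have h1 : t - s ∈ Ioi (0 : ℝ) := sub_pos.mpr hs.2
    have h2 : s ∈ Ioi (0 : ℝ) := hs.1
    simp only [extKernel, Set.indicator_of_mem h1, Set.indicator_of_mem h2]
    rw [ENNReal.toReal_mul, ENNReal.toReal_ofReal (hl.nonneg _ h1),
      ENNReal.toReal_ofReal (sq_nonneg _)]
  rw [lintegral_extKernel_conv l _ ht hl.nonneg (fun _ _ => sq_nonneg _) hi,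
    Real.enorm_eq_ofReal]
  rw [conv, intervalIntegral.integral_of_le ht, integral_Ioc_eq_integral_Ioo]
  refine setIntegral_nonneg measurableSet_Ioo fun s hs => ?_
  exact mul_nonneg (hl.nonneg _ (sub_pos.mpr hs.2)) (sq_nonneg _)

theorem lintegral_Iio_extKernel_norm_sq_lt_top {H : Type*} [NormedAddCommGroup H] {f : ℝ → H}
    (hfL : MemL2Loc f) (R : ℝ) : ∫⁻ s in Iio R, extKernel (fun t => ‖f t‖ ^ 2) s < ⊤ := by
  rw [extKernel, setLIntegral_indicator measurableSet_Ioi, Ioi_inter_Iio]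
  rcases le_or_gt R 0 with h | h
  · simp [Ioo_eq_empty (not_lt.mpr h)]
  · exact ((hfL R h).integrable_norm_pow (by norm_num)).lintegral_lt_top

theorem IsKernel.lintegral_Iio_extKernel_lt_top (hl : IsKernel l) (R : ℝ) :
    ∫⁻ s in Iio R, extKernel l s < ⊤ := by
  rw [extKernel, setLIntegral_indicator measurableSet_Ioi, Ioi_inter_Iio]
  exact ((hl.integrableOn_Ioc R).mono_set Ioo_subset_Ioc_self).lintegral_lt_top

/-- Tonelli for two functions integrable up to time n. Finiteness must be known separately: where
the integral diverges, `conv` has the default value 0 and its norm would not detect this. -/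
theorem IsKernel.ae_lintegral_lt_top (hl : IsKernel l) (hf : StronglyMeasurable f)
    (hfL : MemL2Loc f) :
    ∀ᵐ t : ℝ, ∫⁻ s, extKernel l (t - s) * extKernel (fun t => ‖f t‖ ^ 2) s < ⊤ := by
  set W := extKernel fun t => ‖f t‖ ^ 2 with hWdef
  have hW : Measurable W := measurable_extKernel_norm_sq hf
  have hK := hl.measurable_extKernel
  have hA : Measurable fun t => ∫⁻ s, extKernel l (t - s) * W s := by
    refine Measurable.lintegral_prod_right' (f := fun p : ℝ × ℝ => extKernel l (p.1 - p.2) * W p.2)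
      ?_
    fun_prop
  have key : ∀ n : ℕ, ∀ᵐ t : ℝ, t < n → ∫⁻ s, extKernel l (t - s) * W s < ⊤ := by
    intro n
    have hΘ : Measurable ((Iio (n : ℝ)).indicator (1 : ℝ → ℝ≥0∞)) :=
      measurable_one.indicator measurableSet_Iio
    have h1 : ∫⁻ t, (∫⁻ s, extKernel l (t - s) * W s) * (Iio (n : ℝ)).indicator 1 t < ⊤ := by
      rw [lintegral_conv_mul hK hW hΘ]
      refine lt_of_le_of_lt (lintegral_mono fun s => lintegral_mono fun r => ?_ :
        _ ≤ ∫⁻ s, ∫⁻ r, (Iio (n : ℝ)).indicator W s * (Iio (n : ℝ)).indicator (extKernel l) r) ?_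
      · rcases le_or_gt r 0 with hr | hr
        · simp [extKernel_of_nonpos l r hr]
        rcases le_or_gt s 0 with hs | hs
        · simp [hWdef, extKernel_of_nonpos _ s hs]
        by_cases h : r + s < n
        · rw [Set.indicator_of_mem (show r + s ∈ Iio (n : ℝ) from h),
            Set.indicator_of_mem (show s ∈ Iio (n : ℝ) from by simp only [mem_Iio]; linarith),
            Set.indicator_of_mem (show r ∈ Iio (n : ℝ) from by simp only [mem_Iio]; linarith)]
          simp [mul_comm]
        · rw [Set.indicator_of_notMem (show r + s ∉ Iio (n : ℝ) from h), mul_zero]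
          exact zero_le
      · rw [lintegral_lintegral_mul (hW.indicator measurableSet_Iio).aemeasurable
          (hK.indicator measurableSet_Iio).aemeasurable, lintegral_indicator measurableSet_Iio,
          lintegral_indicator measurableSet_Iio]
        exact ENNReal.mul_lt_top (lintegral_Iio_extKernel_norm_sq_lt_top hfL _)
          (hl.lintegral_Iio_extKernel_lt_top _)
    filter_upwards [ae_lt_top (hA.mul hΘ) h1.ne] with t ht htn
    simpa [Set.indicator_of_mem (show t ∈ Iio (n : ℝ) from htn)] using ht
  filter_upwards [ae_all_iff.mpr key] with t ht
  obtain ⟨n, hn⟩ := exists_nat_gt t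
  exact ht n hn

theorem IsKernel.ae_lintegral_eq_enorm_conv (hl : IsKernel l) (hf : StronglyMeasurable f)
    (hfL : MemL2Loc f) :
    ∀ᵐ t ∂volume.restrict (Ioi 0),
      ∫⁻ s, extKernel l (t - s) * extKernel (fun t => ‖f t‖ ^ 2) s
        = ‖conv l (fun t => ‖f t‖ ^ 2) t‖ₑ := by
  filter_upwards [ae_restrict_of_ae (hl.ae_lintegral_lt_top hf hfL),
    ae_restrict_mem measurableSet_Ioi] with t h1 h2
  exact hl.lintegral_eq_enorm_conv hf (le_of_lt h2) h1

theorem conv_congr_ae {F : Type*} [NormedAddCommGroup F] [NormedSpace ℝ F] {w w' : ℝ → F} {T t : ℝ}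
    (htT : t ≤ T) (h : w =ᵐ[volume.restrict (Ioo 0 T)] w') (ht : 0 ≤ t) :
    conv l w t = conv l w' t := by
  rw [conv, conv, intervalIntegral.integral_of_le ht, intervalIntegral.integral_of_le ht,
    integral_Ioc_eq_integral_Ioo, integral_Ioc_eq_integral_Ioo]
  refine integral_congr_ae ?_
  filter_upwards [ae_restrict_of_ae_restrict_of_subset (Ioo_subset_Ioo_right htT) h] with s hs
  rw [hs]

theorem MemL2Loc.aestronglyMeasurable (hf : MemL2Loc f) :
    AEStronglyMeasurable f (volume.restrict (Ioi 0)) := by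
  have : Ioi (0 : ℝ) = ⋃ n : ℕ, Ioo 0 ((n : ℝ) + 1) := by
    ext t
    simp only [mem_Ioi, mem_iUnion, mem_Ioo]
    refine ⟨fun h => ?_, fun ⟨_, h⟩ => h.1⟩
    obtain ⟨n, hn⟩ := exists_nat_gt t
    exact ⟨n, h, by linarith⟩
  rw [this, aestronglyMeasurable_iUnion_iff]
  exact fun n => MemLp.aestronglyMeasurable (hf _ (by positivity))

theorem MemL2Loc.congr {f' : ℝ → E} (hf : MemL2Loc f) (h : f =ᵐ[volume.restrict (Ioi 0)] f') :
    MemL2Loc f' := fun S hS =>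
  (memLp_congr_ae (ae_restrict_of_ae_restrict_of_subset Ioo_subset_Ioi_self h)).mp (hf S hS)

/-- Cutting off the data after time `T` does not increase its norm, as `l` is nonincreasing. -/
theorem IsKernel.eLpNorm_conv_indicator_le (hl : IsKernel l) {T : ℝ} (hT : 0 < T) (hf : MemL2 T f) :
    eLpNorm (conv l fun t => ‖(Ioo 0 T).indicator f t‖ ^ 2) ⊤ (volume.restrict (Ioi 0))
      ≤ eLpNorm (conv l fun t => ‖f t‖ ^ 2) ⊤ (volume.restrict (Ioo 0 T)) := by
  set N := eLpNorm (conv l fun t => ‖f t‖ ^ 2) ⊤ (volume.restrict (Ioo 0 T)) with hN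
  obtain ⟨g, hg, hfg⟩ := (MemLp.aestronglyMeasurable hf)
  set h : ℝ → E := (Ioo 0 T).indicator g with hh
  have hhm : StronglyMeasurable h := hg.indicator measurableSet_Ioo
  have hhL : MemL2Loc h := fun S _ =>
    ((memLp_indicator_iff_restrict measurableSet_Ioo).mpr
      ((memLp_congr_ae hfg).mp hf)).mono_measure Measure.restrict_le_self
  have hfh : (Ioo 0 T).indicator f =ᵐ[volume] h :=
    (ae_eq_restrict_iff_indicator_ae_eq measurableSet_Ioo).mp hfg
  set W := extKernel fun t => ‖h t‖ ^ 2 with hW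
  have hWT : ∀ s, T ≤ s → W s = 0 := fun s hs => by
    have : h s = 0 := Set.indicator_of_notMem (fun hs' => (not_lt.mpr hs) hs'.2) _
    simp [hW, extKernel, Set.indicator, this]
  have hcongr : (fun t => ‖f t‖ ^ 2) =ᵐ[volume.restrict (Ioo 0 T)] fun t => ‖h t‖ ^ 2 := by
    filter_upwards [ae_restrict_of_ae hfh, ae_restrict_mem measurableSet_Ioo] with t h1 h2
    rw [← h1, Set.indicator_of_mem h2]
  have hgood : ∀ᵐ t ∂volume.restrict (Ioo 0 T), ∫⁻ s, extKernel l (t - s) * W s ≤ N := by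
    filter_upwards [ae_restrict_of_ae_restrict_of_subset Ioo_subset_Ioi_self
      (hl.ae_lintegral_eq_enorm_conv hhm hhL), ae_restrict_mem measurableSet_Ioo,
      ae_le_eLpNormEssSup (f := conv l fun t => ‖f t‖ ^ 2) (μ := volume.restrict (Ioo 0 T))]
      with t h1 h2 h3
    rw [hW, h1, ← conv_congr_ae h2.2.le hcongr h2.1.le, hN, eLpNorm_exponent_top]
    exact h3
  -- The data vanish after T. Exhaust s < T by s < c with c < T and compare with a good time t'
  -- between c and T: as t' < t, the nonincreasing kernel is larger at t' - s.
  have hlate : ∀ t, T ≤ t → ∫⁻ s, extKernel l (t - s) * W s ≤ N := by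
    intro t ht
    have hU : (⋃ n : ℕ, Iio (T - 1 / ((n : ℝ) + 1))) = Iio T := by
      ext s
      simp only [mem_iUnion, mem_Iio]
      refine ⟨fun ⟨n, hn⟩ => hn.trans_le (sub_le_self _ (by positivity)), fun hs => ?_⟩
      obtain ⟨n, hn⟩ := exists_nat_one_div_lt (sub_pos.mpr hs)
      exact ⟨n, by linarith⟩
    have hmono : Monotone fun n : ℕ => Iio (T - 1 / ((n : ℝ) + 1)) := fun a b hab =>
      Iio_subset_Iio (sub_le_sub_left (one_div_le_one_div_of_le (by positivity) (by gcongr)) _)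
    have hsplit : ∫⁻ s, extKernel l (t - s) * W s = ∫⁻ s in Iio T, extKernel l (t - s) * W s := by
      rw [← lintegral_indicator measurableSet_Iio]
      refine lintegral_congr fun s => ?_
      by_cases hs : s ∈ Iio T
      · rw [Set.indicator_of_mem hs]
      · rw [Set.indicator_of_notMem hs, hWT s (not_lt.mp hs), mul_zero]
    rw [hsplit, ← hU, setLIntegral_iUnion_of_directed _ hmono.directed_le]
    refine iSup_le fun n => ?_
    set c := T - 1 / ((n : ℝ) + 1) with hc
    have hcT : c < T := sub_lt_self _ (by positivity)
    obtain ⟨t', ht', htN⟩ := Measure.exists_mem_of_measure_ne_zero_of_ae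
      (s := Ioo (max c 0) T) (by simp [hcT, hT])
      (ae_restrict_of_ae_restrict_of_subset (Ioo_subset_Ioo_left (le_max_right _ _)) hgood)
    refine le_trans ?_ htN
    refine (setLIntegral_mono' measurableSet_Iio fun s hs => ?_).trans
      (setLIntegral_le_lintegral _ _)
    have hs1 : s < t' := lt_trans hs ((le_max_left _ _).trans_lt ht'.1)
    have hs2 : t' - s ∈ Ioi (0 : ℝ) := sub_pos.mpr hs1
    have hs3 : t - s ∈ Ioi (0 : ℝ) := sub_pos.mpr (hs1.trans (ht'.2.trans_le ht))
    refine mul_le_mul_left ?_ _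
    rw [extKernel, Set.indicator_of_mem hs2, Set.indicator_of_mem hs3]
    exact ENNReal.ofReal_le_ofReal (hl.anti hs2 hs3 (by linarith [ht'.2]))
  rw [eLpNorm_exponent_top]
  refine eLpNormEssSup_le_of_ae_enorm_bound ?_
  have hgood' := (ae_restrict_iff' measurableSet_Ioo).mp hgood
  filter_upwards [hl.ae_lintegral_eq_enorm_conv hhm hhL, ae_restrict_of_ae hgood',
    ae_restrict_mem measurableSet_Ioi] with t h1 h2 h3
  rw [conv_congr_ae (w' := fun t => ‖h t‖ ^ 2) le_rfl
    (ae_restrict_of_ae (hfh.mono fun s hs => by simp only [hs])) (le_of_lt h3), ← h1]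
  rcases lt_or_ge t T with h4 | h4
  · exact h2 ⟨h3, h4⟩
  · exact hlate t h4

end DataNorm

/-! ### Reduction to the energy condition, and restriction to finite intervals. -/

section Reduction

variable {H : Type u} [NormedAddCommGroup H] [InnerProductSpace ℝ H] {φ₁ φ₂ : H → EReal}
  {k l : ℝ → ℝ} {f : ℝ → H} {u₀ : H}

theorem IsGlobalStrongSolution.congr_data {f' v : ℝ → H}
    (h : IsGlobalStrongSolution φ₁ φ₂ k u₀ f v) (hff' : f =ᵐ[volume.restrict (Ioi 0)] f') :
    IsGlobalStrongSolution φ₁ φ₂ k u₀ f' v := by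
  obtain ⟨h1, h2, h3, h4, g, ξ, η, h5, h6, h7, h8, h9⟩ := h
  refine ⟨h1, h2, h3, h4, g, ξ, η, h5, h6, h7, h8, ?_⟩
  filter_upwards [h9, hff'] with t ht htf
  rwa [← htf]

theorem IsWeakDeriv.restrict {I J : Set ℝ} (hJ : MeasurableSet J) (hIJ : I ⊆ J) {v g : ℝ → H}
    (h : IsWeakDeriv J v g) : IsWeakDeriv I v g := by
  intro ψ hψ hψc hψs
  have h1 := h ψ hψ hψc (hψs.trans hIJ)
  rwa [setIntegral_eq_of_subset_of_forall_sdiff_eq_zero hJ hIJ fun t ht => ?_,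
    setIntegral_eq_of_subset_of_forall_sdiff_eq_zero hJ hIJ fun t ht => ?_] at h1
  · rw [image_eq_zero_of_notMem_tsupport fun h' => ht.2 (hψs h'), zero_smul]
  · rw [image_eq_zero_of_notMem_tsupport fun h' => ht.2 (hψs (tsupport_deriv_subset h')), zero_smul]

theorem IsGlobalStrongSolution.isStrongSolution {v : ℝ → H} {T : ℝ} (hT : 0 < T)
    (h : IsGlobalStrongSolution φ₁ φ₂ k u₀ ((Ioo 0 T).indicator f) v) :
    IsStrongSolution φ₁ φ₂ k u₀ f T v := by
  obtain ⟨h1, h2, h3, h4, g, ξ, η, h5, h6, h7, h8, h9⟩ := h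
  refine ⟨h1 T hT, h2 T hT, h3 T hT, ae_restrict_of_ae_restrict_of_subset Ioo_subset_Ioi_self h4,
    g, ξ, η, h5 T hT, h6.restrict measurableSet_Ioi Ioo_subset_Ioi_self, h7 T hT, h8 T hT, ?_⟩
  filter_upwards [ae_restrict_of_ae_restrict_of_subset Ioo_subset_Ioi_self h9,
    ae_restrict_mem measurableSet_Ioo] with t ht1 ht2
  rwa [Set.indicator_of_mem ht2] at ht1

theorem memLInfty_of_continuous (h₁ : ProperConvexLSC φ₁) (hnn : ∀ w, 0 ≤ φ₁ w) {v : ℝ → H}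
    (hv : Continuous v) {R : ℝ} (hR : ∀ t, φ₁ (v t) ≤ (R : EReal)) (I : Set ℝ) :
    MemLInfty I fun t => φ₁ (v t) := by
  have hlt : ∀ t, φ₁ (v t) < ⊤ := fun t => (hR t).trans_lt (EReal.coe_lt_top R)
  refine ⟨ae_of_all _ fun t => ⟨(hlt t).ne, h₁.ne_bot _⟩, ?_⟩
  refine memLp_top_of_bound (LowerSemicontinuous.comp h₁.lsc
    hv).measurable.ereal_toReal.aestronglyMeasurable
    R (ae_of_all _ fun t => ?_)
  rw [Real.norm_of_nonneg (EReal.toReal_nonneg (hnn _)), ← EReal.coe_le_coe_iff,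
    h₁.coe_toReal (hlt t)]
  exact hR t

theorem dataEnergy_eq_coe (h₁ : ProperConvexLSC φ₁) {I : Set ℝ} {δ : ℝ} (hu₀ : u₀ ∈ effDom φ₁)
    (h : dataEnergy φ₁ l I u₀ f < (δ : EReal)) :
    eLpNorm (conv l fun t => ‖f t‖ ^ 2) ⊤ (volume.restrict I) ≠ ⊤ ∧
    dataEnergy φ₁ l I u₀ f = (((φ₁ u₀).toReal
      + (eLpNorm (conv l fun t => ‖f t‖ ^ 2) ⊤ (volume.restrict I)).toReal : ℝ) : EReal) := by
  have hfin : eLpNorm (conv l fun t => ‖f t‖ ^ 2) ⊤ (volume.restrict I) ≠ ⊤ := by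
    intro htop
    rw [dataEnergy, htop, EReal.coe_ennreal_top, EReal.add_top_of_ne_bot (h₁.ne_bot _)] at h
    exact not_top_lt h
  refine ⟨hfin, ?_⟩
  rw [EReal.coe_add, h₁.coe_toReal hu₀, EReal.coe_ennreal_toReal hfin, dataEnergy]

theorem exists_global_solution_of_dataEnergy_lt [CompleteSpace H]
    (h₁ : ProperConvexLSC φ₁) (h₂ : ProperConvexLSC φ₂) (hnn : ∀ w, 0 ≤ φ₁ w)
    (hc : PrecompactSublevels φ₁) (hdom : subdiffDom φ₁ ⊆ subdiffDom φ₂) {ν ρ C : ℝ} (hν₀ : 0 ≤ ν)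
    (hν₁ : ν < 1) (hC : C = (1 + 1 / (2 * (1 - ν))) / (1 - ν))
    (hgrowth : ∀ w ∈ subdiffDom φ₁, φ₁ w ≤ (ρ : EReal) →
      ‖minSection φ₂ w‖ ≤ ν * ‖minSection φ₁ w‖)
    (hkl : ConjugateKernels k l) (hf : MemL2Loc f) (hu₀ : u₀ ∈ effDom φ₁)
    (hE : dataEnergy φ₁ l (Ioi 0) u₀ f < ((ρ / C : ℝ) : EReal)) :
    ∃ v : ℝ → H, IsGlobalStrongSolution φ₁ φ₂ k u₀ f v ∧ Continuous v ∧ v 0 = u₀ ∧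
      (∀ I, MemLInfty I fun t => φ₁ (v t)) ∧
      ∀ t, φ₁ (v t) ≤ (C : EReal) * dataEnergy φ₁ l (Ioi 0) u₀ f := by
  obtain ⟨hfin, hEeq⟩ := dataEnergy_eq_coe h₁ hu₀ hE
  set F := (eLpNorm (conv l fun t => ‖f t‖ ^ 2) ⊤ (volume.restrict (Ioi 0))).toReal with hF
  have hF0 : 0 ≤ F := ENNReal.toReal_nonneg
  have hφ0 : 0 ≤ (φ₁ u₀).toReal := EReal.toReal_nonneg (hnn u₀)
  have h1ν : 0 < 1 - ν := by linarith
  have hC0 : 0 < C := by rw [hC]; positivity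
  obtain ⟨g, hg, hfg⟩ := hf.aestronglyMeasurable
  have hgL := hf.congr hfg
  have hWF : ∀ᵐ t ∂volume.restrict (Ioi 0),
      ∫⁻ s, extKernel l (t - s) * extKernel (fun t => ‖g t‖ ^ 2) s ≤ ENNReal.ofReal F := by
    filter_upwards [hkl.isKernel_right.ae_lintegral_eq_enorm_conv hg hgL,
      ae_le_eLpNormEssSup (f := conv l fun t => ‖f t‖ ^ 2) (μ := volume.restrict (Ioi 0)),
      ae_restrict_mem measurableSet_Ioi] with t h1 h2 h3
    rw [h1, hF, ENNReal.ofReal_toReal hfin, eLpNorm_exponent_top]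
    rwa [conv_congr_ae (w' := fun t => ‖g t‖ ^ 2) le_rfl
      (ae_restrict_of_ae_restrict_of_subset Ioo_subset_Ioi_self
        (hfg.mono fun s hs => by simp only [hs])) (le_of_lt h3)] at h2
  set κ := 1 / (2 * (1 - ν)) with hκ
  have hκ0 : 0 ≤ κ := by positivity
  set e := (φ₁ u₀).toReal + F with he
  -- The a priori quantity Q is taken as (1 + κ) times the data energy e, so that Q/(1 - ν) = C e,
  -- and e < ρ/C is exactly the smallness required.
  have hQ : (φ₁ u₀).toReal + F / (2 * (1 - ν)) ≤ (1 + κ) * e := by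
    have : F / (2 * (1 - ν)) = κ * F := by rw [hκ]; ring
    rw [this, he]
    nlinarith
  have hCe : (1 + κ) * e / (1 - ν) = C * e := by rw [hC]; ring
  have hQρ : (1 + κ) * e / (1 - ν) ≤ ρ := by
    rw [hEeq, EReal.coe_lt_coe_iff, lt_div_iff₀ hC0] at hE
    rw [hCe]
    linarith
  obtain ⟨v, hv, hv0, hvR, hsol⟩ := exists_global_solution h₁ h₂ hnn hc hdom hν₀ hν₁ hgrowth hkl hg
    hF0 hWF hu₀ hQ hQρ
  refine ⟨v, hsol.congr_data hfg.symm, hv, hv0, memLInfty_of_continuous h₁ hnn hv hvR, fun t => ?_⟩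
  rw [hEeq, ← EReal.coe_mul, ← hCe]
  exact hvR t

end Reduction

end FracGradFlow

/-! ### The main theorem. -/

theorem theorem2p5 (ν₂ : ℝ) (hν₀ : 0 ≤ ν₂) (hν₁ : ν₂ < 1) :
    ∃ C : ℝ, 0 < C ∧
    ∀ m₂ M₂ : ℝ≥0 → ℝ≥0, FracGradFlow.AdmissibleGrowth m₂ M₂ →
    ∃ δ₀ : ℝ, 0 < δ₀ ∧
    ∀ (H : Type u) [NormedAddCommGroup H] [InnerProductSpace ℝ H] [CompleteSpace H]
      (φ₁ φ₂ : H → EReal) (k l : ℝ → ℝ),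
      FracGradFlow.ProperConvexLSC φ₁ → FracGradFlow.ProperConvexLSC φ₂ →
      FracGradFlow.ConjugateKernels k l →
      FracGradFlow.PrecompactSublevels φ₁ →
      FracGradFlow.GrowthCondition ν₂ m₂ M₂ φ₁ φ₂ →
      (∀ T : ℝ, 0 < T → ∀ u₀ ∈ FracGradFlow.effDom φ₁, ∀ f : ℝ → H,
        FracGradFlow.MemL2 T f →
        FracGradFlow.dataEnergy φ₁ l (Ioo 0 T) u₀ f < (δ₀ : EReal) →
        ∃ v : ℝ → H, FracGradFlow.IsStrongSolution φ₁ φ₂ k u₀ f T v ∧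
          ContinuousOn v (Icc 0 T) ∧ v 0 = u₀ ∧
          FracGradFlow.MemLInfty (Ioo 0 T) (fun t => φ₁ (v t)) ∧
          (⨆ t ∈ Icc 0 T, φ₁ (v t)) ≤
            (C : EReal) * FracGradFlow.dataEnergy φ₁ l (Ioo 0 T) u₀ f) ∧
      (∀ u₀ ∈ FracGradFlow.effDom φ₁, ∀ f : ℝ → H,
        FracGradFlow.MemL2Loc f →
        FracGradFlow.dataEnergy φ₁ l (Ioi 0) u₀ f < (δ₀ : EReal) →
        ∃ v : ℝ → H, FracGradFlow.IsGlobalStrongSolution φ₁ φ₂ k u₀ f v ∧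
          ContinuousOn v (Ici 0) ∧ v 0 = u₀ ∧
          FracGradFlow.MemLInfty (Ioi 0) (fun t => φ₁ (v t)) ∧
          (⨆ t ∈ Ici (0 : ℝ), φ₁ (v t)) ≤
            (C : EReal) * FracGradFlow.dataEnergy φ₁ l (Ioi 0) u₀ f) := by
  -- The midpoint of ν₂ and 1: the gap (1 - ν₂)/2 pays for the absorption of M₂, and C still depends
  -- on ν₂ alone.
  set ν : ℝ := (1 + ν₂) / 2 with hν
  have hν' : ν < 1 := by linarith
  have hν'' : 0 ≤ ν := by linarith
  have h1ν : 0 < 1 - ν := by linarith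
  set C : ℝ := (1 + 1 / (2 * (1 - ν))) / (1 - ν) with hC
  have hC0 : 0 < C := by positivity
  refine ⟨C, hC0, fun m₂ M₂ hadm => ?_⟩
  obtain ⟨ρ, hρ, hMρ⟩ := hadm.exists_le_mul (ε := (1 - ν₂) / 2) (by linarith)
  refine ⟨ρ / C, by positivity, ?_⟩
  intro H _ _ _ φ₁ φ₂ k l h₁ h₂ hkl hc hgr
  have hgrowth : ∀ w ∈ FracGradFlow.subdiffDom φ₁, φ₁ w ≤ (ρ : EReal) →
      ‖FracGradFlow.minSection φ₂ w‖ ≤ ν * ‖FracGradFlow.minSection φ₁ w‖ := fun w hw hwρ => by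
    have := hgr.norm_minSection_le (ε := (1 - ν₂) / 2) (by linarith) hMρ hw hwρ
    rwa [show ν₂ + (1 - ν₂) / 2 = ν by rw [hν]; ring] at this
  refine ⟨fun T hT u₀ hu₀ f hf hE => ?_, fun u₀ hu₀ f hf hE => ?_⟩
  -- Extension by zero does not increase the energy, so the finite-horizon solution is the
  -- restriction of a global one.
  · have hle : FracGradFlow.dataEnergy φ₁ l (Ioi 0) u₀ ((Ioo 0 T).indicator f)
        ≤ FracGradFlow.dataEnergy φ₁ l (Ioo 0 T) u₀ f :=
      add_le_add_right (EReal.coe_ennreal_le_coe_ennreal_iff.mpr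
        (hkl.isKernel_right.eLpNorm_conv_indicator_le hT hf)) _
    have hfL : FracGradFlow.MemL2Loc ((Ioo 0 T).indicator f) := fun S _ =>
      ((memLp_indicator_iff_restrict measurableSet_Ioo).mpr hf).mono_measure
        Measure.restrict_le_self
    obtain ⟨v, hsol, hv, hv0, hL, hb⟩ := FracGradFlow.exists_global_solution_of_dataEnergy_lt h₁ h₂
      hgr.nonneg hc hgr.dom_subset hν'' hν' hC hgrowth hkl hfL hu₀ (hle.trans_lt hE)
    exact ⟨v, hsol.isStrongSolution hT, hv.continuousOn, hv0, hL _, iSup₂_le fun t _ =>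
      (hb t).trans (mul_le_mul_of_nonneg_left hle (EReal.coe_nonneg.mpr hC0.le))⟩
  · obtain ⟨v, hsol, hv, hv0, hL, hb⟩ := FracGradFlow.exists_global_solution_of_dataEnergy_lt h₁ h₂
      hgr.nonneg hc hgr.dom_subset hν'' hν' hC hgrowth hkl hf hu₀ hE
    exact ⟨v, hsol, hv.continuousOn, hv0, hL _, iSup₂_le fun t _ => hb t⟩
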